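/- For integers $m\ge n\ge 1$ let $\mathcal T_{n,m}$ be the Babuška–Aziz (Schwarz) triangulation of the unit square $[0,1]^2$ cut out by the lines $y=\frac{j}{2m}$ ($1\le j\le 2m-1$), $y=\frac nm x+\frac jm$ ($1-m\le j\le m-1$) and $y=-\frac nm x+\frac jm$ ($1\le j\le 2m-1$). Let $V_{n,m}$ be the nonconforming P1 (Crouzeix–Raviart) space: all functions that are linear polynomials on each triangle of $\mathcal T_{n,m}$, whose integrals along every interior edge agree from both sides, and whose integrals along every boundary edge vanish. Write $(v,w)_{n,m}=\sum_{\Delta\in\mathcal T_{n,m}}\int_\Delta\nabla v\cdot\nabla w\,dx\,dy$ and $|v|_{n,m}=(v,v)_{n,m}^{1/2}$ (the discrete $H^1$ norm). Let $u(x,y)=x(1-x)y(1-y)$, the solution of $-\Delta u=f:=2(x(1-x)+y(1-y))$ on $[0,1]^2$ with zero boundary values. Then for all $m\ge n\ge1$ there is a unique Galerkin solution $u_{n,m}\in V_{n,m}$, i.e. $(u_{n,m},w)_{n,m}=\int_{[0,1]^2} f w\,dx\,dy$ for all $w\in V_{n,m}$, and, with $E_{n,m}=|u-u_{n,m}|_{n,m}$: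 (i) there are constants $C,C'>0$, independent of $n$ and $m$, such that $$C'\min\Big(1,\frac m{n^2}\Big)\le E_{n,m}\le C\min\Big(1,\frac m{n^2}\Big)\qquad\text{for all } m\ge n\ge1;$$ (ii) consequently, if $m_l\ge n_l\ge 1$, $n_l\to\infty$ and $E_{n_l,m_l}\to0$ as $l\to\infty$, then $m_l/n_l^2\to0$; (iii) the loss of convergence is due to the consistency error and not to the best approximation error: there are constants $C_1,C_1'>0$ with $$\frac{C_1'}{n}\le\inf_{v\in V_{n,m}}|u-v|_{n,m}\le\frac{C_1}n\qquad\text{for all } m\ge n\ge1,$$ whereas the consistency error $E^{C}_{n,m}=\sup\{|(u,w)_{n,m}-\int_{[0,1]^2} f w\,dx\,dy| : w\in V_{n,m},\ |w|_{n,m}=1\}$ satisfies, with constants $C_2,C_2'>0$, $K$ and $n_0$, the bounds $E^{C}_{n,m}\le C_2\min(1,m/n^2)$ for all $m\ge n\ge1$ and $E^{C}_{n,m}\ge C_2'\min(1,m/n^2)$ for all $m\ge n\ge n_0$ with $m\ge Kn$. -/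

import Mathlib

open MeasureTheory Filter Topology

noncomputable section

namespace NonconformingP1

/-- The plane; only its linear, topological and measure structure is used (Euclidean lengths are
written out in coordinates). -/
abbrev Plane : Type := ℝ × ℝ

/-- The partial derivative `g_x`. -/
def dx (g : Plane → ℝ) (p : Plane) : ℝ := fderiv ℝ g p (1, 0)

/-- The partial derivative `g_y`. -/
def dy (g : Plane → ℝ) (p : Plane) : ℝ := fderiv ℝ g p (0, 1)

/-- The line integral `∫_e g ds` over the segment `e` from `a` to `b` (`ds` is arc length). -/
def edgeIntegral (g : Plane → ℝ) (a b : Plane) : ℝ :=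
  Real.sqrt ((b.1 - a.1) ^ 2 + (b.2 - a.2) ^ 2) *
    ∫ t in (0 : ℝ)..1, g (AffineMap.lineMap a b t)

section Triangulation

/-! A triangulation is given by a finite family `T` of triangles, each by its three vertices. -/

variable {ι : Type}

/-- The closed triangle with index `i`. -/
def triangle (T : ι → Fin 3 → Plane) (i : ι) : Set Plane := convexHull ℝ (Set.range (T i))

/-- The edge of triangle `i` opposite to its vertex `k`, as an unordered pair of end points. -/
def edge (T : ι → Fin 3 → Plane) (i : ι) (k : Fin 3) : Sym2 Plane := s(T i (k + 1), T i (k + 2))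

/-- The integral of `g` along the edge of triangle `i` opposite to its vertex `k`. -/
def integralOnEdge (T : ι → Fin 3 → Plane) (i : ι) (k : Fin 3) (g : Plane → ℝ) : ℝ :=
  edgeIntegral g (T i (k + 1)) (T i (k + 2))

/-- A boundary edge: an edge that belongs to one triangle only. -/
def IsBoundaryEdge (T : ι → Fin 3 → Plane) (i : ι) (k : Fin 3) : Prop :=
  ∀ i₂ k₂, edge T i₂ k₂ = edge T i k → i₂ = i

/-- The space `V_T` of nonconforming P1 (Crouzeix–Raviart) elements with homogeneous Dirichlet
boundary conditions. An element is a family of linear polynomials, one on each triangle, such that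
the integrals along an interior edge agree from both sides, and the integrals along boundary edges
vanish. -/
def crouzeixRaviart (T : ι → Fin 3 → Plane) : Set (ι → (Plane →ᵃ[ℝ] ℝ)) :=
  {v | (∀ i i₂ k k₂, i ≠ i₂ → edge T i k = edge T i₂ k₂ →
          integralOnEdge T i k (v i) = integralOnEdge T i₂ k₂ (v i₂)) ∧
       (∀ i k, IsBoundaryEdge T i k → integralOnEdge T i k (v i) = 0)}

/-- The function family underlying an element of `V_T`. -/
def pieces (v : ι → (Plane →ᵃ[ℝ] ℝ)) : ι → Plane → ℝ := fun i p => v i p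

variable [Fintype ι]

/-- The scalar product `(g, h)_{H¹,T} = ∑_Δ ∫_Δ ∇g · ∇h` of piecewise smooth functions, which are
given by one smooth function on the plane for each triangle. -/
def brokenInner (T : ι → Fin 3 → Plane) (g h : ι → Plane → ℝ) : ℝ :=
  ∑ i, ∫ p in triangle T i, (dx (g i) p * dx (h i) p + dy (g i) p * dy (h i) p)

/-- The discrete (broken) `H¹` norm `|g|_{H¹,T}`. -/
def brokenNorm (T : ι → Fin 3 → Plane) (g : ι → Plane → ℝ) : ℝ :=
  Real.sqrt (∑ i, ∫ p in triangle T i, ((dx (g i) p) ^ 2 + (dy (g i) p) ^ 2))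

/-- The scalar product `(f, h)_{L₂}` with a piecewise defined `h`. -/
def load (T : ι → Fin 3 → Plane) (f : Plane → ℝ) (h : ι → Plane → ℝ) : ℝ :=
  ∑ i, ∫ p in triangle T i, f p * h i p

/-- `v` is a Galerkin solution in `V_T` of `-Δu = f` with zero boundary values. -/
def IsGalerkinSolution (T : ι → Fin 3 → Plane) (f : Plane → ℝ) (v : ι → (Plane →ᵃ[ℝ] ℝ)) : Prop :=
  v ∈ crouzeixRaviart T ∧
    ∀ w ∈ crouzeixRaviart T, brokenInner T (pieces v) (pieces w) = load T f (pieces w)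

/-- The error `|u - v|_{H¹,T}`. -/
def brokenError (T : ι → Fin 3 → Plane) (u : Plane → ℝ) (v : ι → (Plane →ᵃ[ℝ] ℝ)) : ℝ :=
  brokenNorm T (fun i p => u p - v i p)

/-- The best approximation error `inf {|u - v|_{H¹,T} : v ∈ V_T}`. -/
def bestApproxError (T : ι → Fin 3 → Plane) (u : Plane → ℝ) : ℝ :=
  sInf {r | ∃ v ∈ crouzeixRaviart T, r = brokenError T u v}

/-- The consistency error
`sup {|(u, w)_{H¹,T} - (f, w)_{L₂}| : w ∈ V_T, |w|_{H¹,T} = 1}`. -/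
def consistencyError (T : ι → Fin 3 → Plane) (u f : Plane → ℝ) : ℝ :=
  sSup {r | ∃ w ∈ crouzeixRaviart T, brokenNorm T (pieces w) = 1 ∧
    r = |brokenInner T (fun _ => u) (pieces w) - load T f (pieces w)|}

end Triangulation

/-- The grid point `P_{i,j} = (i / (2n), j / (2m))`. -/
def gridPoint (n m i j : ℕ) : Plane := ((i : ℝ) / (2 * n), (j : ℝ) / (2 * m))

/-- The Babuška–Aziz (Schwarz) triangulation `T_{n,m}` of the unit square. For `j < 2m`, the strip
between the lines `y = j / (2m)` and `y = (j+1) / (2m)` is bounded by one line with even index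
`2 * ((j + 1) / 2)` and one with odd index `2 * (j / 2) + 1` (with division in `ℕ`). It consists of
`n` triangles whose horizontal edge lies on the even line and `n + 1` triangles whose horizontal
edge lies on the odd line; the first and the last of the latter (where `2 * a - 1` is truncated to
`0` in `ℕ`, and `2 * a + 1` is cut down to `2 * n`) are the right-angled ones at the vertical sides
of the square. -/
def babuskaAziz (n m : ℕ) : Fin (2 * m) × (Fin n ⊕ Fin (n + 1)) → Fin 3 → Plane
  | (j, Sum.inl a) =>
      ![gridPoint n m (2 * a) (2 * ((j + 1) / 2)),
        gridPoint n m (2 * a + 2) (2 * ((j + 1) / 2)),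
        gridPoint n m (2 * a + 1) (2 * (j / 2) + 1)]
  | (j, Sum.inr a) =>
      ![gridPoint n m (2 * a - 1) (2 * (j / 2) + 1),
        gridPoint n m (min (2 * a + 1) (2 * n)) (2 * (j / 2) + 1),
        gridPoint n m (2 * a) (2 * ((j + 1) / 2))]

/-- The solution `u(x,y) = x(1-x)y(1-y)` of the model problem. -/
def modelU (p : Plane) : ℝ := p.1 * (1 - p.1) * (p.2 * (1 - p.2))

/-- The right-hand side `f = -Δu = 2(x(1-x) + y(1-y))` of the model problem. -/
def modelF (p : Plane) : ℝ := 2 * (p.1 * (1 - p.1) + p.2 * (1 - p.2))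

end NonconformingP1

end

/-! Strang's second lemma splits the error into best approximation and consistency. The
Crouzeix–Raviart interpolant reproduces edge means, so its gradient is the mean gradient on each
triangle and the best approximation error has order `1 / n`. Integrating by parts, the consistency
term becomes a sum over the triangles of slopes of `w` times first moments of `∂u/∂ν` along the
edges. Each moment is at most of order `1 / n³`, and at most `6nm` triangles give an upper bound of
order `m / n²`. For the lower bound, prescribe at the edge midpoints a function that oscillates from
one leg to the next with an amplitude vanishing at the vertical sides: the leading contributions of
the triangles then add up with the same sign to `m / n²`, while the norm stays below
`max(1, m / n²)`. -/

noncomputable section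

namespace NonconformingP1

section AffineFunctions

/-- The constant partial derivative in `x` of an affine function. -/
def slopeX (w : Plane →ᵃ[ℝ] ℝ) : ℝ := w.linear (1, 0)

/-- The constant partial derivative in `y` of an affine function. -/
def slopeY (w : Plane →ᵃ[ℝ] ℝ) : ℝ := w.linear (0, 1)

theorem linear_eq_slopes (w : Plane →ᵃ[ℝ] ℝ) (z : Plane) :
    w.linear z = slopeX w * z.1 + slopeY w * z.2 := by
  have hz : z = z.1 • ((1, 0) : Plane) + z.2 • ((0, 1) : Plane) := by ext <;> simp
  conv_lhs => rw [hz]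
  rw [map_add, map_smul, map_smul, slopeX, slopeY, smul_eq_mul, smul_eq_mul]
  ring

theorem affine_sub_eq (w : Plane →ᵃ[ℝ] ℝ) (z z' : Plane) :
    w z - w z' = slopeX w * (z.1 - z'.1) + slopeY w * (z.2 - z'.2) := by
  rw [← vsub_eq_sub, ← AffineMap.linearMap_vsub, linear_eq_slopes]
  rfl

theorem contDiff_affine (w : Plane →ᵃ[ℝ] ℝ) : ContDiff ℝ 1 w :=
  (⟨w, w.continuous_of_finiteDimensional⟩ : Plane →ᴬ[ℝ] ℝ).contDiff

theorem hasFDerivAt_affine (w : Plane →ᵃ[ℝ] ℝ) (z : Plane) :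
    HasFDerivAt w (LinearMap.toContinuousLinearMap w.linear) z := by
  have hw : (w : Plane → ℝ) = fun z => LinearMap.toContinuousLinearMap w.linear z + w 0 :=
    AffineMap.decomp w
  rw [hw]
  exact (ContinuousLinearMap.hasFDerivAt _).add_const _

@[simp] theorem dx_affine (w : Plane →ᵃ[ℝ] ℝ) (z : Plane) : dx w z = slopeX w := by
  simp [dx, slopeX, (hasFDerivAt_affine w z).fderiv]

@[simp] theorem dy_affine (w : Plane →ᵃ[ℝ] ℝ) (z : Plane) : dy w z = slopeY w := by
  simp [dy, slopeY, (hasFDerivAt_affine w z).fderiv]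

/-- The affine function `α + β x + γ y`. -/
def affineOfCoeffs (α β γ : ℝ) : Plane →ᵃ[ℝ] ℝ :=
  AffineMap.const ℝ Plane α +
    (β • LinearMap.fst ℝ ℝ ℝ + γ • LinearMap.snd ℝ ℝ ℝ).toAffineMap

@[simp] theorem affineOfCoeffs_apply (α β γ : ℝ) (z : Plane) :
    affineOfCoeffs α β γ z = α + (β * z.1 + γ * z.2) := rfl

end AffineFunctions

section PartialDerivatives

variable {g h : Plane → ℝ} {p : Plane}

theorem dx_add (hg : DifferentiableAt ℝ g p) (hh : DifferentiableAt ℝ h p) :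
    dx (g + h) p = dx g p + dx h p := by
  simp [dx, fderiv_add hg hh]

theorem dy_add (hg : DifferentiableAt ℝ g p) (hh : DifferentiableAt ℝ h p) :
    dy (g + h) p = dy g p + dy h p := by
  simp [dy, fderiv_add hg hh]

theorem dx_sub (hg : DifferentiableAt ℝ g p) (hh : DifferentiableAt ℝ h p) :
    dx (g - h) p = dx g p - dx h p := by
  simp [dx, fderiv_sub hg hh]

theorem dy_sub (hg : DifferentiableAt ℝ g p) (hh : DifferentiableAt ℝ h p) :
    dy (g - h) p = dy g p - dy h p := by
  simp [dy, fderiv_sub hg hh]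

theorem dx_smul (c : ℝ) (hg : DifferentiableAt ℝ g p) : dx (c • g) p = c * dx g p := by
  simp [dx, fderiv_const_smul hg]

theorem dy_smul (c : ℝ) (hg : DifferentiableAt ℝ g p) : dy (c • g) p = c * dy g p := by
  simp [dy, fderiv_const_smul hg]

theorem dx_mul (hg : DifferentiableAt ℝ g p) (hh : DifferentiableAt ℝ h p) :
    dx (g * h) p = dx g p * h p + g p * dx h p := by
  simp [dx, fderiv_mul hg hh]
  ring

theorem dy_mul (hg : DifferentiableAt ℝ g p) (hh : DifferentiableAt ℝ h p) :
    dy (g * h) p = dy g p * h p + g p * dy h p := by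
  simp [dy, fderiv_mul hg hh]
  ring

theorem fderiv_eq_dx_dy (g : Plane → ℝ) (p z : Plane) :
    fderiv ℝ g p z = z.1 * dx g p + z.2 * dy g p := by
  have hz : z = z.1 • ((1, 0) : Plane) + z.2 • ((0, 1) : Plane) := by ext <;> simp
  conv_lhs => rw [hz]
  rw [map_add, map_smul, map_smul, smul_eq_mul, smul_eq_mul, dx, dy]

theorem continuous_dx (hg : ContDiff ℝ 1 g) : Continuous (dx g) :=
  (hg.continuous_fderiv one_ne_zero).clm_apply continuous_const

theorem continuous_dy (hg : ContDiff ℝ 1 g) : Continuous (dy g) :=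
  (hg.continuous_fderiv one_ne_zero).clm_apply continuous_const

end PartialDerivatives

section TriangleIntegrals

variable {P : Fin 3 → Plane} {f g : Plane → ℝ}

/-- Twice the signed area of the triangle with vertices `P 0`, `P 1`, `P 2`; it is positive when
they are numbered counterclockwise. -/
def signedDoubleArea (P : Fin 3 → Plane) : ℝ :=
  (P 1 - P 0).1 * (P 2 - P 0).2 - (P 2 - P 0).1 * (P 1 - P 0).2

/-- The mean value of `g` over the segment from `a` to `b`. -/
def edgeMean (g : Plane → ℝ) (a b : Plane) : ℝ :=
  ∫ t in (0 : ℝ)..1, g (AffineMap.lineMap a b t)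

theorem edgeMean_symm (g : Plane → ℝ) (a b : Plane) : edgeMean g a b = edgeMean g b a := by
  have h := intervalIntegral.integral_comp_sub_left (a := (0 : ℝ)) (b := 1)
    (fun t => g (AffineMap.lineMap b a t)) 1
  simp only [AffineMap.lineMap_apply_one_sub, sub_self, sub_zero] at h
  exact h

/-- The affine parametrization of the triangle with vertices `P k` by the reference triangle
`0 ≤ x, 0 ≤ y, x + y ≤ 1`. -/
def trianglePoint (P : Fin 3 → Plane) (z : Plane) : Plane :=
  P 0 + z.1 • (P 1 - P 0) + z.2 • (P 2 - P 0)

theorem continuous_trianglePoint (P : Fin 3 → Plane) : Continuous (trianglePoint P) := by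
  unfold trianglePoint
  fun_prop

theorem convexHull_range_eq_image_trianglePoint (P : Fin 3 → Plane) :
    convexHull ℝ (Set.range P) =
      trianglePoint P '' {z | 0 ≤ z.1 ∧ 0 ≤ z.2 ∧ z.1 + z.2 ≤ 1} := by
  have hP : Set.range P = Fintype.linearCombination ℝ P ''
      Set.range fun (i j : Fin 3) => if i = j then (1 : ℝ) else 0 := by
    rw [← Set.range_comp]
    congr 1
    ext i <;> simp [Fintype.linearCombination_apply]
  rw [hP, ← LinearMap.image_convexHull, convexHull_basis_eq_stdSimplex]
  ext z
  constructor
  · rintro ⟨a, ⟨ha, hsum⟩, rfl⟩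
    rw [Fin.sum_univ_three] at hsum
    refine ⟨(a 1, a 2), ⟨ha 1, ha 2, by linarith [ha 0]⟩, ?_⟩
    rw [Fintype.linearCombination_apply, Fin.sum_univ_three,
      show a 0 = 1 - a 1 - a 2 by linarith]
    simp only [trianglePoint]
    module
  · rintro ⟨a, ⟨h1, h2, h12⟩, rfl⟩
    refine ⟨![1 - a.1 - a.2, a.1, a.2], ⟨?_, ?_⟩, ?_⟩
    · intro i
      fin_cases i <;> simp <;> linarith
    · simp only [Fin.sum_univ_three, Matrix.cons_val]
      ring
    · rw [Fintype.linearCombination_apply, Fin.sum_univ_three]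
      simp only [trianglePoint, Matrix.cons_val]
      module

/-- The linear part of `trianglePoint P`. -/
def triangleFrame (P : Fin 3 → Plane) : Plane →L[ℝ] Plane :=
  (ContinuousLinearMap.fst ℝ ℝ ℝ).smulRight (P 1 - P 0) +
    (ContinuousLinearMap.snd ℝ ℝ ℝ).smulRight (P 2 - P 0)

theorem det_triangleFrame (P : Fin 3 → Plane) : (triangleFrame P).det = signedDoubleArea P := by
  rw [ContinuousLinearMap.det, ← LinearMap.det_toMatrix (Module.Basis.finTwoProd ℝ),
    Matrix.det_fin_two]
  simp [LinearMap.toMatrix_apply, triangleFrame, signedDoubleArea]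

theorem hasFDerivAt_trianglePoint (P : Fin 3 → Plane) (z : Plane) :
    HasFDerivAt (trianglePoint P) (triangleFrame P) z := by
  have h : trianglePoint P = fun z => P 0 + triangleFrame P z := by
    ext z <;> simp [trianglePoint, triangleFrame] <;> ring
  rw [h]
  exact (triangleFrame P).hasFDerivAt.const_add _

theorem trianglePoint_injective (hP : signedDoubleArea P ≠ 0) :
    Function.Injective (trianglePoint P) := by
  intro z z' h
  simp only [trianglePoint, Prod.ext_iff, Prod.fst_add, Prod.snd_add, Prod.smul_fst,
    Prod.smul_snd, smul_eq_mul] at h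
  obtain ⟨h1, h2⟩ := h
  have hx : signedDoubleArea P * (z.1 - z'.1) = 0 := by
    unfold signedDoubleArea
    linear_combination (P 2 - P 0).2 * h1 - (P 2 - P 0).1 * h2
  have hy : signedDoubleArea P * (z.2 - z'.2) = 0 := by
    unfold signedDoubleArea
    linear_combination (P 1 - P 0).1 * h2 - (P 1 - P 0).2 * h1
  exact Prod.ext (sub_eq_zero.1 ((mul_eq_zero.1 hx).resolve_left hP))
    (sub_eq_zero.1 ((mul_eq_zero.1 hy).resolve_left hP))

theorem isCompact_referenceTriangle :
    IsCompact {z : Plane | 0 ≤ z.1 ∧ 0 ≤ z.2 ∧ z.1 + z.2 ≤ 1} := by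
  refine (isCompact_Icc (a := ((0, 0) : Plane)) (b := (1, 1))).of_isClosed_subset ?_ ?_
  · exact (isClosed_le continuous_const continuous_fst).inter
      ((isClosed_le continuous_const continuous_snd).inter
        (isClosed_le (continuous_fst.add continuous_snd) continuous_const))
  · rintro z ⟨h1, h2, h12⟩
    exact ⟨⟨h1, h2⟩, ⟨by dsimp only; linarith, by dsimp only; linarith⟩⟩

theorem setIntegral_referenceTriangle (hf : Continuous f) :
    ∫ z in {z : Plane | 0 ≤ z.1 ∧ 0 ≤ z.2 ∧ z.1 + z.2 ≤ 1}, f z =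
      ∫ t in (0 : ℝ)..1, ∫ s in (0 : ℝ)..1 - t, f (s, t) := by
  set R : Set Plane := {z | 0 ≤ z.1 ∧ 0 ≤ z.2 ∧ z.1 + z.2 ≤ 1} with hR
  have hRm : MeasurableSet R := isCompact_referenceTriangle.measurableSet
  have hint : Integrable (R.indicator f) := (integrable_indicator_iff hRm).2
    (hf.continuousOn.integrableOn_compact isCompact_referenceTriangle)
  rw [← integral_indicator hRm, Measure.volume_eq_prod, integral_prod_symm _ hint,
    intervalIntegral.integral_of_le zero_le_one, ← integral_Icc_eq_integral_Ioc,
    ← integral_indicator measurableSet_Icc]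
  congr 1 with t
  by_cases ht : t ∈ Set.Icc (0 : ℝ) 1
  · have hslice : ∀ s, R.indicator f (s, t) =
        (Set.Icc 0 (1 - t)).indicator (fun s => f (s, t)) s := by
      intro s
      simp only [Set.indicator_apply, hR, Set.mem_ofPred_eq, Set.mem_Icc, ht.1, true_and,
        le_sub_iff_add_le]
    simp_rw [hslice]
    rw [integral_indicator measurableSet_Icc, integral_Icc_eq_integral_Ioc,
      Set.indicator_of_mem ht, intervalIntegral.integral_of_le (sub_nonneg.2 ht.2)]
  · have hslice : ∀ s, R.indicator f (s, t) = 0 := fun s => Set.indicator_of_notMem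
      (fun h => ht ⟨h.2.1, by linarith [h.1, h.2.2]⟩) _
    simp_rw [hslice, integral_zero, Set.indicator_of_notMem ht]

theorem setIntegral_convexHull_triangle (hP : signedDoubleArea P ≠ 0) (hf : Continuous f) :
    ∫ z in convexHull ℝ (Set.range P), f z = |signedDoubleArea P| *
      ∫ t in (0 : ℝ)..1, ∫ s in (0 : ℝ)..1 - t, f (trianglePoint P (s, t)) := by
  rw [convexHull_range_eq_image_trianglePoint,
    integral_image_eq_integral_abs_det_fderiv_smul volume
      isCompact_referenceTriangle.measurableSet
      (fun z _ => (hasFDerivAt_trianglePoint P z).hasFDerivWithinAt)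
      (trianglePoint_injective hP).injOn]
  simp_rw [det_triangleFrame, smul_eq_mul]
  rw [integral_const_mul,
    setIntegral_referenceTriangle (f := fun z => f (trianglePoint P z))
      (hf.comp (continuous_trianglePoint P))]

end TriangleIntegrals

section DivergenceTheorem

variable {P : Fin 3 → Plane} {f g : Plane → ℝ}

theorem isCompact_convexHull_range (P : Fin 3 → Plane) :
    IsCompact (convexHull ℝ (Set.range P)) :=
  (Set.finite_range P).isCompact_convexHull ℝ

theorem integrableOn_convexHull_range (P : Fin 3 → Plane) (hf : Continuous f) :
    IntegrableOn f (convexHull ℝ (Set.range P)) :=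
  hf.continuousOn.integrableOn_compact (isCompact_convexHull_range P)

theorem setIntegral_triangle_fderiv (hP : signedDoubleArea P ≠ 0) (hg : ContDiff ℝ 1 g) :
    ∫ z in convexHull ℝ (Set.range P), fderiv ℝ g z (P 1 - P 0) = |signedDoubleArea P| *
      (edgeMean g (P 1) (P 2) - edgeMean g (P 0) (P 2)) := by
  have hcont : ∀ a b : Plane, Continuous fun t : ℝ => g (AffineMap.lineMap a b t) := fun a b =>
    hg.continuous.comp AffineMap.lineMap_continuous
  rw [setIntegral_convexHull_triangle hP
    ((hg.continuous_fderiv one_ne_zero).clm_apply continuous_const), edgeMean, edgeMean,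
    ← intervalIntegral.integral_sub ((hcont _ _).intervalIntegrable _ _)
      ((hcont _ _).intervalIntegrable _ _)]
  congr 1
  refine intervalIntegral.integral_congr fun t _ => ?_
  have hderiv : ∀ s : ℝ, HasDerivAt (fun s => g (trianglePoint P (s, t)))
      (fderiv ℝ g (trianglePoint P (s, t)) (P 1 - P 0)) s := by
    intro s
    have hpath : HasDerivAt (fun s : ℝ => trianglePoint P (s, t)) (P 1 - P 0) s := by
      have h := (((hasDerivAt_id s).smul_const (P 1 - P 0)).const_add (P 0)).add_const
        (t • (P 2 - P 0))
      rwa [one_smul] at h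
    exact (hg.differentiable one_ne_zero _).hasFDerivAt.comp_hasDerivAt s hpath
  rw [intervalIntegral.integral_eq_sub_of_hasDerivAt (fun s _ => hderiv s)
    (((hg.continuous_fderiv one_ne_zero).comp ((continuous_trianglePoint P).comp
      (continuous_id.prodMk continuous_const))).clm_apply continuous_const
      |>.intervalIntegrable _ _)]
  congr 2 <;> simp only [trianglePoint, AffineMap.lineMap_apply_module] <;> module

theorem setIntegral_triangle_fderiv' (hP : signedDoubleArea P ≠ 0) (hg : ContDiff ℝ 1 g) :
    ∫ z in convexHull ℝ (Set.range P), fderiv ℝ g z (P 2 - P 0) = |signedDoubleArea P| *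
      (edgeMean g (P 1) (P 2) - edgeMean g (P 0) (P 1)) := by
  set Q : Fin 3 → Plane := P ∘ Equiv.swap 1 2
  have hrange : Set.range Q = Set.range P := (Equiv.swap 1 2).surjective.range_comp P
  have hQ : signedDoubleArea Q = -signedDoubleArea P := by
    simp only [signedDoubleArea, Q, Function.comp_apply, Equiv.swap_apply_left,
      Equiv.swap_apply_right, Equiv.swap_apply_of_ne_of_ne (show (0 : Fin 3) ≠ 1 by decide)
        (show (0 : Fin 3) ≠ 2 by decide)]
    ring
  have h := setIntegral_triangle_fderiv (P := Q) (hQ ▸ neg_ne_zero.2 hP) hg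
  rw [hrange, hQ, abs_neg] at h
  simpa [Q, edgeMean_symm g (P 2) (P 1), Equiv.swap_apply_of_ne_of_ne] using h

theorem signedDoubleArea_smul_dx (P : Fin 3 → Plane) (g : Plane → ℝ) (z : Plane) :
    signedDoubleArea P * dx g z = (P 2 - P 0).2 * fderiv ℝ g z (P 1 - P 0) -
      (P 1 - P 0).2 * fderiv ℝ g z (P 2 - P 0) := by
  rw [fderiv_eq_dx_dy, fderiv_eq_dx_dy, signedDoubleArea]
  ring

theorem signedDoubleArea_smul_dy (P : Fin 3 → Plane) (g : Plane → ℝ) (z : Plane) :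
    signedDoubleArea P * dy g z = (P 1 - P 0).1 * fderiv ℝ g z (P 2 - P 0) -
      (P 2 - P 0).1 * fderiv ℝ g z (P 1 - P 0) := by
  rw [fderiv_eq_dx_dy, fderiv_eq_dx_dy, signedDoubleArea]
  ring

theorem integrableOn_triangle_fderiv (P : Fin 3 → Plane) (hg : ContDiff ℝ 1 g) (a : Plane) :
    IntegrableOn (fun z => fderiv ℝ g z a) (convexHull ℝ (Set.range P)) :=
  integrableOn_convexHull_range P ((hg.continuous_fderiv one_ne_zero).clm_apply continuous_const)

theorem eq_sign_mul_of_mul_eq_abs_mul {D x y : ℝ} (hD : D ≠ 0) (h : D * x = |D| * y) :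
    x = SignType.sign D * y := by
  refine mul_left_cancel₀ hD ?_
  rw [h, ← sign_mul_self D]
  ring

theorem setIntegral_triangle_dx (hP : signedDoubleArea P ≠ 0) (hg : ContDiff ℝ 1 g) :
    ∫ z in convexHull ℝ (Set.range P), dx g z = SignType.sign (signedDoubleArea P) *
      ∑ k : Fin 3, (P (k + 2) - P (k + 1)).2 * edgeMean g (P (k + 1)) (P (k + 2)) := by
  refine eq_sign_mul_of_mul_eq_abs_mul hP ?_
  rw [← integral_const_mul]
  simp_rw [signedDoubleArea_smul_dx]
  rw [integral_sub ((integrableOn_triangle_fderiv P hg _).const_mul _)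
      ((integrableOn_triangle_fderiv P hg _).const_mul _), integral_const_mul, integral_const_mul,
    setIntegral_triangle_fderiv hP hg, setIntegral_triangle_fderiv' hP hg, Fin.sum_univ_three]
  simp only [Fin.reduceAdd, zero_add, edgeMean_symm g (P 2) (P 0), Prod.snd_sub]
  ring

theorem setIntegral_triangle_dy (hP : signedDoubleArea P ≠ 0) (hg : ContDiff ℝ 1 g) :
    ∫ z in convexHull ℝ (Set.range P), dy g z = SignType.sign (signedDoubleArea P) *
      ∑ k : Fin 3, -((P (k + 2) - P (k + 1)).1 * edgeMean g (P (k + 1)) (P (k + 2))) := by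
  refine eq_sign_mul_of_mul_eq_abs_mul hP ?_
  rw [← integral_const_mul]
  simp_rw [signedDoubleArea_smul_dy]
  rw [integral_sub ((integrableOn_triangle_fderiv P hg _).const_mul _)
      ((integrableOn_triangle_fderiv P hg _).const_mul _), integral_const_mul, integral_const_mul,
    setIntegral_triangle_fderiv hP hg, setIntegral_triangle_fderiv' hP hg, Fin.sum_univ_three]
  simp only [Fin.reduceAdd, zero_add, edgeMean_symm g (P 2) (P 0), Prod.fst_sub]
  ring

/-- The flux density of the field `(F, G)` through the segment from `a` to `b`, at the point with
parameter `t ∈ [0, 1]`: the field is paired with the normal `(b.2 - a.2, -(b.1 - a.1))`, which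
points to the right of the direction of travel and has the length of the segment. -/
def normalFlux (F G : Plane → ℝ) (a b : Plane) (t : ℝ) : ℝ :=
  (b - a).2 * F (AffineMap.lineMap a b t) - (b - a).1 * G (AffineMap.lineMap a b t)

theorem continuous_normalFlux {F G : Plane → ℝ} (hF : Continuous F) (hG : Continuous G)
    (a b : Plane) : Continuous (normalFlux F G a b) :=
  (continuous_const.mul (hF.comp AffineMap.lineMap_continuous)).sub
    (continuous_const.mul (hG.comp AffineMap.lineMap_continuous))

/-- The divergence theorem on a triangle. The sign accounts for the orientation of the boundary
induced by the numbering of the vertices. -/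
theorem setIntegral_triangle_div {F G : Plane → ℝ} (hP : signedDoubleArea P ≠ 0)
    (hF : ContDiff ℝ 1 F) (hG : ContDiff ℝ 1 G) :
    ∫ z in convexHull ℝ (Set.range P), (dx F z + dy G z) = SignType.sign (signedDoubleArea P) *
      ∑ k : Fin 3, ∫ t in (0 : ℝ)..1, normalFlux F G (P (k + 1)) (P (k + 2)) t := by
  rw [integral_add (integrableOn_convexHull_range P (continuous_dx hF))
      (integrableOn_convexHull_range P (continuous_dy hG)),
    setIntegral_triangle_dx hP hF, setIntegral_triangle_dy hP hG, ← mul_add,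
    ← Finset.sum_add_distrib]
  refine congrArg _ (Finset.sum_congr rfl fun k _ => ?_)
  have hint : ∀ {f : Plane → ℝ}, Continuous f → IntervalIntegrable
      (fun t => f (AffineMap.lineMap (P (k + 1)) (P (k + 2)) t)) volume 0 1 := fun hf =>
    (hf.comp AffineMap.lineMap_continuous).intervalIntegrable _ _
  simp only [normalFlux]
  rw [intervalIntegral.integral_sub ((hint hF.continuous).const_mul _)
      ((hint hG.continuous).const_mul _), intervalIntegral.integral_const_mul,
    intervalIntegral.integral_const_mul, edgeMean, edgeMean]
  ring

end DivergenceTheorem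

section CrouzeixRaviart

variable {ι : Type} {T : ι → Fin 3 → Plane}

/-- The midpoint of the edge of triangle `i` opposite to its vertex `k`. -/
def edgeMidpoint (T : ι → Fin 3 → Plane) (i : ι) (k : Fin 3) : Plane :=
  midpoint ℝ (T i (k + 1)) (T i (k + 2))

theorem edgeMean_affine (w : Plane →ᵃ[ℝ] ℝ) (a b : Plane) :
    edgeMean w a b = w (midpoint ℝ a b) := by
  have hline : ∀ t : ℝ, w (AffineMap.lineMap a b t) = w a + (w b - w a) * t := by
    intro t
    rw [AffineMap.apply_lineMap, AffineMap.lineMap_apply_module]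
    simp only [smul_eq_mul]
    ring
  simp_rw [edgeMean, hline]
  rw [intervalIntegral.integral_add (by simp) (Continuous.intervalIntegrable (by fun_prop) _ _),
    intervalIntegral.integral_const, intervalIntegral.integral_const_mul, integral_id,
    AffineMap.map_midpoint, midpoint_eq_smul_add, smul_eq_mul, smul_eq_mul, invOf_eq_inv]
  ring

theorem edgeIntegral_eq_mul_edgeMean (g : Plane → ℝ) (a b : Plane) :
    edgeIntegral g a b = Real.sqrt ((b.1 - a.1) ^ 2 + (b.2 - a.2) ^ 2) * edgeMean g a b := rfl

theorem integralOnEdge_affine (T : ι → Fin 3 → Plane) (i : ι) (k : Fin 3) (w : Plane →ᵃ[ℝ] ℝ) :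
    integralOnEdge T i k w = Real.sqrt (((T i (k + 2)).1 - (T i (k + 1)).1) ^ 2 +
      ((T i (k + 2)).2 - (T i (k + 1)).2) ^ 2) * w (edgeMidpoint T i k) := by
  rw [integralOnEdge, edgeIntegral_eq_mul_edgeMean, edgeMean_affine, edgeMidpoint]

/-- Midpoint values that depend on the edges only, and vanish on the boundary, define an element of
the Crouzeix–Raviart space. -/
theorem mem_crouzeixRaviart_of_edgeMidpoint {v : ι → (Plane →ᵃ[ℝ] ℝ)} (φ : Sym2 Plane → ℝ)
    (hv : ∀ i k, v i (edgeMidpoint T i k) = φ (edge T i k))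
    (hφ : ∀ i k, IsBoundaryEdge T i k → φ (edge T i k) = 0) : v ∈ crouzeixRaviart T := by
  refine ⟨fun i i₂ k k₂ _ he => ?_, fun i k hb => ?_⟩
  · rw [integralOnEdge_affine, integralOnEdge_affine, hv, hv, he]
    rcases Sym2.eq_iff.1 he with ⟨h1, h2⟩ | ⟨h1, h2⟩
    · rw [h1, h2]
    · rw [h1, h2, ← neg_sub (T i₂ (k₂ + 2)).1, ← neg_sub (T i₂ (k₂ + 2)).2, neg_sq, neg_sq]
  · rw [integralOnEdge_affine, hv, hφ i k hb, mul_zero]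

theorem integralOnEdge_add (T : ι → Fin 3 → Plane) (i : ι) (k : Fin 3)
    (v w : Plane →ᵃ[ℝ] ℝ) : integralOnEdge T i k ⇑(v + w) =
      integralOnEdge T i k v + integralOnEdge T i k w := by
  rw [integralOnEdge_affine, integralOnEdge_affine, integralOnEdge_affine, AffineMap.coe_add,
    Pi.add_apply, mul_add]

theorem integralOnEdge_smul (T : ι → Fin 3 → Plane) (i : ι) (k : Fin 3) (c : ℝ)
    (v : Plane →ᵃ[ℝ] ℝ) : integralOnEdge T i k ⇑(c • v) = c * integralOnEdge T i k v := by
  rw [integralOnEdge_affine, integralOnEdge_affine, AffineMap.coe_smul, Pi.smul_apply,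
    smul_eq_mul, mul_left_comm]

/-- The Crouzeix–Raviart space as a vector space. -/
def crouzeixRaviartSubmodule (T : ι → Fin 3 → Plane) : Submodule ℝ (ι → (Plane →ᵃ[ℝ] ℝ)) where
  carrier := crouzeixRaviart T
  zero_mem' := mem_crouzeixRaviart_of_edgeMidpoint 0 (fun _ _ => rfl) (fun _ _ _ => rfl)
  add_mem' {v w} hv hw := by
    refine ⟨fun i i₂ k k₂ hi he => ?_, fun i k hb => ?_⟩ <;>
      simp only [Pi.add_apply, integralOnEdge_add]
    · rw [hv.1 i i₂ k k₂ hi he, hw.1 i i₂ k k₂ hi he]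
    · rw [hv.2 i k hb, hw.2 i k hb, add_zero]
  smul_mem' c v hv := by
    refine ⟨fun i i₂ k k₂ hi he => ?_, fun i k hb => ?_⟩ <;>
      simp only [Pi.smul_apply, integralOnEdge_smul]
    · rw [hv.1 i i₂ k k₂ hi he]
    · rw [hv.2 i k hb, mul_zero]

theorem vertex_ne_of_signedDoubleArea_ne_zero {P : Fin 3 → Plane} (hP : signedDoubleArea P ≠ 0)
    (k : Fin 3) : P (k + 1) ≠ P (k + 2) := by
  intro h
  refine hP ?_
  unfold signedDoubleArea
  fin_cases k <;> simp at h <;> simp [h, mul_comm]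

theorem edgeLength_ne_zero {a b : Plane} (h : a ≠ b) :
    Real.sqrt ((b.1 - a.1) ^ 2 + (b.2 - a.2) ^ 2) ≠ 0 := by
  refine Real.sqrt_ne_zero'.2 ?_
  by_contra hle
  have h1 : b.1 - a.1 = 0 := by nlinarith [sq_nonneg (b.1 - a.1), sq_nonneg (b.2 - a.2)]
  have h2 : b.2 - a.2 = 0 := by nlinarith [sq_nonneg (b.1 - a.1), sq_nonneg (b.2 - a.2)]
  exact h (Prod.ext (sub_eq_zero.1 h1).symm (sub_eq_zero.1 h2).symm)

theorem eq_of_edgeIntegral_eq {a b : Plane} (h : a ≠ b) {v w : Plane →ᵃ[ℝ] ℝ}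
    (hvw : edgeIntegral v a b = edgeIntegral w a b) : v (midpoint ℝ a b) = w (midpoint ℝ a b) := by
  rw [edgeIntegral_eq_mul_edgeMean, edgeIntegral_eq_mul_edgeMean, edgeMean_affine,
    edgeMean_affine] at hvw
  exact mul_left_cancel₀ (edgeLength_ne_zero h) hvw

theorem exists_affine_apply_vertex {P : Fin 3 → Plane} (hP : signedDoubleArea P ≠ 0)
    (y : Fin 3 → ℝ) : ∃ w : Plane →ᵃ[ℝ] ℝ, ∀ k, w (P k) = y k := by
  set β := ((y 1 - y 0) * (P 2 - P 0).2 - (y 2 - y 0) * (P 1 - P 0).2) / signedDoubleArea P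
  set γ := ((y 2 - y 0) * (P 1 - P 0).1 - (y 1 - y 0) * (P 2 - P 0).1) / signedDoubleArea P
  have hβ : β * signedDoubleArea P = _ := div_mul_cancel₀ _ hP
  have hγ : γ * signedDoubleArea P = _ := div_mul_cancel₀ _ hP
  refine ⟨affineOfCoeffs (y 0 - β * (P 0).1 - γ * (P 0).2) β γ, fun k => ?_⟩
  rw [affineOfCoeffs_apply]
  refine mul_left_cancel₀ hP ?_
  simp only [signedDoubleArea, Prod.fst_sub, Prod.snd_sub] at hβ hγ ⊢
  fin_cases k <;> simp only [Fin.zero_eta, Fin.mk_one, Fin.reduceFinMk]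
  · ring
  · linear_combination ((P 1).1 - (P 0).1) * hβ + ((P 1).2 - (P 0).2) * hγ
  · linear_combination ((P 2).1 - (P 0).1) * hβ + ((P 2).2 - (P 0).2) * hγ

theorem exists_affine_apply_edgeMidpoint {P : Fin 3 → Plane} (hP : signedDoubleArea P ≠ 0)
    (c : Fin 3 → ℝ) : ∃ w : Plane →ᵃ[ℝ] ℝ, ∀ k, w (midpoint ℝ (P (k + 1)) (P (k + 2))) = c k := by
  obtain ⟨w, hw⟩ := exists_affine_apply_vertex hP fun k => c (k + 1) + c (k + 2) - c k
  refine ⟨w, fun k => ?_⟩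
  rw [AffineMap.map_midpoint, hw, hw, midpoint_eq_smul_add, smul_eq_mul, invOf_eq_inv]
  fin_cases k <;> simp <;> ring

end CrouzeixRaviart

section BestApproximation

variable {ι : Type} {T : ι → Fin 3 → Plane}

theorem volume_real_triangle {P : Fin 3 → Plane} (hP : signedDoubleArea P ≠ 0) :
    volume.real (convexHull ℝ (Set.range P)) = |signedDoubleArea P| / 2 := by
  have h := setIntegral_convexHull_triangle hP (f := fun _ => 1) continuous_const
  simp only [setIntegral_const, smul_eq_mul, mul_one, intervalIntegral.integral_const,
    sub_zero] at h
  rw [h, intervalIntegral.integral_sub (by simp) (by simp), intervalIntegral.integral_const,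
    integral_id]
  norm_num
  ring

theorem setIntegral_triangle_const (P : Fin 3 → Plane) (c : ℝ) :
    ∫ _ in convexHull ℝ (Set.range P), c = volume.real (convexHull ℝ (Set.range P)) * c := by
  rw [setIntegral_const, smul_eq_mul]

theorem exists_crouzeixRaviart_edgeMean_eq (hT : ∀ i, signedDoubleArea (T i) ≠ 0)
    (u : Plane → ℝ) (hu : ∀ i k, IsBoundaryEdge T i k →
      edgeMean u (T i (k + 1)) (T i (k + 2)) = 0) :
    ∃ v ∈ crouzeixRaviart T, ∀ i k, edgeMean (v i) (T i (k + 1)) (T i (k + 2)) =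
      edgeMean u (T i (k + 1)) (T i (k + 2)) := by
  choose v hv using fun i => exists_affine_apply_edgeMidpoint (hT i) fun k =>
    edgeMean u (T i (k + 1)) (T i (k + 2))
  refine ⟨v, mem_crouzeixRaviart_of_edgeMidpoint
    (Sym2.lift ⟨edgeMean u, edgeMean_symm u⟩) hv fun i k hb => hu i k hb, fun i k => ?_⟩
  rw [edgeMean_affine, hv]

theorem abs_sub_le_of_setIntegral_eq {s : Set Plane} {f : Plane → ℝ} {c ε : ℝ} {z : Plane}
    (hs : 0 < volume.real s) (hf : IntegrableOn f s) (hc : ∫ z in s, f z = volume.real s * c)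
    (hz : ∀ z' ∈ s, |f z - f z'| ≤ ε) : |f z - c| ≤ ε := by
  have hfin : volume s < ⊤ := (ENNReal.toReal_pos_iff.1 hs).2
  have hmean : ∫ z' in s, (f z - f z') = volume.real s * (f z - c) := by
    rw [integral_sub (integrableOn_const (C := f z) hfin.ne) hf, hc, setIntegral_const,
      smul_eq_mul, mul_sub]
  have hbound : |∫ z' in s, (f z - f z')| ≤ ε * volume.real s :=
    (Real.norm_eq_abs _).ge.trans (norm_setIntegral_le_of_norm_le_const hfin hz)
  rw [hmean, abs_mul, abs_of_pos hs, mul_comm ε] at hbound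
  exact le_of_mul_le_mul_left hbound hs

section EdgeMeans

variable {P : Fin 3 → Plane} {u : Plane → ℝ} {w : Plane →ᵃ[ℝ] ℝ} {ε : ℝ} {z : Plane}

theorem abs_dx_sub_slopeX_le (hP : signedDoubleArea P ≠ 0) (hu : ContDiff ℝ 1 u)
    (hw : ∀ k, edgeMean w (P (k + 1)) (P (k + 2)) = edgeMean u (P (k + 1)) (P (k + 2)))
    (hz : ∀ z' ∈ convexHull ℝ (Set.range P), |dx u z - dx u z'| ≤ ε) :
    |dx u z - slopeX w| ≤ ε := by
  refine abs_sub_le_of_setIntegral_eq (by rw [volume_real_triangle hP]; positivity)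
    (integrableOn_convexHull_range P (continuous_dx hu)) ?_ hz
  rw [setIntegral_triangle_dx hP hu, ← setIntegral_triangle_const]
  simp_rw [← hw]
  simpa only [dx_affine] using (setIntegral_triangle_dx hP (contDiff_affine w)).symm

theorem abs_dy_sub_slopeY_le (hP : signedDoubleArea P ≠ 0) (hu : ContDiff ℝ 1 u)
    (hw : ∀ k, edgeMean w (P (k + 1)) (P (k + 2)) = edgeMean u (P (k + 1)) (P (k + 2)))
    (hz : ∀ z' ∈ convexHull ℝ (Set.range P), |dy u z - dy u z'| ≤ ε) :
    |dy u z - slopeY w| ≤ ε := by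
  refine abs_sub_le_of_setIntegral_eq (by rw [volume_real_triangle hP]; positivity)
    (integrableOn_convexHull_range P (continuous_dy hu)) ?_ hz
  rw [setIntegral_triangle_dy hP hu, ← setIntegral_triangle_const]
  simp_rw [← hw]
  simpa only [dy_affine] using (setIntegral_triangle_dy hP (contDiff_affine w)).symm

end EdgeMeans

theorem brokenError_eq [Fintype ι] {u : Plane → ℝ} (hu : ContDiff ℝ 1 u)
    (v : ι → (Plane →ᵃ[ℝ] ℝ)) : brokenError T u v = Real.sqrt (∑ i, ∫ p in triangle T i,
      ((dx u p - slopeX (v i)) ^ 2 + (dy u p - slopeY (v i)) ^ 2)) := by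
  have hu' := hu.differentiable one_ne_zero
  have hv' := fun i => (contDiff_affine (v i)).differentiable one_ne_zero
  unfold brokenError brokenNorm
  congr! with i _ p
  · exact (dx_sub (hu' p) (hv' i p)).trans (by rw [dx_affine])
  · exact (dy_sub (hu' p) (hv' i p)).trans (by rw [dy_affine])

theorem bestApproxError_le_brokenError [Fintype ι] {v : ι → (Plane →ᵃ[ℝ] ℝ)}
    (hv : v ∈ crouzeixRaviart T) (u : Plane → ℝ) :
    bestApproxError T u ≤ brokenError T u v := by
  refine csInf_le ⟨0, ?_⟩ ⟨v, hv, rfl⟩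
  rintro r ⟨v, -, rfl⟩
  exact Real.sqrt_nonneg _

/-- The Crouzeix–Raviart interpolant of `u` is defined by the mean values of `u` over the edges; by
the divergence theorem its gradient on each triangle is the mean value of the gradient of `u`. -/
theorem exists_crouzeixRaviart_brokenError_le [Fintype ι]
    (hT : ∀ i, signedDoubleArea (T i) ≠ 0) {u : Plane → ℝ} (hu : ContDiff ℝ 1 u)
    (hu0 : ∀ i k, IsBoundaryEdge T i k → edgeMean u (T i (k + 1)) (T i (k + 2)) = 0) {ε : ℝ}
    (hx : ∀ i, ∀ z ∈ triangle T i, ∀ z' ∈ triangle T i, |dx u z - dx u z'| ≤ ε)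
    (hy : ∀ i, ∀ z ∈ triangle T i, ∀ z' ∈ triangle T i, |dy u z - dy u z'| ≤ ε) :
    ∃ v ∈ crouzeixRaviart T,
      brokenError T u v ≤ Real.sqrt (2 * ε ^ 2 * ∑ i, volume.real (triangle T i)) := by
  obtain ⟨v, hv, hmean⟩ := exists_crouzeixRaviart_edgeMean_eq hT u hu0
  refine ⟨v, hv, ?_⟩
  rw [brokenError_eq hu, Finset.mul_sum]
  refine Real.sqrt_le_sqrt (Finset.sum_le_sum fun i _ => ?_)
  have hcont : Continuous fun p => (dx u p - slopeX (v i)) ^ 2 + (dy u p - slopeY (v i)) ^ 2 :=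
    (((continuous_dx hu).sub continuous_const).pow 2).add
      (((continuous_dy hu).sub continuous_const).pow 2)
  calc ∫ p in triangle T i, ((dx u p - slopeX (v i)) ^ 2 + (dy u p - slopeY (v i)) ^ 2)
      ≤ ∫ _ in triangle T i, 2 * ε ^ 2 := by
        refine setIntegral_mono_on (integrableOn_convexHull_range _ hcont)
          (integrableOn_convexHull_range _ continuous_const)
          (isCompact_convexHull_range _).measurableSet fun p hp => ?_
        have h1 := abs_dx_sub_slopeX_le (hT i) hu (hmean i) (hx i p hp)
        have h2 := abs_dy_sub_slopeY_le (hT i) hu (hmean i) (hy i p hp)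
        linarith [sq_le_sq' (neg_le_of_abs_le h1) (le_of_abs_le h1),
          sq_le_sq' (neg_le_of_abs_le h2) (le_of_abs_le h2)]
    _ = 2 * ε ^ 2 * volume.real (triangle T i) := by
        rw [triangle, setIntegral_triangle_const, mul_comm]

end BestApproximation

section BrokenForm

variable {ι : Type} {T : ι → Fin 3 → Plane}

/-- The families of continuously differentiable functions, one for each triangle; the discrete
`H¹` form is bilinear on this space. -/
def smoothFamilies (ι : Type) : Submodule ℝ (ι → Plane → ℝ) where
  carrier := {g | ∀ i, ContDiff ℝ 1 (g i)}
  zero_mem' _ := contDiff_const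
  add_mem' hg hh i := (hg i).add (hh i)
  smul_mem' c _ hg i := (hg i).const_smul c

theorem differentiableAt_of_mem_smoothFamilies {g : ι → Plane → ℝ} (hg : g ∈ smoothFamilies ι)
    (i : ι) (p : Plane) : DifferentiableAt ℝ (g i) p :=
  (hg i).differentiable one_ne_zero p

theorem pieces_mem_smoothFamilies (w : ι → (Plane →ᵃ[ℝ] ℝ)) : pieces w ∈ smoothFamilies ι :=
  fun i => contDiff_affine (w i)

theorem integrableOn_triangle_grad_mul {g h : ι → Plane → ℝ} (hg : g ∈ smoothFamilies ι)
    (hh : h ∈ smoothFamilies ι) (i : ι) :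
    IntegrableOn (fun p => dx (g i) p * dx (h i) p + dy (g i) p * dy (h i) p) (triangle T i) :=
  integrableOn_convexHull_range _ (((continuous_dx (hg i)).mul (continuous_dx (hh i))).add
    ((continuous_dy (hg i)).mul (continuous_dy (hh i))))

variable [Fintype ι]

theorem brokenInner_comm (T : ι → Fin 3 → Plane) (g h : ι → Plane → ℝ) :
    brokenInner T g h = brokenInner T h g := by
  simp only [brokenInner, mul_comm]

theorem brokenInner_add_left {g g' h : ι → Plane → ℝ} (hg : g ∈ smoothFamilies ι)
    (hg' : g' ∈ smoothFamilies ι) (hh : h ∈ smoothFamilies ι) :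
    brokenInner T (g + g') h = brokenInner T g h + brokenInner T g' h := by
  simp only [brokenInner, ← Finset.sum_add_distrib]
  refine Finset.sum_congr rfl fun i _ => ?_
  rw [← integral_add (integrableOn_triangle_grad_mul hg hh i)
    (integrableOn_triangle_grad_mul hg' hh i)]
  congr 1 with p
  rw [Pi.add_apply, dx_add (differentiableAt_of_mem_smoothFamilies hg i p)
    (differentiableAt_of_mem_smoothFamilies hg' i p),
    dy_add (differentiableAt_of_mem_smoothFamilies hg i p)
    (differentiableAt_of_mem_smoothFamilies hg' i p)]
  ring

theorem brokenInner_smul_left {g : ι → Plane → ℝ} (hg : g ∈ smoothFamilies ι) (c : ℝ)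
    (h : ι → Plane → ℝ) : brokenInner T (c • g) h = c * brokenInner T g h := by
  simp only [brokenInner, Finset.mul_sum, ← integral_const_mul]
  refine Finset.sum_congr rfl fun i _ => ?_
  congr 1 with p
  rw [Pi.smul_apply, dx_smul c (differentiableAt_of_mem_smoothFamilies hg i p),
    dy_smul c (differentiableAt_of_mem_smoothFamilies hg i p)]
  ring

/-- The discrete `H¹` scalar product as a bilinear form on the piecewise smooth functions. -/
def brokenForm (T : ι → Fin 3 → Plane) : LinearMap.BilinForm ℝ (smoothFamilies ι) :=
  LinearMap.mk₂ ℝ (fun g h => brokenInner T g.1 h.1)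
    (fun g g' h => brokenInner_add_left g.2 g'.2 h.2)
    (fun c g h => brokenInner_smul_left g.2 c h.1)
    (fun g h h' => by
      rw [brokenInner_comm T g.1, brokenInner_comm T g.1, brokenInner_comm T g.1]
      exact brokenInner_add_left h.2 h'.2 g.2)
    (fun c g h => by
      rw [brokenInner_comm T g.1, brokenInner_comm T g.1]
      exact brokenInner_smul_left h.2 c g.1)

theorem brokenNorm_nonneg (T : ι → Fin 3 → Plane) (g : ι → Plane → ℝ) : 0 ≤ brokenNorm T g :=
  Real.sqrt_nonneg _

theorem brokenInner_self (T : ι → Fin 3 → Plane) (g : ι → Plane → ℝ) :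
    brokenInner T g g = brokenNorm T g ^ 2 := by
  have h0 : 0 ≤ ∑ i, ∫ p in triangle T i, ((dx (g i) p) ^ 2 + (dy (g i) p) ^ 2) :=
    Finset.sum_nonneg fun i _ => integral_nonneg fun p => by positivity
  rw [brokenNorm, Real.sq_sqrt h0, brokenInner]
  simp only [pow_two]

theorem abs_brokenInner_le {g h : ι → Plane → ℝ} (hg : g ∈ smoothFamilies ι)
    (hh : h ∈ smoothFamilies ι) :
    |brokenInner T g h| ≤ brokenNorm T g * brokenNorm T h := by
  have hsymm : LinearMap.IsSymm (brokenForm T) := ⟨fun g h => brokenInner_comm T g.1 h.1⟩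
  have hCS := (brokenForm T).apply_sq_le_of_symm
    (fun g => (brokenInner_self T g.1).ge.trans' (sq_nonneg _)) hsymm ⟨g, hg⟩ ⟨h, hh⟩
  refine abs_le_of_sq_le_sq ?_ (mul_nonneg (brokenNorm_nonneg T g) (brokenNorm_nonneg T h))
  rw [mul_pow, ← brokenInner_self, ← brokenInner_self]
  exact hCS

theorem brokenInner_sub_left {g g' h : ι → Plane → ℝ} (hg : g ∈ smoothFamilies ι)
    (hg' : g' ∈ smoothFamilies ι) (hh : h ∈ smoothFamilies ι) :
    brokenInner T (g - g') h = brokenInner T g h - brokenInner T g' h :=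
  LinearMap.map_sub₂ (brokenForm T) ⟨g, hg⟩ ⟨g', hg'⟩ ⟨h, hh⟩

theorem brokenNorm_add_le {g h : ι → Plane → ℝ} (hg : g ∈ smoothFamilies ι)
    (hh : h ∈ smoothFamilies ι) :
    brokenNorm T (g + h) ≤ brokenNorm T g + brokenNorm T h := by
  have hsum : g + h ∈ smoothFamilies ι := add_mem hg hh
  have hexp : brokenNorm T (g + h) ^ 2 =
      brokenNorm T g ^ 2 + 2 * brokenInner T g h + brokenNorm T h ^ 2 := by
    rw [← brokenInner_self, ← brokenInner_self, ← brokenInner_self,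
      brokenInner_add_left hg hh hsum, brokenInner_comm T g, brokenInner_comm T h (g + h),
      brokenInner_add_left hg hh hg, brokenInner_add_left hg hh hh, brokenInner_comm T h g]
    ring
  refine abs_le_of_sq_le_sq' ?_ (add_nonneg (brokenNorm_nonneg T g) (brokenNorm_nonneg T h)) |>.2
  nlinarith [le_of_abs_le (abs_brokenInner_le (T := T) hg hh)]

theorem brokenNorm_smul {g : ι → Plane → ℝ} (hg : g ∈ smoothFamilies ι) (c : ℝ) :
    brokenNorm T (c • g) = |c| * brokenNorm T g := by
  have hsq : brokenNorm T (c • g) ^ 2 = (|c| * brokenNorm T g) ^ 2 := by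
    rw [← brokenInner_self, brokenInner_smul_left hg, brokenInner_comm,
      brokenInner_smul_left hg, brokenInner_self, mul_pow, sq_abs]
    ring
  exact (sq_eq_sq₀ (brokenNorm_nonneg T _)
    (mul_nonneg (abs_nonneg c) (brokenNorm_nonneg T g))).1 hsq

theorem brokenNorm_pieces_sq (T : ι → Fin 3 → Plane) (w : ι → (Plane →ᵃ[ℝ] ℝ)) :
    brokenNorm T (pieces w) ^ 2 =
      ∑ i, volume.real (triangle T i) * (slopeX (w i) ^ 2 + slopeY (w i) ^ 2) := by
  rw [← brokenInner_self, brokenInner]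
  refine Finset.sum_congr rfl fun i _ => ?_
  have hslopes : ∀ p,
      dx (pieces w i) p * dx (pieces w i) p + dy (pieces w i) p * dy (pieces w i) p =
      slopeX (w i) ^ 2 + slopeY (w i) ^ 2 := fun p => by
    rw [show pieces w i = w i from rfl, dx_affine, dy_affine, pow_two, pow_two]
  simp only [hslopes]
  exact setIntegral_triangle_const _ _

end BrokenForm

section Galerkin

variable {ι : Type} [Fintype ι] {T : ι → Fin 3 → Plane} {u f : Plane → ℝ}
  {v w : ι → (Plane →ᵃ[ℝ] ℝ)}

theorem load_add (hf : Continuous f) (v w : ι → (Plane →ᵃ[ℝ] ℝ)) :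
    load T f (pieces (v + w)) = load T f (pieces v) + load T f (pieces w) := by
  have hint : ∀ (v : ι → (Plane →ᵃ[ℝ] ℝ)) i,
      IntegrableOn (fun p => f p * v i p) (triangle T i) := fun v i =>
    integrableOn_convexHull_range _ (hf.mul (contDiff_affine (v i)).continuous)
  simp only [load, ← Finset.sum_add_distrib]
  refine Finset.sum_congr rfl fun i _ => ?_
  simp only [pieces]
  rw [← integral_add (hint v i) (hint w i)]
  congr 1 with p
  rw [← mul_add]
  rfl

theorem load_smul (c : ℝ) (w : ι → (Plane →ᵃ[ℝ] ℝ)) :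
    load T f (pieces (c • w)) = c * load T f (pieces w) := by
  simp only [load, Finset.mul_sum, ← integral_const_mul]
  refine Finset.sum_congr rfl fun i _ => ?_
  congr 1 with p
  exact mul_left_comm _ _ _

/-- The load as a linear functional on the Crouzeix–Raviart space. -/
def loadFunctional (T : ι → Fin 3 → Plane) (hf : Continuous f) :
    Module.Dual ℝ (crouzeixRaviartSubmodule T) where
  toFun w := load T f (pieces w.1)
  map_add' v w := load_add hf v.1 w.1
  map_smul' c w := load_smul c w.1

/-- A piecewise affine function, viewed as a piecewise smooth function. -/
def piecesHom (ι : Type) : (ι → (Plane →ᵃ[ℝ] ℝ)) →ₗ[ℝ] smoothFamilies ι where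
  toFun w := ⟨pieces w, pieces_mem_smoothFamilies w⟩
  map_add' _ _ := rfl
  map_smul' _ _ := rfl

theorem existsUnique_isGalerkinSolution (hf : Continuous f)
    (hT : ∀ w ∈ crouzeixRaviart T, brokenNorm T (pieces w) = 0 → w = 0) :
    ∃! v, IsGalerkinSolution T f v := by
  let form : crouzeixRaviartSubmodule T →ₗ[ℝ] Module.Dual ℝ (crouzeixRaviartSubmodule T) :=
    (brokenForm T).compl₁₂ ((piecesHom ι).comp (crouzeixRaviartSubmodule T).subtype)
      ((piecesHom ι).comp (crouzeixRaviartSubmodule T).subtype)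
  have hinj : Function.Injective form := by
    refine (injective_iff_map_eq_zero form).2 fun w hw => Subtype.ext (hT w.1 w.2 ?_)
    have henergy : brokenInner T (pieces w.1) (pieces w.1) = 0 := LinearMap.congr_fun hw w
    rwa [brokenInner_self, sq_eq_zero_iff] at henergy
  have hbij : Function.Bijective form := ⟨hinj,
    (LinearMap.injective_iff_surjective_of_finrank_eq_finrank
      Subspace.dual_finrank_eq.symm).1 hinj⟩
  obtain ⟨v, hv, huniq⟩ := hbij.existsUnique (loadFunctional T hf)
  refine ⟨v.1, ⟨v.2, fun w hw => LinearMap.congr_fun hv ⟨w, hw⟩⟩, fun v' hv' => ?_⟩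
  exact congrArg Subtype.val (huniq ⟨v', hv'.1⟩ (LinearMap.ext fun w => hv'.2 w.1 w.2))

/-- The residual `(u, w) - (f, w)` of `u` tested with a piecewise affine `w`; it vanishes for
continuous `w` if `-Δu = f`. -/
def consistencyTerm (T : ι → Fin 3 → Plane) (u f : Plane → ℝ) (w : ι → (Plane →ᵃ[ℝ] ℝ)) : ℝ :=
  brokenInner T (fun _ => u) (pieces w) - load T f (pieces w)

theorem abs_consistencyTerm_le_brokenError (hu : ContDiff ℝ 1 u) (hv : IsGalerkinSolution T f v)
    (hw : w ∈ crouzeixRaviart T) :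
    |consistencyTerm T u f w| ≤ brokenError T u v * brokenNorm T (pieces w) := by
  have hu' : (fun _ => u) ∈ smoothFamilies ι := fun _ => hu
  rw [consistencyTerm, ← hv.2 w hw, ← brokenInner_sub_left hu' (pieces_mem_smoothFamilies v)
    (pieces_mem_smoothFamilies w)]
  exact abs_brokenInner_le (sub_mem hu' (pieces_mem_smoothFamilies v))
    (pieces_mem_smoothFamilies w)

theorem consistencyTerm_smul (c : ℝ) (w : ι → (Plane →ᵃ[ℝ] ℝ)) :
    consistencyTerm T u f (c • w) = c * consistencyTerm T u f w := by
  have h : brokenInner T (fun _ => u) (pieces (c • w)) =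
      c * brokenInner T (fun _ => u) (pieces w) := by
    rw [brokenInner_comm, brokenInner_comm T (fun _ => u)]
    exact brokenInner_smul_left (pieces_mem_smoothFamilies w) c _
  rw [consistencyTerm, h, load_smul, consistencyTerm, mul_sub]

theorem consistencyError_nonneg : 0 ≤ consistencyError T u f :=
  Real.sSup_nonneg (by rintro r ⟨w, -, -, rfl⟩; exact abs_nonneg _)

theorem consistencyError_le {C : ℝ} (hC : 0 ≤ C) (h : ∀ w ∈ crouzeixRaviart T,
    |consistencyTerm T u f w| ≤ C * brokenNorm T (pieces w)) : consistencyError T u f ≤ C := by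
  refine Real.sSup_le ?_ hC
  rintro r ⟨w, hw, hnorm, rfl⟩
  exact (h w hw).trans_eq (by rw [hnorm, mul_one])

theorem abs_consistencyTerm_le_consistencyError (hu : ContDiff ℝ 1 u)
    (hv : IsGalerkinSolution T f v) (hw : w ∈ crouzeixRaviart T) :
    |consistencyTerm T u f w| ≤ consistencyError T u f * brokenNorm T (pieces w) := by
  rcases (brokenNorm_nonneg T (pieces w)).eq_or_lt with h0 | hpos
  · simpa only [← h0, mul_zero] using abs_consistencyTerm_le_brokenError hu hv hw
  set N := brokenNorm T (pieces w)
  have hunit : brokenNorm T (pieces (N⁻¹ • w)) = 1 :=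
    (brokenNorm_smul (pieces_mem_smoothFamilies w) _).trans
      (by rw [abs_of_pos (inv_pos.2 hpos), inv_mul_cancel₀ hpos.ne'])
  have hle : |consistencyTerm T u f (N⁻¹ • w)| ≤ consistencyError T u f := by
    refine le_csSup ⟨brokenError T u v, ?_⟩
      ⟨_, (crouzeixRaviartSubmodule T).smul_mem _ hw, hunit, rfl⟩
    rintro r ⟨w', hw', hnorm, rfl⟩
    exact (abs_consistencyTerm_le_brokenError hu hv hw').trans_eq (by rw [hnorm, mul_one])
  rwa [consistencyTerm_smul, abs_mul, abs_of_pos (inv_pos.2 hpos), inv_mul_le_iff₀' hpos] at hle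

theorem consistencyError_le_brokenError (hu : ContDiff ℝ 1 u) (hv : IsGalerkinSolution T f v) :
    consistencyError T u f ≤ brokenError T u v :=
  consistencyError_le (brokenNorm_nonneg T _)
    fun _ hw => abs_consistencyTerm_le_brokenError hu hv hw

theorem brokenError_eq_brokenNorm_sub :
    brokenError T u v = brokenNorm T ((fun _ => u) - pieces v) :=
  rfl

/-- Strang's second lemma. -/
theorem brokenError_le_add_consistencyError (hu : ContDiff ℝ 1 u)
    (hv : IsGalerkinSolution T f v) (hw : w ∈ crouzeixRaviart T) :
    brokenError T u v ≤ 2 * brokenError T u w + consistencyError T u f := by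
  have hu' : (fun _ => u) ∈ smoothFamilies ι := fun _ => hu
  have hw' := pieces_mem_smoothFamilies w
  have hd : w - v ∈ crouzeixRaviart T := (crouzeixRaviartSubmodule T).sub_mem hw hv.1
  have hd' := pieces_mem_smoothFamilies (w - v)
  set d := pieces (w - v)
  have hsq : brokenNorm T d ^ 2 =
      consistencyTerm T u f (w - v) - brokenInner T ((fun _ => u) - pieces w) d := by
    have hsub : brokenInner T d d = brokenInner T (pieces w) d - brokenInner T (pieces v) d :=
      brokenInner_sub_left hw' (pieces_mem_smoothFamilies v) hd'
    rw [← brokenInner_self, hsub, consistencyTerm, ← hv.2 _ hd, brokenInner_sub_left hu' hw' hd']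
    ring
  have hd_le : brokenNorm T d ≤ brokenError T u w + consistencyError T u f := by
    have hcons := le_of_abs_le (abs_consistencyTerm_le_consistencyError hu hv hd)
    have happrox := neg_le_of_abs_le (abs_brokenInner_le (T := T) (sub_mem hu' hw') hd')
    have hmul : brokenNorm T d * brokenNorm T d ≤
        (brokenError T u w + consistencyError T u f) * brokenNorm T d := by
      rw [← pow_two, hsq, add_mul, add_comm, brokenError_eq_brokenNorm_sub]
      linarith
    rcases (brokenNorm_nonneg T d).eq_or_lt with h0 | hpos
    · rw [← h0]
      exact add_nonneg (brokenNorm_nonneg T _) consistencyError_nonneg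
    · exact le_of_mul_le_mul_right hmul hpos
  have hsplit : (fun _ => u) - pieces v = ((fun _ => u) - pieces w) + d :=
    (sub_add_sub_cancel _ (pieces w) _).symm
  have htri : brokenError T u v ≤ brokenError T u w + brokenNorm T d := by
    rw [brokenError_eq_brokenNorm_sub, hsplit]
    exact brokenNorm_add_le (sub_mem hu' hw') hd'
  linarith

end Galerkin

section FluxMoment

variable {F G : Plane → ℝ}

/-- The first moment of the flux density of the field `(F, G)` about the midpoint of the segment
from `a` to `b`; it vanishes if the flux density is constant. -/
def fluxMoment (F G : Plane → ℝ) (a b : Plane) : ℝ :=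
  ∫ t in (0 : ℝ)..1, (t - 1 / 2) * normalFlux F G a b t

theorem affine_lineMap_eq_midpoint_add (w : Plane →ᵃ[ℝ] ℝ) (a b : Plane) (t : ℝ) :
    w (AffineMap.lineMap a b t) = w (midpoint ℝ a b) + (w b - w a) * (t - 1 / 2) := by
  rw [AffineMap.map_midpoint, AffineMap.apply_lineMap, AffineMap.lineMap_apply_module,
    midpoint_eq_smul_add]
  simp only [smul_eq_mul, invOf_eq_inv]
  ring

theorem integral_normalFlux_mul_affine (hF : Continuous F) (hG : Continuous G)
    (w : Plane →ᵃ[ℝ] ℝ) (a b : Plane) :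
    ∫ t in (0 : ℝ)..1, normalFlux (F * w) (G * w) a b t =
      w (midpoint ℝ a b) * (∫ t in (0 : ℝ)..1, normalFlux F G a b t) +
        (w b - w a) * fluxMoment F G a b := by
  have hν := continuous_normalFlux hF hG a b
  have hpoint : ∀ t, normalFlux (F * w) (G * w) a b t = w (midpoint ℝ a b) * normalFlux F G a b t +
      (w b - w a) * ((t - 1 / 2) * normalFlux F G a b t) := fun t => by
    simp only [normalFlux, Pi.mul_apply, affine_lineMap_eq_midpoint_add]
    ring
  simp_rw [hpoint]
  rw [intervalIntegral.integral_add (Continuous.intervalIntegrable (by fun_prop) _ _)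
      (Continuous.intervalIntegrable (by fun_prop) _ _),
    intervalIntegral.integral_const_mul, intervalIntegral.integral_const_mul, fluxMoment]

theorem abs_fluxMoment_le (hF : Continuous F) (hG : Continuous G) {a b : Plane} {c ε : ℝ}
    (h : ∀ t ∈ Set.Icc (0 : ℝ) 1, |normalFlux F G a b t - c| ≤ ε) :
    |fluxMoment F G a b| ≤ ε / 2 := by
  have hν := continuous_normalFlux hF hG a b
  have hcenter : fluxMoment F G a b =
      ∫ t in (0 : ℝ)..1, (t - 1 / 2) * (normalFlux F G a b t - c) := by
    have hc : ∫ t in (0 : ℝ)..1, (t - 1 / 2) * c = 0 := by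
      rw [intervalIntegral.integral_mul_const, intervalIntegral.integral_sub
        (Continuous.intervalIntegrable (by fun_prop) _ _) (by simp), integral_id,
        intervalIntegral.integral_const, smul_eq_mul]
      ring
    simp_rw [mul_sub]
    rw [intervalIntegral.integral_sub (Continuous.intervalIntegrable (by fun_prop) _ _)
      (Continuous.intervalIntegrable (by fun_prop) _ _), hc, sub_zero, fluxMoment]
  have hbound : ∀ t ∈ Set.uIoc (0 : ℝ) 1, ‖(t - 1 / 2) * (normalFlux F G a b t - c)‖ ≤ ε / 2 := by
    intro t ht
    rw [Set.uIoc_of_le zero_le_one] at ht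
    have hhalf : |t - 1 / 2| ≤ 1 / 2 := abs_le.2 ⟨by linarith [ht.1], by linarith [ht.2]⟩
    have hε := h t ⟨ht.1.le, ht.2⟩
    rw [Real.norm_eq_abs, abs_mul]
    exact (mul_le_mul hhalf hε (abs_nonneg _) (by norm_num)).trans_eq (by ring)
  simpa only [sub_zero, abs_one, mul_one, hcenter, ← Real.norm_eq_abs] using
    intervalIntegral.norm_integral_le_of_norm_le_const hbound

/-- Green's formula on a triangle. Without the moments the boundary terms would be those of the
midpoint rule, whose contributions cancel for nonconforming elements. -/
theorem setIntegral_triangle_green {P : Fin 3 → Plane} (hP : signedDoubleArea P ≠ 0)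
    (hF : ContDiff ℝ 1 F) (hG : ContDiff ℝ 1 G) (w : Plane →ᵃ[ℝ] ℝ) :
    (∫ z in convexHull ℝ (Set.range P), (F z * slopeX w + G z * slopeY w)) +
        ∫ z in convexHull ℝ (Set.range P), (dx F z + dy G z) * w z =
      SignType.sign (signedDoubleArea P) *
        ∑ k : Fin 3, (w (midpoint ℝ (P (k + 1)) (P (k + 2))) *
            (∫ t in (0 : ℝ)..1, normalFlux F G (P (k + 1)) (P (k + 2)) t) +
          (w (P (k + 2)) - w (P (k + 1))) * fluxMoment F G (P (k + 1)) (P (k + 2))) := by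
  have hw := contDiff_affine w
  simp_rw [← integral_normalFlux_mul_affine hF.continuous hG.continuous]
  have hgrad : Continuous fun z => F z * slopeX w + G z * slopeY w :=
    (hF.continuous.mul continuous_const).add (hG.continuous.mul continuous_const)
  have hdiv : Continuous fun z => (dx F z + dy G z) * w z :=
    ((continuous_dx hF).add (continuous_dy hG)).mul hw.continuous
  rw [← setIntegral_triangle_div (F := F * w) (G := G * w) hP (hF.mul hw) (hG.mul hw),
    ← integral_add (integrableOn_convexHull_range P hgrad) (integrableOn_convexHull_range P hdiv)]
  congr 1 with z
  have hz : ∀ {g : Plane → ℝ}, ContDiff ℝ 1 g → DifferentiableAt ℝ g z := fun hg =>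
    hg.differentiable one_ne_zero z
  rw [dx_mul (hz hF) (hz hw), dy_mul (hz hG) (hz hw), dx_affine, dy_affine]
  ring

end FluxMoment

section NeighbourMap

variable {ι : Type} {T : ι → Fin 3 → Plane}

/-- `N` pairs each side of a triangle with the same edge as a side of the adjacent triangle, and
fixes the sides on the boundary. Here the pair `(i, k)` is the side of the triangle `i` opposite to
its vertex `k`. The vertices are supposed to be numbered in such a way that adjacent triangles
induce the same direction on their common edge; their orientations are then opposite. -/
structure IsNeighbourMap (T : ι → Fin 3 → Plane) (N : ι × Fin 3 → ι × Fin 3) : Prop where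
  involutive : Function.Involutive N
  isBoundaryEdge : ∀ e, N e = e → IsBoundaryEdge T e.1 e.2
  fst_ne : ∀ e, N e ≠ e → (N e).1 ≠ e.1
  source_eq : ∀ e, T (N e).1 ((N e).2 + 1) = T e.1 (e.2 + 1)
  target_eq : ∀ e, T (N e).1 ((N e).2 + 2) = T e.1 (e.2 + 2)
  sign_eq : ∀ e, N e ≠ e → SignType.sign (signedDoubleArea (T (N e).1)) =
    -SignType.sign (signedDoubleArea (T e.1))

variable {N : ι × Fin 3 → ι × Fin 3} {w : ι → (Plane →ᵃ[ℝ] ℝ)}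

theorem IsNeighbourMap.edgeMidpoint_eq (hN : IsNeighbourMap T N) (e : ι × Fin 3) :
    edgeMidpoint T (N e).1 (N e).2 = edgeMidpoint T e.1 e.2 := by
  rw [edgeMidpoint, hN.source_eq, hN.target_eq, edgeMidpoint]

theorem apply_edgeMidpoint_eq_zero (hT : ∀ i, signedDoubleArea (T i) ≠ 0)
    (hN : IsNeighbourMap T N) (hw : w ∈ crouzeixRaviart T) {e : ι × Fin 3} (he : N e = e) :
    w e.1 (edgeMidpoint T e.1 e.2) = 0 := by
  have h := hw.2 e.1 e.2 (hN.isBoundaryEdge e he)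
  rw [integralOnEdge, edgeIntegral_eq_mul_edgeMean, edgeMean_affine] at h
  exact (mul_eq_zero.1 h).resolve_left
    (edgeLength_ne_zero (vertex_ne_of_signedDoubleArea_ne_zero (hT e.1) e.2))

theorem apply_neighbour_edgeMidpoint (hT : ∀ i, signedDoubleArea (T i) ≠ 0)
    (hN : IsNeighbourMap T N) (hw : w ∈ crouzeixRaviart T) (e : ι × Fin 3) :
    w (N e).1 (edgeMidpoint T e.1 e.2) = w e.1 (edgeMidpoint T e.1 e.2) := by
  by_cases he : N e = e
  · rw [he]
  have hedge : edge T (N e).1 (N e).2 = edge T e.1 e.2 := by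
    rw [edge, hN.source_eq, hN.target_eq, edge]
  have h := hw.1 _ _ _ _ (hN.fst_ne e he) hedge
  rw [integralOnEdge, hN.source_eq, hN.target_eq] at h
  exact eq_of_edgeIntegral_eq (vertex_ne_of_signedDoubleArea_ne_zero (hT e.1) e.2) h

variable [Fintype ι]

theorem exists_const_of_brokenNorm_eq_zero (hT : ∀ i, signedDoubleArea (T i) ≠ 0)
    (hN : IsNeighbourMap T N) (hw : w ∈ crouzeixRaviart T) (h0 : brokenNorm T (pieces w) = 0) :
    ∃ c : ι → ℝ, (∀ i p, w i p = c i) ∧ (∀ e, c (N e).1 = c e.1) ∧ ∀ e, N e = e → c e.1 = 0 := by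
  have harea : ∀ i, 0 < volume.real (triangle T i) := fun i => by
    rw [triangle, volume_real_triangle (hT i)]
    exact half_pos (abs_pos.2 (hT i))
  have hslopes : ∀ i, slopeX (w i) = 0 ∧ slopeY (w i) = 0 := by
    have hsum := brokenNorm_pieces_sq T w
    rw [h0, zero_pow two_ne_zero, eq_comm, Finset.sum_eq_zero_iff_of_nonneg
      fun i _ => mul_nonneg (harea i).le (by positivity)] at hsum
    intro i
    have h := (mul_eq_zero.1 (hsum i (Finset.mem_univ i))).resolve_left (harea i).ne'
    exact ⟨by nlinarith, by nlinarith⟩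
  have hconst : ∀ i p, w i p = w i 0 := fun i p => by
    rw [← sub_eq_zero, affine_sub_eq, (hslopes i).1, (hslopes i).2, zero_mul, zero_mul, add_zero]
  refine ⟨fun i => w i 0, hconst, fun e => ?_, fun e he => ?_⟩
  · exact (hconst _ _).symm.trans ((apply_neighbour_edgeMidpoint hT hN hw e).trans (hconst _ _))
  · exact (hconst _ _).symm.trans (apply_edgeMidpoint_eq_zero hT hN hw he)

theorem sum_sign_mul_edgeMidpoint_mul_flux_eq_zero (hT : ∀ i, signedDoubleArea (T i) ≠ 0)
    (hN : IsNeighbourMap T N) (hw : w ∈ crouzeixRaviart T) (φ : Plane → Plane → ℝ) :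
    ∑ i, (SignType.sign (signedDoubleArea (T i)) : ℝ) *
      ∑ k, w i (edgeMidpoint T i k) * φ (T i (k + 1)) (T i (k + 2)) = 0 := by
  simp_rw [Finset.mul_sum]
  rw [← Finset.sum_product', Finset.univ_product_univ]
  refine Finset.sum_involution (fun e _ => N e) (fun e _ => ?_) (fun e _ hne he => hne ?_)
    (fun _ _ => Finset.mem_univ _) (fun e _ => hN.involutive e)
  · by_cases he : N e = e
    · simp only [he, apply_edgeMidpoint_eq_zero hT hN hw he, zero_mul, mul_zero, add_zero]
    · rw [hN.sign_eq e he, hN.edgeMidpoint_eq, apply_neighbour_edgeMidpoint hT hN hw, hN.source_eq,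
        hN.target_eq]
      push_cast
      ring
  · rw [apply_edgeMidpoint_eq_zero hT hN hw he, zero_mul, mul_zero]

/-- The signed sum of the moments of the field `(F, G)` over all edges, weighted with the
increments of the piecewise affine `w`. By Green's formula, it measures the nonconformity of `w`. -/
def edgeDefect (T : ι → Fin 3 → Plane) (F G : Plane → ℝ) (w : ι → (Plane →ᵃ[ℝ] ℝ)) : ℝ :=
  ∑ i, SignType.sign (signedDoubleArea (T i)) *
    ∑ k : Fin 3, (w i (T i (k + 2)) - w i (T i (k + 1))) *
      fluxMoment F G (T i (k + 1)) (T i (k + 2))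

variable {F G f : Plane → ℝ}

theorem sum_setIntegral_add_load_eq_edgeDefect (hT : ∀ i, signedDoubleArea (T i) ≠ 0)
    (hN : IsNeighbourMap T N) (hF : ContDiff ℝ 1 F) (hG : ContDiff ℝ 1 G)
    (hf : ∀ z, dx F z + dy G z = f z) (hw : w ∈ crouzeixRaviart T) :
    (∑ i, ∫ z in triangle T i, (F z * slopeX (w i) + G z * slopeY (w i))) +
      load T f (pieces w) = edgeDefect T F G w := by
  have hcancel := sum_sign_mul_edgeMidpoint_mul_flux_eq_zero hT hN hw
    fun a b => ∫ t in (0 : ℝ)..1, normalFlux F G a b t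
  rw [load, ← Finset.sum_add_distrib, edgeDefect, ← zero_add (∑ i, _ * _), ← hcancel,
    ← Finset.sum_add_distrib]
  refine Finset.sum_congr rfl fun i _ => ?_
  rw [← mul_add, ← Finset.sum_add_distrib]
  simp_rw [← hf]
  exact setIntegral_triangle_green (hT i) hF hG (w i)

theorem brokenInner_pieces_right (T : ι → Fin 3 → Plane) (u : Plane → ℝ)
    (w : ι → (Plane →ᵃ[ℝ] ℝ)) : brokenInner T (fun _ => u) (pieces w) =
      ∑ i, ∫ z in triangle T i, (dx u z * slopeX (w i) + dy u z * slopeY (w i)) := by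
  unfold brokenInner
  congr! with i _ z
  · exact dx_affine (w i) z
  · exact dy_affine (w i) z

theorem consistencyTerm_eq_edgeDefect (hT : ∀ i, signedDoubleArea (T i) ≠ 0)
    (hN : IsNeighbourMap T N) {u : Plane → ℝ} (hx : ContDiff ℝ 1 (dx u)) (hy : ContDiff ℝ 1 (dy u))
    (hf : ∀ z, dx (dx u) z + dy (dy u) z = -f z) (hw : w ∈ crouzeixRaviart T) :
    consistencyTerm T u f w = edgeDefect T (dx u) (dy u) w := by
  have hload : load T (fun z => -f z) (pieces w) = -load T f (pieces w) := by
    simp only [load, neg_mul, integral_neg, Finset.sum_neg_distrib]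
  rw [← sum_setIntegral_add_load_eq_edgeDefect hT hN hx hy hf hw, ← brokenInner_pieces_right,
    hload, ← sub_eq_add_neg, consistencyTerm]

theorem abs_sign_le_one (x : ℝ) : |(SignType.sign x : ℝ)| ≤ 1 := by
  rcases SignType.sign x with _ | _ | _ <;> simp

theorem abs_edgeDefect_le {h δ : ℝ} (hx : ∀ i k, |(T i (k + 2)).1 - (T i (k + 1)).1| ≤ h)
    (hy : ∀ i k, |(T i (k + 2)).2 - (T i (k + 1)).2| ≤ h)
    (hδ : ∀ i k, |fluxMoment F G (T i (k + 1)) (T i (k + 2))| ≤ δ) (w : ι → (Plane →ᵃ[ℝ] ℝ)) :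
    |edgeDefect T F G w| ≤ 3 * h * δ * ∑ i, (|slopeX (w i)| + |slopeY (w i)|) := by
  rw [edgeDefect, Finset.mul_sum]
  refine (Finset.abs_sum_le_sum_abs _ _).trans (Finset.sum_le_sum fun i _ => ?_)
  have hside : ∀ k, |(w i (T i (k + 2)) - w i (T i (k + 1))) *
      fluxMoment F G (T i (k + 1)) (T i (k + 2))| ≤
        (|slopeX (w i)| + |slopeY (w i)|) * h * δ := fun k => by
    rw [abs_mul, affine_sub_eq]
    refine mul_le_mul ?_ (hδ i k) (abs_nonneg _)
      (mul_nonneg (by positivity) ((abs_nonneg _).trans (hx i k)))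
    refine (abs_add_le _ _).trans ?_
    rw [abs_mul, abs_mul, add_mul]
    exact add_le_add (mul_le_mul_of_nonneg_left (hx i k) (abs_nonneg _))
      (mul_le_mul_of_nonneg_left (hy i k) (abs_nonneg _))
  calc _ ≤ 1 * |∑ k : Fin 3, (w i (T i (k + 2)) - w i (T i (k + 1))) *
        fluxMoment F G (T i (k + 1)) (T i (k + 2))| := by
        rw [abs_mul]
        exact mul_le_mul_of_nonneg_right (abs_sign_le_one _) (abs_nonneg _)
    _ ≤ 1 * ∑ _k : Fin 3, (|slopeX (w i)| + |slopeY (w i)|) * h * δ :=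
        mul_le_mul_of_nonneg_left ((Finset.abs_sum_le_sum_abs _ _).trans
          (Finset.sum_le_sum fun k _ => hside k)) zero_le_one
    _ = 3 * h * δ * (|slopeX (w i)| + |slopeY (w i)|) := by
        rw [Finset.sum_const, Finset.card_univ, Fintype.card_fin, nsmul_eq_mul]
        push_cast
        ring

theorem sum_abs_slopes_le {a : ℝ} (ha : 0 < a) (hT : ∀ i, a ≤ volume.real (triangle T i))
    (w : ι → (Plane →ᵃ[ℝ] ℝ)) :
    ∑ i, (|slopeX (w i)| + |slopeY (w i)|) ≤
      Real.sqrt (2 * Fintype.card ι / a) * brokenNorm T (pieces w) := by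
  refine abs_le_of_sq_le_sq' ?_ (mul_nonneg (Real.sqrt_nonneg _) (brokenNorm_nonneg T _)) |>.2
  rw [mul_pow, Real.sq_sqrt (by positivity), brokenNorm_pieces_sq]
  calc (∑ i, (|slopeX (w i)| + |slopeY (w i)|)) ^ 2
      ≤ Fintype.card ι * ∑ i, (|slopeX (w i)| + |slopeY (w i)|) ^ 2 := sq_sum_le_card_mul_sum_sq
    _ ≤ Fintype.card ι * ∑ i, 2 / a * (volume.real (triangle T i) *
          (slopeX (w i) ^ 2 + slopeY (w i) ^ 2)) := by
        refine mul_le_mul_of_nonneg_left (Finset.sum_le_sum fun i _ => ?_) (Nat.cast_nonneg _)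
        rw [div_mul_eq_mul_div, le_div_iff₀ ha]
        have hsq : (|slopeX (w i)| + |slopeY (w i)|) ^ 2 ≤
            2 * (slopeX (w i) ^ 2 + slopeY (w i) ^ 2) := by
          rw [← sq_abs (slopeX _), ← sq_abs (slopeY _)]
          exact add_sq_le
        nlinarith [mul_le_mul_of_nonneg_right (hT i)
          (add_nonneg (sq_nonneg (slopeX (w i))) (sq_nonneg (slopeY (w i))))]
    _ = 2 * Fintype.card ι / a * ∑ i, volume.real (triangle T i) *
          (slopeX (w i) ^ 2 + slopeY (w i) ^ 2) := by
        rw [← Finset.mul_sum]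
        ring

end NeighbourMap

section GridIndices

variable {n m : ℕ}

/-- The horizontal grid index of a vertex of a triangle of the mesh. -/
def vertexX (n : ℕ) : Fin n ⊕ Fin (n + 1) → Fin 3 → ℕ
  | Sum.inl a => ![2 * a, 2 * a + 2, 2 * a + 1]
  | Sum.inr a => ![2 * a - 1, min (2 * a + 1) (2 * n), 2 * a]

/-- The vertical grid index of a vertex of a triangle in the strip `j` of the mesh. -/
def vertexY (n j : ℕ) : Fin n ⊕ Fin (n + 1) → Fin 3 → ℕ
  | Sum.inl _ => ![2 * ((j + 1) / 2), 2 * ((j + 1) / 2), 2 * (j / 2) + 1]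
  | Sum.inr _ => ![2 * (j / 2) + 1, 2 * (j / 2) + 1, 2 * ((j + 1) / 2)]

/-- The orientation of a triangle in the strip `j` of the mesh: `1` if its apex lies above its
horizontal edge, and `-1` otherwise. -/
def orient (n j : ℕ) : Fin n ⊕ Fin (n + 1) → ℝ
  | Sum.inl _ => (-1) ^ j
  | Sum.inr _ => -(-1) ^ j

theorem babuskaAziz_apply (j : Fin (2 * m)) (s : Fin n ⊕ Fin (n + 1)) (k : Fin 3) :
    babuskaAziz n m (j, s) k = gridPoint n m (vertexX n s k) (vertexY n j s k) := by
  rcases s with a | a <;> fin_cases k <;> rfl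

theorem gridPoint_injective (hn : 1 ≤ n) (hm : 1 ≤ m) {i j i' j' : ℕ}
    (h : gridPoint n m i j = gridPoint n m i' j') : i = i' ∧ j = j' := by
  have hn' : (2 * n : ℝ) ≠ 0 := by positivity
  have hm' : (2 * m : ℝ) ≠ 0 := by positivity
  obtain ⟨hi, hj⟩ := Prod.ext_iff.1 h
  exact ⟨Nat.cast_injective ((div_left_inj' hn').1 hi),
    Nat.cast_injective ((div_left_inj' hm').1 hj)⟩

theorem vertexX_zero_lt_vertexX_one (hn : 1 ≤ n) (s : Fin n ⊕ Fin (n + 1)) :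
    vertexX n s 0 < vertexX n s 1 := by
  rcases s with a | a <;> simp [vertexX]
  omega

theorem vertexX_one_le (s : Fin n ⊕ Fin (n + 1)) : vertexX n s 1 ≤ vertexX n s 0 + 2 := by
  rcases s with a | a <;> simp [vertexX]
  omega

theorem vertexX_zero_le (s : Fin n ⊕ Fin (n + 1)) (k : Fin 3) : vertexX n s 0 ≤ vertexX n s k := by
  rcases s with a | a <;> fin_cases k <;> simp [vertexX]
  omega

theorem vertexX_le_vertexX_one (s : Fin n ⊕ Fin (n + 1)) (k : Fin 3) :
    vertexX n s k ≤ vertexX n s 1 := by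
  rcases s with a | a <;> fin_cases k <;> simp [vertexX] <;> omega

theorem vertexX_one_le_two_mul (s : Fin n ⊕ Fin (n + 1)) : vertexX n s 1 ≤ 2 * n := by
  rcases s with a | a <;> simp [vertexX]
  omega

theorem le_vertexY (j : ℕ) (s : Fin n ⊕ Fin (n + 1)) (k : Fin 3) : j ≤ vertexY n j s k := by
  rcases s with a | a <;> fin_cases k <;> simp [vertexY] <;> omega

theorem vertexY_le (j : ℕ) (s : Fin n ⊕ Fin (n + 1)) (k : Fin 3) : vertexY n j s k ≤ j + 1 := by
  rcases s with a | a <;> fin_cases k <;> simp [vertexY] <;> omega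

theorem vertexY_two_sub_vertexY_zero (j : ℕ) (s : Fin n ⊕ Fin (n + 1)) :
    (vertexY n j s 2 : ℝ) - vertexY n j s 0 = orient n j s := by
  rcases Nat.even_or_odd' j with ⟨c, rfl | rfl⟩
  · have h : (2 * c + 1) / 2 = c := by omega
    rcases s with a | a <;> simp [vertexY, orient, h]
  · have h₁ : (2 * c + 1) / 2 = c := by omega
    have h₂ : (2 * c + 1 + 1) / 2 = c + 1 := by omega
    rcases s with a | a <;> simp [vertexY, orient, h₁, h₂, pow_succ] <;> ring

theorem edge_index_sum_eq (hn : 1 ≤ n) (hm : 1 ≤ m) {j j' : Fin (2 * m)}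
    {s s' : Fin n ⊕ Fin (n + 1)} {k k' : Fin 3}
    (h : edge (babuskaAziz n m) (j, s) k = edge (babuskaAziz n m) (j', s') k') :
    vertexX n s (k + 1) + vertexX n s (k + 2) = vertexX n s' (k' + 1) + vertexX n s' (k' + 2) ∧
    vertexY n j s (k + 1) + vertexY n j s (k + 2) =
      vertexY n j' s' (k' + 1) + vertexY n j' s' (k' + 2) := by
  unfold edge at h
  simp only [babuskaAziz_apply] at h
  rcases Sym2.eq_iff.1 h with ⟨h₁, h₂⟩ | ⟨h₁, h₂⟩ <;>
  · have := gridPoint_injective hn hm h₁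
    have := gridPoint_injective hn hm h₂
    omega

end GridIndices

section MeshNeighbours

variable {n m : ℕ}

/-- The strip on the other side of the even line bounding the strip `j`, or `j` itself if that line
is a side of the square (for `j = 0` the difference is truncated). -/
def acrossEvenLine (j : Fin (2 * m)) : Fin (2 * m) :=
  ⟨if (j : ℕ) % 2 = 0 then j - 1 else min (j + 1) (2 * m - 1), by split_ifs <;> omega⟩

/-- The strip on the other side of the odd line bounding the strip `j`. -/
def acrossOddLine (j : Fin (2 * m)) : Fin (2 * m) :=
  ⟨if (j : ℕ) % 2 = 0 then j + 1 else j - 1, by split_ifs <;> omega⟩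

/-- The neighbour map of the Babuška–Aziz triangulation. -/
def meshNeighbour : (Fin (2 * m) × (Fin n ⊕ Fin (n + 1))) × Fin 3 →
    (Fin (2 * m) × (Fin n ⊕ Fin (n + 1))) × Fin 3
  | ((j, Sum.inl a), 0) => ((j, Sum.inr a.succ), 1)
  | ((j, Sum.inl a), 1) => ((j, Sum.inr a.castSucc), 0)
  | ((j, Sum.inl a), 2) => ((acrossEvenLine j, Sum.inl a), 2)
  | ((j, Sum.inr a), 0) =>
      if h : (a : ℕ) < n then ((j, Sum.inl ⟨a, h⟩), 1) else ((j, Sum.inr a), 0)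
  | ((j, Sum.inr a), 1) =>
      if h : 0 < (a : ℕ) then ((j, Sum.inl ⟨a - 1, by omega⟩), 0) else ((j, Sum.inr a), 1)
  | ((j, Sum.inr a), 2) => ((acrossOddLine j, Sum.inr a), 2)

theorem acrossEvenLine_involutive : Function.Involutive (acrossEvenLine (m := m)) := fun j => by
  have := j.2
  ext
  simp only [acrossEvenLine]
  split_ifs <;> omega

theorem acrossOddLine_involutive : Function.Involutive (acrossOddLine (m := m)) := fun j => by
  have := j.2
  ext
  simp only [acrossOddLine]
  split_ifs <;> omega

theorem acrossEvenLine_add_one_div_two (j : Fin (2 * m)) :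
    ((acrossEvenLine j : ℕ) + 1) / 2 = (j + 1) / 2 := by
  have := j.2
  simp only [acrossEvenLine]
  split_ifs <;> omega

theorem acrossOddLine_div_two (j : Fin (2 * m)) : (acrossOddLine j : ℕ) / 2 = j / 2 := by
  have := j.2
  simp only [acrossOddLine]
  split_ifs <;> omega

theorem neg_one_pow_eq_neg_of_mod_two_ne {a b : ℕ} (h : a % 2 ≠ b % 2) :
    (-1 : ℝ) ^ a = -(-1) ^ b := by
  rcases Nat.even_or_odd b with hb | hb
  · rw [hb.neg_one_pow, Odd.neg_one_pow (by grind)]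
  · rw [hb.neg_one_pow, Even.neg_one_pow (by grind), neg_neg]

theorem neg_one_pow_acrossEvenLine {j : Fin (2 * m)} (hj : acrossEvenLine j ≠ j) :
    (-1 : ℝ) ^ (acrossEvenLine j : ℕ) = -(-1) ^ (j : ℕ) := by
  refine neg_one_pow_eq_neg_of_mod_two_ne ?_
  rw [Ne, Fin.ext_iff] at hj
  simp only [acrossEvenLine] at hj ⊢
  split_ifs at hj ⊢ <;> omega

theorem neg_one_pow_acrossOddLine (j : Fin (2 * m)) :
    (-1 : ℝ) ^ (acrossOddLine j : ℕ) = -(-1) ^ (j : ℕ) := by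
  refine neg_one_pow_eq_neg_of_mod_two_ne ?_
  simp only [acrossOddLine]
  split_ifs <;> omega

theorem meshNeighbour_involutive : Function.Involutive (meshNeighbour (n := n) (m := m)) := by
  rintro ⟨⟨j, a | a⟩, k⟩ <;> fin_cases k <;>
    simp only [Fin.zero_eta, Fin.mk_one, Fin.reduceFinMk, meshNeighbour]
  · simp
  · simp
  · rw [acrossEvenLine_involutive]
  · split_ifs with h
    · rfl
    · simp [h]
  · split_ifs with h
    · simp [Fin.ext_iff]
      omega
    · simp [h]
  · rw [acrossOddLine_involutive]

/-- The four alternatives belong to the right, left, lower and upper side of the square. -/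
theorem eq_of_meshNeighbour_eq_self {j : Fin (2 * m)} {s : Fin n ⊕ Fin (n + 1)} {k : Fin 3}
    (h : meshNeighbour ((j, s), k) = ((j, s), k)) :
    (∃ a, s = Sum.inr a ∧ k = 0 ∧ (a : ℕ) = n) ∨ (∃ a, s = Sum.inr a ∧ k = 1 ∧ (a : ℕ) = 0) ∨
    (∃ a, s = Sum.inl a ∧ k = 2 ∧ (j : ℕ) = 0) ∨
    (∃ a, s = Sum.inl a ∧ k = 2 ∧ (j : ℕ) + 1 = 2 * m) := by
  have := j.2
  rcases s with a | a <;> fin_cases k <;>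
    simp only [Fin.zero_eta, Fin.mk_one, Fin.reduceFinMk, meshNeighbour] at h
  · simp at h
  · simp at h
  · simp [acrossEvenLine, Fin.ext_iff, -Fin.val_eq_zero_iff] at h ⊢
    split_ifs at h <;> omega
  · split_ifs at h with ha
    · simp at h
    · exact Or.inl ⟨a, rfl, rfl, by omega⟩
  · split_ifs at h with ha
    · simp at h
    · exact Or.inr (Or.inl ⟨a, rfl, rfl, by omega⟩)
  · simp [acrossOddLine, Fin.ext_iff] at h
    split_ifs at h <;> omega

theorem isBoundaryEdge_of_meshNeighbour_eq_self (hn : 1 ≤ n) (hm : 1 ≤ m) {j : Fin (2 * m)}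
    {s : Fin n ⊕ Fin (n + 1)} {k : Fin 3} (h : meshNeighbour ((j, s), k) = ((j, s), k)) :
    IsBoundaryEdge (babuskaAziz n m) (j, s) k := by
  rintro ⟨j', s'⟩ k' he
  obtain ⟨hx, hy⟩ := edge_index_sum_eq hn hm he
  have := j'.2
  rcases eq_of_meshNeighbour_eq_self h with
      ⟨a, rfl, rfl, ha⟩ | ⟨a, rfl, rfl, ha⟩ | ⟨a, rfl, rfl, hj⟩ | ⟨a, rfl, rfl, hj⟩ <;>
    rcases s' with a' | a' <;> fin_cases k' <;>
    simp [vertexX, vertexY, Fin.ext_iff, -Fin.val_eq_zero_iff] at hx hy ⊢ <;> omega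

theorem meshNeighbour_fst_ne (e : (Fin (2 * m) × (Fin n ⊕ Fin (n + 1))) × Fin 3)
    (he : meshNeighbour e ≠ e) : (meshNeighbour e).1 ≠ e.1 := by
  obtain ⟨⟨j, a | a⟩, k⟩ := e <;> fin_cases k <;>
    simp only [Fin.zero_eta, Fin.mk_one, Fin.reduceFinMk, meshNeighbour] at he ⊢ <;>
    try split_ifs at he ⊢
  all_goals simp_all

theorem vertex_meshNeighbour (e : (Fin (2 * m) × (Fin n ⊕ Fin (n + 1))) × Fin 3) (i : Fin 2) :
    vertexX n (meshNeighbour e).1.2 ((meshNeighbour e).2 + i.succ) =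
        vertexX n e.1.2 (e.2 + i.succ) ∧
      vertexY n (meshNeighbour e).1.1 (meshNeighbour e).1.2 ((meshNeighbour e).2 + i.succ) =
        vertexY n e.1.1 e.1.2 (e.2 + i.succ) := by
  obtain ⟨⟨j, a | a⟩, k⟩ := e <;> fin_cases k <;> fin_cases i <;>
    simp only [Fin.zero_eta, Fin.mk_one, Fin.reduceFinMk, meshNeighbour] <;>
    try split_ifs
  all_goals simp [vertexX, vertexY, acrossEvenLine_add_one_div_two, acrossOddLine_div_two] <;> omega

theorem orient_meshNeighbour (e : (Fin (2 * m) × (Fin n ⊕ Fin (n + 1))) × Fin 3)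
    (he : meshNeighbour e ≠ e) :
    orient n (meshNeighbour e).1.1 (meshNeighbour e).1.2 = -orient n e.1.1 e.1.2 := by
  obtain ⟨⟨j, a | a⟩, k⟩ := e <;> fin_cases k <;>
    simp only [Fin.zero_eta, Fin.mk_one, Fin.reduceFinMk, meshNeighbour] at he ⊢ <;>
    try split_ifs at he ⊢
  · simp [orient]
  · simp [orient]
  · exact neg_one_pow_acrossEvenLine (by simpa using he)
  · simp [orient]
  · exact absurd rfl he
  · simp [orient]
  · exact absurd rfl he
  · simp [orient, neg_one_pow_acrossOddLine]

theorem signedDoubleArea_babuskaAziz (j : Fin (2 * m)) (s : Fin n ⊕ Fin (n + 1)) :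
    signedDoubleArea (babuskaAziz n m (j, s)) =
      (vertexX n s 1 - vertexX n s 0) * orient n j s / (2 * n * (2 * m)) := by
  have hY : (vertexY n j s 1 : ℝ) = vertexY n j s 0 := by rcases s with a | a <;> rfl
  rw [signedDoubleArea, babuskaAziz_apply, babuskaAziz_apply, babuskaAziz_apply,
    ← vertexY_two_sub_vertexY_zero]
  simp only [gridPoint, Prod.fst_sub, Prod.snd_sub, hY]
  ring

theorem sign_signedDoubleArea_babuskaAziz (hn : 1 ≤ n) (j : Fin (2 * m))
    (s : Fin n ⊕ Fin (n + 1)) :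
    SignType.sign (signedDoubleArea (babuskaAziz n m (j, s))) = SignType.sign (orient n j s) := by
  have hm : 0 < m := by have := j.2; omega
  have hX : (0 : ℝ) < vertexX n s 1 - vertexX n s 0 :=
    sub_pos.2 (Nat.cast_lt.2 (vertexX_zero_lt_vertexX_one hn s))
  have hscale : 0 < ((vertexX n s 1 : ℝ) - vertexX n s 0) / (2 * n * (2 * m)) := by positivity
  rw [signedDoubleArea_babuskaAziz, mul_div_right_comm, sign_mul, sign_pos hscale, one_mul]

theorem isNeighbourMap_meshNeighbour (hn : 1 ≤ n) (hm : 1 ≤ m) :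
    IsNeighbourMap (babuskaAziz n m) meshNeighbour where
  involutive := meshNeighbour_involutive
  isBoundaryEdge _ he := isBoundaryEdge_of_meshNeighbour_eq_self hn hm he
  fst_ne := meshNeighbour_fst_ne
  source_eq e := by
    rw [babuskaAziz_apply, babuskaAziz_apply]
    exact congrArg₂ _ (vertex_meshNeighbour e 0).1 (vertex_meshNeighbour e 0).2
  target_eq e := by
    rw [babuskaAziz_apply, babuskaAziz_apply]
    exact congrArg₂ _ (vertex_meshNeighbour e 1).1 (vertex_meshNeighbour e 1).2
  sign_eq e he := by
    rw [sign_signedDoubleArea_babuskaAziz hn, sign_signedDoubleArea_babuskaAziz hn,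
      orient_meshNeighbour e he, Left.sign_neg]

end MeshNeighbours

section MeshSize

variable {n m : ℕ}

theorem abs_orient (j : ℕ) (s : Fin n ⊕ Fin (n + 1)) : |orient n j s| = 1 := by
  rcases s with a | a <;> simp [orient]

theorem signedDoubleArea_babuskaAziz_ne_zero (hn : 1 ≤ n)
    (i : Fin (2 * m) × (Fin n ⊕ Fin (n + 1))) : signedDoubleArea (babuskaAziz n m i) ≠ 0 := by
  have ho : orient n i.1 i.2 ≠ 0 := abs_pos.1 (by rw [abs_orient]; exact one_pos)
  rw [← sign_ne_zero, sign_signedDoubleArea_babuskaAziz hn, sign_ne_zero]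
  exact ho

theorem volume_real_triangle_babuskaAziz (hn : 1 ≤ n) (j : Fin (2 * m))
    (s : Fin n ⊕ Fin (n + 1)) :
    volume.real (triangle (babuskaAziz n m) (j, s)) =
      ((vertexX n s 1 : ℝ) - vertexX n s 0) / (8 * n * m) := by
  have hX : (0 : ℝ) < vertexX n s 1 - vertexX n s 0 :=
    sub_pos.2 (Nat.cast_lt.2 (vertexX_zero_lt_vertexX_one hn s))
  rw [triangle, volume_real_triangle (signedDoubleArea_babuskaAziz_ne_zero hn _),
    signedDoubleArea_babuskaAziz, abs_div, abs_mul, abs_orient, abs_of_pos hX,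
    abs_of_nonneg (by positivity : (0 : ℝ) ≤ 2 * n * (2 * m)), mul_one, div_div]
  ring_nf

theorem one_div_le_volume_real_triangle (hn : 1 ≤ n) (i : Fin (2 * m) × (Fin n ⊕ Fin (n + 1))) :
    1 / (8 * n * m : ℝ) ≤ volume.real (triangle (babuskaAziz n m) i) := by
  have hX : (vertexX n i.2 0 : ℝ) + 1 ≤ vertexX n i.2 1 := by
    exact_mod_cast vertexX_zero_lt_vertexX_one hn i.2
  rw [volume_real_triangle_babuskaAziz hn]
  gcongr
  linarith

theorem volume_real_triangle_le (hn : 1 ≤ n) (i : Fin (2 * m) × (Fin n ⊕ Fin (n + 1))) :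
    volume.real (triangle (babuskaAziz n m) i) ≤ 1 / (4 * n * m) := by
  have hX : (vertexX n i.2 1 : ℝ) ≤ vertexX n i.2 0 + 2 := by
    exact_mod_cast vertexX_one_le i.2
  rw [volume_real_triangle_babuskaAziz hn]
  calc _ ≤ 2 / (8 * n * m : ℝ) := by gcongr; linarith
    _ = 1 / (4 * n * m) := by ring

theorem card_triangles_le (hn : 1 ≤ n) :
    (Fintype.card (Fin (2 * m) × (Fin n ⊕ Fin (n + 1))) : ℝ) ≤ 6 * n * m := by
  have hn' : (1 : ℝ) ≤ n := Nat.one_le_cast.2 hn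
  simp only [Fintype.card_prod, Fintype.card_sum, Fintype.card_fin]
  push_cast
  nlinarith [mul_nonneg (sub_nonneg.2 hn') m.cast_nonneg]

theorem sum_volume_real_triangle_le (hn : 1 ≤ n) (hm : 1 ≤ m) :
    ∑ i, volume.real (triangle (babuskaAziz n m) i) ≤ 3 / 2 :=
  calc ∑ i, volume.real (triangle (babuskaAziz n m) i)
    _ ≤ (Fintype.card (Fin (2 * m) × (Fin n ⊕ Fin (n + 1))) : ℝ) * (1 / (4 * n * m)) := by
      rw [← nsmul_eq_mul]
      exact Finset.sum_le_card_nsmul _ _ _ fun i _ => volume_real_triangle_le hn i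
    _ ≤ 6 * n * m * (1 / (4 * n * m)) := by gcongr; exact card_triangles_le hn
    _ = 3 / 2 := by field_simp; norm_num

theorem sum_abs_slopes_babuskaAziz_le (hn : 1 ≤ n) (hm : 1 ≤ m)
    (w : Fin (2 * m) × (Fin n ⊕ Fin (n + 1)) → (Plane →ᵃ[ℝ] ℝ)) :
    ∑ i, (|slopeX (w i)| + |slopeY (w i)|) ≤
      10 * n * m * brokenNorm (babuskaAziz n m) (pieces w) := by
  refine (sum_abs_slopes_le (a := 1 / (8 * n * m)) (by positivity)
    (one_div_le_volume_real_triangle hn) w).trans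
    (mul_le_mul_of_nonneg_right (Real.sqrt_le_iff.2 ⟨by positivity, ?_⟩) (brokenNorm_nonneg _ _))
  rw [one_div, div_inv_eq_mul]
  calc 2 * (Fintype.card (Fin (2 * m) × (Fin n ⊕ Fin (n + 1))) : ℝ) * (8 * n * m)
    _ ≤ 2 * (6 * n * m) * (8 * n * m) := by gcongr; exact card_triangles_le hn
    _ ≤ (10 * n * m) ^ 2 := by nlinarith [sq_nonneg ((n : ℝ) * m)]

theorem vertex_mem_triangle {ι : Type} (T : ι → Fin 3 → Plane) (i : ι) (k : Fin 3) :
    T i k ∈ triangle T i :=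
  subset_convexHull ℝ _ (Set.mem_range_self k)

theorem lineMap_mem_triangle {ι : Type} (T : ι → Fin 3 → Plane) (i : ι) (k l : Fin 3) {t : ℝ}
    (ht : t ∈ Set.Icc (0 : ℝ) 1) : AffineMap.lineMap (T i k) (T i l) t ∈ triangle T i :=
  (convex_convexHull ℝ _).lineMap_mem (vertex_mem_triangle T i k) (vertex_mem_triangle T i l) ht

theorem triangle_babuskaAziz_subset (j : Fin (2 * m)) (s : Fin n ⊕ Fin (n + 1)) :
    triangle (babuskaAziz n m) (j, s) ⊆
      Set.Icc (gridPoint n m (vertexX n s 0) j) (gridPoint n m (vertexX n s 1) (j + 1)) := by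
  refine convexHull_min ?_ (convex_Icc _ _)
  rintro - ⟨k, rfl⟩
  rw [babuskaAziz_apply]
  refine ⟨⟨?_, ?_⟩, ⟨?_, ?_⟩⟩ <;> simp only [gridPoint] <;> gcongr
  exacts [vertexX_zero_le s k, le_vertexY j s k, vertexX_le_vertexX_one s k, vertexY_le j s k]

theorem triangle_babuskaAziz_subset_unitSquare (i : Fin (2 * m) × (Fin n ⊕ Fin (n + 1))) :
    triangle (babuskaAziz n m) i ⊆ Set.Icc 0 1 := by
  refine (triangle_babuskaAziz_subset i.1 i.2).trans (Set.Icc_subset_Icc ⟨?_, ?_⟩ ⟨?_, ?_⟩)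
  · exact div_nonneg (Nat.cast_nonneg _) (by positivity)
  · exact div_nonneg (Nat.cast_nonneg _) (by positivity)
  · exact div_le_one_of_le₀ (by exact_mod_cast vertexX_one_le_two_mul i.2) (by positivity)
  · exact div_le_one_of_le₀ (by exact_mod_cast i.1.2) (by positivity)

theorem abs_fst_sub_le {i : Fin (2 * m) × (Fin n ⊕ Fin (n + 1))} {p q : Plane}
    (hp : p ∈ triangle (babuskaAziz n m) i) (hq : q ∈ triangle (babuskaAziz n m) i) :
    |p.1 - q.1| ≤ 1 / n := by
  obtain ⟨⟨hp₁, -⟩, ⟨hp₂, -⟩⟩ := triangle_babuskaAziz_subset i.1 i.2 hp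
  obtain ⟨⟨hq₁, -⟩, ⟨hq₂, -⟩⟩ := triangle_babuskaAziz_subset i.1 i.2 hq
  refine (abs_sub_le_of_le_of_le hp₁ hp₂ hq₁ hq₂).trans ?_
  have hX : (vertexX n i.2 1 : ℝ) ≤ vertexX n i.2 0 + 2 := by exact_mod_cast vertexX_one_le i.2
  calc (gridPoint n m (vertexX n i.2 1) (i.1 + 1)).1 - (gridPoint n m (vertexX n i.2 0) i.1).1
    _ = ((vertexX n i.2 1 : ℝ) - vertexX n i.2 0) / (2 * n) := (sub_div _ _ _).symm
    _ ≤ 2 / (2 * n) := by gcongr; linarith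
    _ = 1 / n := by ring

theorem abs_snd_sub_le {i : Fin (2 * m) × (Fin n ⊕ Fin (n + 1))} {p q : Plane}
    (hp : p ∈ triangle (babuskaAziz n m) i) (hq : q ∈ triangle (babuskaAziz n m) i) :
    |p.2 - q.2| ≤ 1 / (2 * m) := by
  obtain ⟨⟨-, hp₁⟩, ⟨-, hp₂⟩⟩ := triangle_babuskaAziz_subset i.1 i.2 hp
  obtain ⟨⟨-, hq₁⟩, ⟨-, hq₂⟩⟩ := triangle_babuskaAziz_subset i.1 i.2 hq
  refine (abs_sub_le_of_le_of_le hp₁ hp₂ hq₁ hq₂).trans_eq ?_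
  simp only [gridPoint]
  push_cast
  ring

end MeshSize

section UniqueSolvability

variable {n m : ℕ}

theorem eq_zero_of_brokenNorm_eq_zero (hn : 1 ≤ n) (hm : 1 ≤ m)
    {w : Fin (2 * m) × (Fin n ⊕ Fin (n + 1)) → (Plane →ᵃ[ℝ] ℝ)}
    (hw : w ∈ crouzeixRaviart (babuskaAziz n m))
    (h0 : brokenNorm (babuskaAziz n m) (pieces w) = 0) : w = 0 := by
  obtain ⟨c, hwc, hcN, hc0⟩ := exists_const_of_brokenNorm_eq_zero
    (signedDoubleArea_babuskaAziz_ne_zero hn) (isNeighbourMap_meshNeighbour hn hm) hw h0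
  have hodd : ∀ (j : Fin (2 * m)) (a : Fin (n + 1)), c (j, Sum.inr a) = 0 := fun j a => by
    induction a using Fin.induction with
    | zero => exact hc0 ((j, Sum.inr 0), 1) (by simp [meshNeighbour])
    | succ a ih =>
      exact (hcN ((j, Sum.inl a), 0)).trans ((hcN ((j, Sum.inl a), 1)).symm.trans ih)
  have heven : ∀ (j : Fin (2 * m)) (a : Fin n), c (j, Sum.inl a) = 0 := fun j a =>
    (hcN ((j, Sum.inl a), 0)).symm.trans (hodd j a.succ)
  funext ⟨j, s⟩
  ext p
  rw [hwc]
  rcases s with a | a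
  exacts [heven j a, hodd j a]

end UniqueSolvability

section NeighbourMapBoundary

variable {ι : Type} {T : ι → Fin 3 → Plane}

theorem IsNeighbourMap.eq_of_isBoundaryEdge {N : ι × Fin 3 → ι × Fin 3} (hN : IsNeighbourMap T N)
    {i : ι} {k : Fin 3} (h : IsBoundaryEdge T i k) : N (i, k) = (i, k) := by
  by_contra hne
  refine hN.fst_ne _ hne (h _ (N (i, k)).2 ?_)
  rw [edge, hN.source_eq, hN.target_eq, edge]

theorem exists_crouzeixRaviart_apply_edgeMidpoint (hT : ∀ i, signedDoubleArea (T i) ≠ 0)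
    {g : Plane → ℝ} (hg : ∀ i k, IsBoundaryEdge T i k → g (edgeMidpoint T i k) = 0) :
    ∃ w ∈ crouzeixRaviart T, ∀ i k, w i (edgeMidpoint T i k) = g (edgeMidpoint T i k) := by
  choose w hw using fun i => exists_affine_apply_edgeMidpoint (hT i) fun k =>
    g (edgeMidpoint T i k)
  exact ⟨w, mem_crouzeixRaviart_of_edgeMidpoint (Sym2.lift ⟨fun a b => g (midpoint ℝ a b),
    fun a b => congrArg g (midpoint_comm a b)⟩) hw hg, hw⟩

theorem lineMap_mem_boundary {n m : ℕ} (hn : 1 ≤ n) (hm : 1 ≤ m)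
    {i : Fin (2 * m) × (Fin n ⊕ Fin (n + 1))} {k : Fin 3}
    (h : IsBoundaryEdge (babuskaAziz n m) i k) (t : ℝ) :
    let p : Plane := AffineMap.lineMap (babuskaAziz n m i (k + 1)) (babuskaAziz n m i (k + 2)) t
    (p.1 = 0 ∨ p.1 = 1) ∨ p.2 = 0 ∨ p.2 = 1 := by
  obtain ⟨j, s⟩ := i
  have hn' : (n : ℝ) ≠ 0 := by positivity
  have hm' : (m : ℝ) ≠ 0 := by positivity
  simp only [babuskaAziz_apply, AffineMap.fst_lineMap, AffineMap.snd_lineMap, gridPoint]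
  rcases eq_of_meshNeighbour_eq_self ((isNeighbourMap_meshNeighbour hn hm).eq_of_isBoundaryEdge h)
    with ⟨a, rfl, rfl, ha⟩ | ⟨a, rfl, rfl, ha⟩ | ⟨a, rfl, rfl, hj⟩ | ⟨a, rfl, rfl, hj⟩
  · refine Or.inl (Or.inr ?_)
    simp [vertexX, ha, hn']
  · refine Or.inl (Or.inl ?_)
    simp [vertexX, ha]
  · refine Or.inr (Or.inl ?_)
    simp [vertexY, hj]
  · have hj2 : 2 * (((j : ℕ) + 1) / 2) = 2 * m := by omega
    refine Or.inr (Or.inr ?_)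
    simp [vertexY, hj2, hm']

end NeighbourMapBoundary

section ModelProblem

variable {z : Plane} {g : Plane → ℝ} {g' : ℝ}

theorem dx_eq_of_hasDerivAt (hg : DifferentiableAt ℝ g z)
    (h : HasDerivAt (fun x => g (x, z.2)) g' z.1) : dx g z = g' :=
  (hg.hasFDerivAt.comp_hasDerivAt (x := z.1) (f := fun x => (x, z.2))
    ((hasDerivAt_id _).prodMk (hasDerivAt_const _ _))).unique h

theorem dy_eq_of_hasDerivAt (hg : DifferentiableAt ℝ g z)
    (h : HasDerivAt (fun y => g (z.1, y)) g' z.2) : dy g z = g' :=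
  (hg.hasFDerivAt.comp_hasDerivAt (x := z.2) (f := fun y => (z.1, y))
    ((hasDerivAt_const _ _).prodMk (hasDerivAt_id _))).unique h

theorem contDiff_modelU : ContDiff ℝ 1 modelU := by
  unfold modelU
  fun_prop

theorem continuous_modelF : Continuous modelF := by
  unfold modelF
  fun_prop

theorem hasDerivAt_mul_one_sub (x : ℝ) : HasDerivAt (fun x : ℝ => x * (1 - x)) (1 - 2 * x) x :=
  ((hasDerivAt_id x).mul ((hasDerivAt_id x).const_sub 1)).congr_deriv (by simp; ring)

theorem hasDerivAt_one_sub_two_mul (x : ℝ) : HasDerivAt (fun x : ℝ => 1 - 2 * x) (-2) x :=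
  (((hasDerivAt_id x).const_mul 2).const_sub 1).congr_deriv (by ring)

theorem dx_modelU : dx modelU = fun z => (1 - 2 * z.1) * (z.2 * (1 - z.2)) :=
  funext fun z => dx_eq_of_hasDerivAt (contDiff_modelU.differentiable one_ne_zero z)
    ((hasDerivAt_mul_one_sub z.1).mul_const (z.2 * (1 - z.2)))

theorem dy_modelU : dy modelU = fun z => (1 - 2 * z.2) * (z.1 * (1 - z.1)) :=
  funext fun z => dy_eq_of_hasDerivAt (contDiff_modelU.differentiable one_ne_zero z)
    (((hasDerivAt_mul_one_sub z.2).const_mul (z.1 * (1 - z.1))).congr_deriv (mul_comm _ _))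

theorem contDiff_dx_modelU : ContDiff ℝ 1 (dx modelU) := by
  rw [dx_modelU]
  fun_prop

theorem contDiff_dy_modelU : ContDiff ℝ 1 (dy modelU) := by
  rw [dy_modelU]
  fun_prop

theorem dx_dx_modelU_add_dy_dy_modelU (z : Plane) :
    dx (dx modelU) z + dy (dy modelU) z = -modelF z := by
  rw [dx_eq_of_hasDerivAt (contDiff_dx_modelU.differentiable one_ne_zero z)
      (by simpa only [dx_modelU] using (hasDerivAt_one_sub_two_mul z.1).mul_const _),
    dy_eq_of_hasDerivAt (contDiff_dy_modelU.differentiable one_ne_zero z)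
      (by simpa only [dy_modelU] using (hasDerivAt_one_sub_two_mul z.2).mul_const _), modelF]
  ring

/-- An antiderivative of `modelF` in `x`: the field `(modelFPrimitive, 0)` has the divergence
`modelF`, but no component in the direction in which the triangles are thin. -/
def modelFPrimitive (z : Plane) : ℝ := z.1 ^ 2 - 2 / 3 * z.1 ^ 3 + 2 * z.1 * (z.2 * (1 - z.2))

theorem contDiff_modelFPrimitive : ContDiff ℝ 1 modelFPrimitive := by
  unfold modelFPrimitive
  fun_prop

theorem dx_modelFPrimitive (z : Plane) : dx modelFPrimitive z = modelF z :=
  dx_eq_of_hasDerivAt (contDiff_modelFPrimitive.differentiable one_ne_zero z)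
    ((((hasDerivAt_pow 2 z.1).sub ((hasDerivAt_pow 3 z.1).const_mul (2 / 3))).add
      (((hasDerivAt_id z.1).const_mul 2).mul_const (z.2 * (1 - z.2)))).congr_deriv
      (by simp only [modelF]; push_cast; ring))

end ModelProblem

section ModelBounds

theorem mul_one_sub_mem_Icc {x : ℝ} (hx : x ∈ Set.Icc (0 : ℝ) 1) :
    x * (1 - x) ∈ Set.Icc (0 : ℝ) (1 / 4) :=
  ⟨mul_nonneg hx.1 (sub_nonneg.2 hx.2), by nlinarith [sq_nonneg (x - 1 / 2)]⟩

theorem abs_one_sub_two_mul_le {x : ℝ} (hx : x ∈ Set.Icc (0 : ℝ) 1) : |1 - 2 * x| ≤ 1 :=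
  abs_le.2 ⟨by linarith [hx.2], by linarith [hx.1]⟩

theorem abs_mul_one_sub_sub_le {x y : ℝ} (hx : x ∈ Set.Icc (0 : ℝ) 1)
    (hy : y ∈ Set.Icc (0 : ℝ) 1) : |x * (1 - x) - y * (1 - y)| ≤ |x - y| := by
  rw [show x * (1 - x) - y * (1 - y) = (1 - x - y) * (x - y) by ring, abs_mul]
  exact mul_le_of_le_one_left (abs_nonneg _)
    (abs_le.2 ⟨by linarith [hx.2, hy.2], by linarith [hx.1, hy.1]⟩)

theorem abs_product_sub_le {x y x' y' : ℝ} (hx : x ∈ Set.Icc (0 : ℝ) 1)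
    (hy : y ∈ Set.Icc (0 : ℝ) 1) (hy' : y' ∈ Set.Icc (0 : ℝ) 1) :
    |(1 - 2 * x) * (y * (1 - y)) - (1 - 2 * x') * (y' * (1 - y'))| ≤ |x - x'| / 2 + |y - y'| := by
  have hquarter := mul_one_sub_mem_Icc hy'
  rw [show (1 - 2 * x) * (y * (1 - y)) - (1 - 2 * x') * (y' * (1 - y')) =
    (1 - 2 * x) * (y * (1 - y) - y' * (1 - y')) + (x - x') * (-2 * (y' * (1 - y'))) by ring]
  refine (abs_add_le _ _).trans ?_
  rw [abs_mul, abs_mul, add_comm]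
  refine add_le_add ?_ ?_
  · rw [div_eq_mul_one_div]
    exact mul_le_mul_of_nonneg_left
      (abs_le.2 ⟨by linarith [hquarter.2], by linarith [hquarter.1]⟩) (abs_nonneg _)
  · exact (mul_le_of_le_one_left (abs_nonneg _) (abs_one_sub_two_mul_le hx)).trans
      (abs_mul_one_sub_sub_le hy hy')

variable {z z' : Plane}

theorem abs_dx_modelU_sub_le (hz : z ∈ Set.Icc (0 : Plane) 1) (hz' : z' ∈ Set.Icc (0 : Plane) 1) :
    |dx modelU z - dx modelU z'| ≤ |z.1 - z'.1| / 2 + |z.2 - z'.2| := by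
  rw [dx_modelU]
  exact abs_product_sub_le ⟨hz.1.1, hz.2.1⟩ ⟨hz.1.2, hz.2.2⟩ ⟨hz'.1.2, hz'.2.2⟩

theorem abs_dy_modelU_sub_le (hz : z ∈ Set.Icc (0 : Plane) 1) (hz' : z' ∈ Set.Icc (0 : Plane) 1) :
    |dy modelU z - dy modelU z'| ≤ |z.2 - z'.2| / 2 + |z.1 - z'.1| := by
  rw [dy_modelU]
  exact abs_product_sub_le ⟨hz.1.2, hz.2.2⟩ ⟨hz.1.1, hz.2.1⟩ ⟨hz'.1.1, hz'.2.1⟩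

theorem abs_product_le_one {x y : ℝ} (hx : x ∈ Set.Icc (0 : ℝ) 1) (hy : y ∈ Set.Icc (0 : ℝ) 1) :
    |(1 - 2 * x) * (y * (1 - y))| ≤ 1 := by
  obtain ⟨hy₀, hy₁⟩ := mul_one_sub_mem_Icc hy
  rw [abs_mul, abs_of_nonneg hy₀]
  exact mul_le_one₀ (abs_one_sub_two_mul_le hx) hy₀ (by linarith)

theorem abs_dx_modelU_le (hz : z ∈ Set.Icc (0 : Plane) 1) : |dx modelU z| ≤ 1 := by
  rw [dx_modelU]
  exact abs_product_le_one ⟨hz.1.1, hz.2.1⟩ ⟨hz.1.2, hz.2.2⟩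

theorem abs_dy_modelU_le (hz : z ∈ Set.Icc (0 : Plane) 1) : |dy modelU z| ≤ 1 := by
  rw [dy_modelU]
  exact abs_product_le_one ⟨hz.1.2, hz.2.2⟩ ⟨hz.1.1, hz.2.1⟩

theorem abs_modelFPrimitive_le (hz : z ∈ Set.Icc (0 : Plane) 1) : |modelFPrimitive z| ≤ 1 := by
  obtain ⟨⟨hx₀, hy₀⟩, hx₁, hy₁⟩ := hz
  obtain ⟨hq₀, hq₁⟩ := mul_one_sub_mem_Icc (x := z.2) ⟨hy₀, hy₁⟩
  replace hx₀ : 0 ≤ z.1 := hx₀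
  replace hx₁ : z.1 ≤ 1 := hx₁
  rw [modelFPrimitive, abs_le]
  constructor
  · nlinarith [mul_nonneg hx₀ hq₀, mul_nonneg (sq_nonneg z.1) (sub_nonneg.2 hx₁)]
  · nlinarith [mul_le_mul hx₁ hq₁ hq₀ zero_le_one, mul_nonneg hx₀ (sq_nonneg (z.1 - 1)),
      mul_nonneg (sub_nonneg.2 hx₁) hx₀]

end ModelBounds

section UpperBounds

variable {n m : ℕ}

theorem one_div_two_mul_le_one_div (hn : 1 ≤ n) (hnm : n ≤ m) : 1 / (2 * m : ℝ) ≤ 1 / n := by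
  have hnm' : (n : ℝ) ≤ m := Nat.cast_le.2 hnm
  gcongr
  linarith [(Nat.cast_nonneg m : (0 : ℝ) ≤ m)]

theorem one_div_le_min (hn : 1 ≤ n) (hnm : n ≤ m) : 1 / (n : ℝ) ≤ min 1 ((m : ℝ) / n ^ 2) := by
  have hn' : (1 : ℝ) ≤ n := Nat.one_le_cast.2 hn
  have hnm' : (n : ℝ) ≤ m := Nat.cast_le.2 hnm
  refine le_min (div_le_one_of_le₀ hn' (Nat.cast_nonneg n)) ?_
  rw [div_le_div_iff₀ (by positivity) (by positivity)]
  nlinarith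

theorem modelU_eq_zero_of_mem_boundary {z : Plane} (hz : (z.1 = 0 ∨ z.1 = 1) ∨ z.2 = 0 ∨ z.2 = 1) :
    modelU z = 0 := by
  rcases hz with (h | h) | h | h <;> simp [modelU, h]

theorem abs_dx_modelU_sub_le_div (hn : 1 ≤ n) (hnm : n ≤ m)
    {i : Fin (2 * m) × (Fin n ⊕ Fin (n + 1))} {z z' : Plane}
    (hz : z ∈ triangle (babuskaAziz n m) i) (hz' : z' ∈ triangle (babuskaAziz n m) i) :
    |dx modelU z - dx modelU z'| ≤ 2 * (1 / n) := by
  have hosc := abs_dx_modelU_sub_le (triangle_babuskaAziz_subset_unitSquare i hz)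
    (triangle_babuskaAziz_subset_unitSquare i hz')
  linarith [abs_fst_sub_le hz hz', abs_snd_sub_le hz hz', abs_nonneg (z.1 - z'.1),
    one_div_two_mul_le_one_div hn hnm]

theorem abs_dy_modelU_sub_le_div (hn : 1 ≤ n) (hnm : n ≤ m)
    {i : Fin (2 * m) × (Fin n ⊕ Fin (n + 1))} {z z' : Plane}
    (hz : z ∈ triangle (babuskaAziz n m) i) (hz' : z' ∈ triangle (babuskaAziz n m) i) :
    |dy modelU z - dy modelU z'| ≤ 2 * (1 / n) := by
  have hosc := abs_dy_modelU_sub_le (triangle_babuskaAziz_subset_unitSquare i hz)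
    (triangle_babuskaAziz_subset_unitSquare i hz')
  linarith [abs_fst_sub_le hz hz', abs_snd_sub_le hz hz', abs_nonneg (z.2 - z'.2),
    one_div_two_mul_le_one_div hn hnm]

theorem exists_crouzeixRaviart_brokenError_modelU_le (hn : 1 ≤ n) (hnm : n ≤ m) :
    ∃ v ∈ crouzeixRaviart (babuskaAziz n m), brokenError (babuskaAziz n m) modelU v ≤ 4 / n := by
  have hm := hn.trans hnm
  obtain ⟨v, hv, herr⟩ := exists_crouzeixRaviart_brokenError_le (T := babuskaAziz n m)
    (ε := 2 * (1 / n)) (signedDoubleArea_babuskaAziz_ne_zero hn) contDiff_modelU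
    (fun i k hb => by
      simp [edgeMean, modelU_eq_zero_of_mem_boundary (lineMap_mem_boundary hn hm hb _)])
    (fun i _ hz _ hz' => abs_dx_modelU_sub_le_div hn hnm hz hz')
    (fun i _ hz _ hz' => abs_dy_modelU_sub_le_div hn hnm hz hz')
  refine ⟨v, hv, herr.trans (Real.sqrt_le_iff.2 ⟨by positivity, ?_⟩)⟩
  calc 2 * (2 * (1 / n : ℝ)) ^ 2 * ∑ i, volume.real (triangle (babuskaAziz n m) i)
    _ ≤ 2 * (2 * (1 / n : ℝ)) ^ 2 * (3 / 2) := by gcongr; exact sum_volume_real_triangle_le hn hm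
    _ ≤ (4 / n) ^ 2 := by ring_nf; gcongr; norm_num

theorem bestApproxError_modelU_le (hn : 1 ≤ n) (hnm : n ≤ m) :
    bestApproxError (babuskaAziz n m) modelU ≤ 4 / n := by
  obtain ⟨v, hv, herr⟩ := exists_crouzeixRaviart_brokenError_modelU_le hn hnm
  exact (bestApproxError_le_brokenError hv modelU).trans herr

variable {F G : Plane → ℝ} {w : Fin (2 * m) × (Fin n ⊕ Fin (n + 1)) → (Plane →ᵃ[ℝ] ℝ)}

theorem abs_edgeDefect_babuskaAziz_le (hn : 1 ≤ n) (hnm : n ≤ m) (hF : Continuous F)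
    (hG : Continuous G) {ε : ℝ}
    (h : ∀ i k, ∃ c, ∀ t ∈ Set.Icc (0 : ℝ) 1,
      |normalFlux F G (babuskaAziz n m i (k + 1)) (babuskaAziz n m i (k + 2)) t - c| ≤ ε) :
    |edgeDefect (babuskaAziz n m) F G w| ≤
      15 * m * ε * brokenNorm (babuskaAziz n m) (pieces w) := by
  have hm := hn.trans hnm
  have hε : 0 ≤ ε := by
    obtain ⟨c, hc⟩ := h (⟨0, by omega⟩, Sum.inr 0) 0
    exact (abs_nonneg _).trans (hc 0 ⟨le_rfl, zero_le_one⟩)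
  refine (abs_edgeDefect_le (h := 1 / n) (δ := ε / 2)
    (fun i k => abs_fst_sub_le (vertex_mem_triangle _ i _) (vertex_mem_triangle _ i _))
    (fun i k => (abs_snd_sub_le (vertex_mem_triangle _ i _) (vertex_mem_triangle _ i _)).trans
      (one_div_two_mul_le_one_div hn hnm))
    (fun i k => (h i k).elim fun c hc => abs_fluxMoment_le hF hG hc) w).trans ?_
  calc _ ≤ 3 * (1 / n) * (ε / 2) * (10 * n * m * brokenNorm (babuskaAziz n m) (pieces w)) := by
        gcongr
        exact sum_abs_slopes_babuskaAziz_le hn hm w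
    _ = 15 * m * ε * brokenNorm (babuskaAziz n m) (pieces w) := by
        have hn' : (n : ℝ) ≠ 0 := by positivity
        field_simp
        ring

theorem abs_sum_setIntegral_mul_slopes_le (hn : 1 ≤ n) (hm : 1 ≤ m)
    (hF : ∀ z ∈ Set.Icc (0 : Plane) 1, |F z| ≤ 1) (hG : ∀ z ∈ Set.Icc (0 : Plane) 1, |G z| ≤ 1) :
    |∑ i, ∫ z in triangle (babuskaAziz n m) i, (F z * slopeX (w i) + G z * slopeY (w i))| ≤
      5 / 2 * brokenNorm (babuskaAziz n m) (pieces w) := by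
  have hn' : (n : ℝ) ≠ 0 := by positivity
  have hm' : (m : ℝ) ≠ 0 := by positivity
  have hpiece : ∀ i, |∫ z in triangle (babuskaAziz n m) i,
      (F z * slopeX (w i) + G z * slopeY (w i))| ≤
        1 / (4 * n * m) * (|slopeX (w i)| + |slopeY (w i)|) := fun i => by
    rw [← Real.norm_eq_abs, mul_comm (1 / _ : ℝ)]
    refine (norm_setIntegral_le_of_norm_le_const
      (isCompact_convexHull_range _).measure_lt_top fun z hz => ?_).trans
      (mul_le_mul_of_nonneg_left (volume_real_triangle_le hn i) (by positivity))
    have hz' := triangle_babuskaAziz_subset_unitSquare i hz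
    rw [Real.norm_eq_abs]
    refine (abs_add_le _ _).trans ?_
    rw [abs_mul, abs_mul]
    exact add_le_add (mul_le_of_le_one_left (abs_nonneg _) (hF z hz'))
      (mul_le_of_le_one_left (abs_nonneg _) (hG z hz'))
  calc _ ≤ ∑ i, 1 / (4 * n * m : ℝ) * (|slopeX (w i)| + |slopeY (w i)|) :=
        (Finset.abs_sum_le_sum_abs _ _).trans (Finset.sum_le_sum fun i _ => hpiece i)
    _ ≤ 1 / (4 * n * m : ℝ) * (10 * n * m * brokenNorm (babuskaAziz n m) (pieces w)) := by
        rw [← Finset.mul_sum]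
        gcongr
        exact sum_abs_slopes_babuskaAziz_le hn hm w
    _ = 5 / 2 * brokenNorm (babuskaAziz n m) (pieces w) := by
        field_simp
        ring

theorem abs_normalFlux_modelU_sub_le (hn : 1 ≤ n) (hnm : n ≤ m)
    (i : Fin (2 * m) × (Fin n ⊕ Fin (n + 1))) (k l : Fin 3) {t : ℝ} (ht : t ∈ Set.Icc (0 : ℝ) 1) :
    |normalFlux (dx modelU) (dy modelU) (babuskaAziz n m i k) (babuskaAziz n m i l) t -
      normalFlux (dx modelU) (dy modelU) (babuskaAziz n m i k) (babuskaAziz n m i l) 0| ≤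
        4 / n ^ 2 := by
  have hk := vertex_mem_triangle (babuskaAziz n m) i k
  have hl := vertex_mem_triangle (babuskaAziz n m) i l
  have hp := lineMap_mem_triangle (babuskaAziz n m) i k l ht
  simp only [normalFlux, AffineMap.lineMap_apply_zero]
  rw [sub_sub_sub_comm, ← mul_sub, ← mul_sub]
  refine (abs_sub _ _).trans ?_
  rw [abs_mul, abs_mul, Prod.fst_sub, Prod.snd_sub]
  calc _ ≤ (1 / n : ℝ) * (2 * (1 / n)) + 1 / n * (2 * (1 / n)) := by
        gcongr
        · exact (abs_snd_sub_le hl hk).trans (one_div_two_mul_le_one_div hn hnm)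
        · exact abs_dx_modelU_sub_le_div hn hnm hp hk
        · exact abs_fst_sub_le hl hk
        · exact abs_dy_modelU_sub_le_div hn hnm hp hk
    _ = 4 / n ^ 2 := by ring

theorem abs_consistencyTerm_modelU_le_div (hn : 1 ≤ n) (hnm : n ≤ m)
    (hw : w ∈ crouzeixRaviart (babuskaAziz n m)) :
    |consistencyTerm (babuskaAziz n m) modelU modelF w| ≤
      60 * (m / n ^ 2) * brokenNorm (babuskaAziz n m) (pieces w) := by
  rw [consistencyTerm_eq_edgeDefect (signedDoubleArea_babuskaAziz_ne_zero hn)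
    (isNeighbourMap_meshNeighbour hn (hn.trans hnm)) contDiff_dx_modelU contDiff_dy_modelU
    dx_dx_modelU_add_dy_dy_modelU hw]
  refine (abs_edgeDefect_babuskaAziz_le hn hnm contDiff_dx_modelU.continuous
    contDiff_dy_modelU.continuous fun i k => ⟨_, fun t ht =>
      abs_normalFlux_modelU_sub_le hn hnm i _ _ ht⟩).trans_eq ?_
  ring

theorem abs_load_modelF_le (hn : 1 ≤ n) (hnm : n ≤ m)
    (hw : w ∈ crouzeixRaviart (babuskaAziz n m)) :
    |load (babuskaAziz n m) modelF (pieces w)| ≤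
      10 * brokenNorm (babuskaAziz n m) (pieces w) := by
  have hm := hn.trans hnm
  have hm' : (m : ℝ) ≠ 0 := by positivity
  have hgreen := sum_setIntegral_add_load_eq_edgeDefect (G := 0)
    (signedDoubleArea_babuskaAziz_ne_zero hn) (isNeighbourMap_meshNeighbour hn hm)
    contDiff_modelFPrimitive contDiff_const
    (f := modelF) (fun z => by rw [dx_modelFPrimitive]; simp [dy]) hw
  have hinner := abs_sum_setIntegral_mul_slopes_le (w := w) (F := modelFPrimitive) (G := 0) hn hm
    (fun z hz => abs_modelFPrimitive_le hz) (by simp)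
  have hdefect := abs_edgeDefect_babuskaAziz_le (w := w) (F := modelFPrimitive) (G := 0)
    (ε := 1 / (2 * m)) hn hnm contDiff_modelFPrimitive.continuous continuous_const
    fun i k => ⟨0, fun t ht => by
      have hF := abs_modelFPrimitive_le (triangle_babuskaAziz_subset_unitSquare i
        (lineMap_mem_triangle _ i (k + 1) (k + 2) ht))
      have hY := abs_snd_sub_le (vertex_mem_triangle _ i (k + 2)) (vertex_mem_triangle _ i (k + 1))
      simp only [normalFlux, Pi.zero_apply, mul_zero, sub_zero, abs_mul, Prod.snd_sub]
      exact (mul_le_of_le_one_right (abs_nonneg _) hF).trans hY⟩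
  rw [show 15 * m * (1 / (2 * m)) = (15 / 2 : ℝ) by ring_nf; simp [hm']] at hdefect
  rw [eq_sub_of_add_eq' hgreen]
  exact (abs_sub _ _).trans (by linarith)

theorem abs_consistencyTerm_modelU_le (hn : 1 ≤ n) (hnm : n ≤ m)
    (hw : w ∈ crouzeixRaviart (babuskaAziz n m)) :
    |consistencyTerm (babuskaAziz n m) modelU modelF w| ≤
      25 / 2 * brokenNorm (babuskaAziz n m) (pieces w) := by
  have hinner := abs_sum_setIntegral_mul_slopes_le (w := w) hn (hn.trans hnm)
    (fun z hz => abs_dx_modelU_le hz) (fun z hz => abs_dy_modelU_le hz)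
  have hload := abs_load_modelF_le hn hnm hw
  rw [consistencyTerm, brokenInner_pieces_right]
  exact (abs_sub _ _).trans (by linarith)

theorem consistencyError_modelU_le (hn : 1 ≤ n) (hnm : n ≤ m) :
    consistencyError (babuskaAziz n m) modelU modelF ≤ 60 * min 1 ((m : ℝ) / n ^ 2) := by
  refine consistencyError_le (by positivity) fun w hw => ?_
  rcases min_choice (1 : ℝ) (m / n ^ 2) with h | h <;> rw [h]
  · exact (abs_consistencyTerm_modelU_le hn hnm hw).trans
      (mul_le_mul_of_nonneg_right (by norm_num) (brokenNorm_nonneg _ _))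
  · exact abs_consistencyTerm_modelU_le_div hn hnm hw

theorem brokenError_modelU_le (hn : 1 ≤ n) (hnm : n ≤ m)
    {v : Fin (2 * m) × (Fin n ⊕ Fin (n + 1)) → (Plane →ᵃ[ℝ] ℝ)}
    (hv : IsGalerkinSolution (babuskaAziz n m) modelF v) :
    brokenError (babuskaAziz n m) modelU v ≤ 68 * min 1 ((m : ℝ) / n ^ 2) := by
  obtain ⟨w, hw, herr⟩ := exists_crouzeixRaviart_brokenError_modelU_le hn hnm
  have hstrang := brokenError_le_add_consistencyError contDiff_modelU hv hw
  have hcons := consistencyError_modelU_le hn hnm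
  have hmin := one_div_le_min hn hnm
  rw [← mul_one_div] at herr
  linarith

end UpperBounds

section BestApproximationLowerBound

variable {n m : ℕ}

theorem integral_sq_affine (a b L : ℝ) :
    ∫ s in (0 : ℝ)..L, (a + b * s) ^ 2 = a ^ 2 * L + a * b * L ^ 2 + b ^ 2 * L ^ 3 / 3 := by
  have h : ∀ s ∈ Set.uIcc 0 L, HasDerivAt
      (fun s => a ^ 2 * s + a * b * s ^ 2 + b ^ 2 * s ^ 3 / 3) ((a + b * s) ^ 2) s := fun s _ =>
    ((((hasDerivAt_id s).const_mul (a ^ 2)).add ((hasDerivAt_pow 2 s).const_mul (a * b))).add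
      (((hasDerivAt_pow 3 s).const_mul (b ^ 2)).div_const 3)).congr_deriv (by push_cast; ring)
  rw [intervalIntegral.integral_eq_sub_of_hasDerivAt h
    (Continuous.intervalIntegrable (by fun_prop) _ _)]
  ring

theorem sq_mul_pow_three_div_le_integral_sq_affine (a b : ℝ) {L : ℝ} (hL : 0 ≤ L) :
    b ^ 2 * L ^ 3 / 12 ≤ ∫ s in (0 : ℝ)..L, (a + b * s) ^ 2 := by
  rw [integral_sq_affine]
  linarith [mul_nonneg hL (sq_nonneg (a + b * L / 2))]

theorem integral_one_sub_pow_three_mul_sq :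
    ∫ t in (0 : ℝ)..1, (1 - t) ^ 3 * t ^ 2 = 1 / 60 := by
  have h : ∀ t ∈ Set.uIcc (0 : ℝ) 1, HasDerivAt
      (fun t : ℝ => t ^ 3 / 3 - 3 * (t ^ 4 / 4) + 3 * (t ^ 5 / 5) - t ^ 6 / 6)
      ((1 - t) ^ 3 * t ^ 2) t := fun t _ =>
    (((((hasDerivAt_pow 3 t).div_const 3).sub (((hasDerivAt_pow 4 t).div_const 4).const_mul 3)).add
      (((hasDerivAt_pow 5 t).div_const 5).const_mul 3)).sub
      ((hasDerivAt_pow 6 t).div_const 6)).congr_deriv (by push_cast; ring)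
  rw [intervalIntegral.integral_eq_sub_of_hasDerivAt h
    (Continuous.intervalIntegrable (by fun_prop) _ _)]
  norm_num

theorem mul_apex_le {b e t : ℝ} (hb : b ∈ Set.Icc (0 : ℝ) 1) (ht : t ∈ Set.Icc (0 : ℝ) 1) :
    t * (e * (1 - e)) ≤ (b + t * (e - b)) * (1 - (b + t * (e - b))) := by
  nlinarith [mul_nonneg (sub_nonneg.2 ht.2) (mul_nonneg hb.1 (sub_nonneg.2 hb.2)),
    mul_nonneg (mul_nonneg ht.1 (sub_nonneg.2 ht.2)) (sq_nonneg (e - b))]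

theorem le_setIntegral_sq_dx_modelU_sub {P : Fin 3 → Plane} (hP : signedDoubleArea P ≠ 0)
    (hb : (P 0).2 ∈ Set.Icc (0 : ℝ) 1) (h01 : (P 1).2 = (P 0).2)
    (he : (P 2).2 ∈ Set.Icc (0 : ℝ) 1) (c : ℝ) :
    |signedDoubleArea P| * (((P 1).1 - (P 0).1) ^ 2 * ((P 2).2 * (1 - (P 2).2)) ^ 2 / 180) ≤
      ∫ z in convexHull ℝ (Set.range P), (dx modelU z - c) ^ 2 := by
  have hcont : Continuous fun z => (dx modelU z - c) ^ 2 :=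
    ((continuous_dx contDiff_modelU).sub continuous_const).pow 2
  let Y : ℝ → ℝ := fun t => ((P 0).2 + t * ((P 2).2 - (P 0).2)) *
    (1 - ((P 0).2 + t * ((P 2).2 - (P 0).2)))
  have hslice : ∀ t s : ℝ, (dx modelU (trianglePoint P (s, t)) - c) ^ 2 =
      ((1 - 2 * ((P 0).1 + t * ((P 2).1 - (P 0).1))) * Y t - c +
        -2 * ((P 1).1 - (P 0).1) * Y t * s) ^ 2 := fun t s => by
    simp only [dx_modelU, trianglePoint, Prod.fst_add, Prod.snd_add, Prod.smul_fst,
      Prod.smul_snd, Prod.fst_sub, Prod.snd_sub, smul_eq_mul, h01, sub_self, mul_zero, add_zero, Y]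
    ring
  rw [setIntegral_convexHull_triangle hP hcont]
  refine mul_le_mul_of_nonneg_left ?_ (abs_nonneg _)
  calc ((P 1).1 - (P 0).1) ^ 2 * ((P 2).2 * (1 - (P 2).2)) ^ 2 / 180
      = ∫ t in (0 : ℝ)..1, ((P 1).1 - (P 0).1) ^ 2 * ((P 2).2 * (1 - (P 2).2)) ^ 2 / 3 *
          ((1 - t) ^ 3 * t ^ 2) := by
        rw [intervalIntegral.integral_const_mul, integral_one_sub_pow_three_mul_sq]
        ring
    _ ≤ ∫ t in (0 : ℝ)..1, ∫ s in (0 : ℝ)..1 - t, (dx modelU (trianglePoint P (s, t)) - c) ^ 2 := by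
        refine intervalIntegral.integral_mono_on zero_le_one
          (Continuous.intervalIntegrable (by fun_prop) _ _)
          (Continuous.intervalIntegrable ?_ _ _) fun t ht => ?_
        · simp only [hslice, integral_sq_affine, Y]
          fun_prop
        · have hY : (t * ((P 2).2 * (1 - (P 2).2))) ^ 2 ≤ Y t ^ 2 :=
            pow_le_pow_left₀ (mul_nonneg ht.1 (mul_nonneg he.1 (sub_nonneg.2 he.2)))
              (mul_apex_le hb ht) 2
          simp only [hslice]
          refine le_trans ?_
            (sq_mul_pow_three_div_le_integral_sq_affine _ _ (sub_nonneg.2 ht.2))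
          calc _ = (t * ((P 2).2 * (1 - (P 2).2))) ^ 2 *
                (((P 1).1 - (P 0).1) ^ 2 * (1 - t) ^ 3 / 3) := by ring
            _ ≤ Y t ^ 2 * (((P 1).1 - (P 0).1) ^ 2 * (1 - t) ^ 3 / 3) := by
                have := sub_nonneg.2 ht.2
                gcongr
            _ = _ := by ring

theorem sum_range_odd_mul (M : ℝ) (k : ℕ) :
    ∑ c ∈ Finset.range k, (2 * c + 1 : ℝ) * (2 * M - (2 * c + 1)) =
      2 * M * k ^ 2 - k * (4 * k ^ 2 - 1) / 3 := by
  induction k with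
  | zero => simp
  | succ k ih =>
    rw [Finset.sum_range_succ, ih]
    push_cast
    ring

theorem sum_range_two_mul_half (f : ℕ → ℝ) (m : ℕ) :
    ∑ j ∈ Finset.range (2 * m), f (j / 2) = 2 * ∑ k ∈ Finset.range m, f k := by
  induction m with
  | zero => simp
  | succ m ih =>
    rw [mul_add, mul_one, Finset.sum_range_succ, Finset.sum_range_succ, ih,
      show (2 * m) / 2 = m by omega, show (2 * m + 1) / 2 = m by omega, Finset.sum_range_succ]
    ring

theorem le_sum_sq_odd_lines (hm : 1 ≤ m) : (m : ℝ) / 36 ≤ ∑ k ∈ Finset.range m,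
    ((2 * k + 1 : ℝ) / (2 * m) * (1 - (2 * k + 1) / (2 * m))) ^ 2 := by
  have hm' : (0 : ℝ) < m := by positivity
  have hmean : (m : ℝ) / 6 ≤ ∑ k ∈ Finset.range m,
      ((2 * k + 1 : ℝ) / (2 * m) * (1 - (2 * k + 1) / (2 * m))) :=
    calc (m : ℝ) / 6 ≤ (2 * m * m ^ 2 - m * (4 * m ^ 2 - 1) / 3) / (4 * m ^ 2) := by
          rw [le_div_iff₀ (by positivity)]
          nlinarith
      _ = _ := by
          rw [← sum_range_odd_mul, Finset.sum_div]
          exact Finset.sum_congr rfl fun k _ => by field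
  calc (m : ℝ) / 36 ≤ ∑ k ∈ Finset.range m,
        (1 / 3 * ((2 * k + 1 : ℝ) / (2 * m) * (1 - (2 * k + 1) / (2 * m))) - 1 / 36) := by
        rw [Finset.sum_sub_distrib, ← Finset.mul_sum, Finset.sum_const, Finset.card_range,
          nsmul_eq_mul]
        linarith
    _ ≤ _ := Finset.sum_le_sum fun k _ => by
        linarith [sq_nonneg ((2 * k + 1 : ℝ) / (2 * m) * (1 - (2 * k + 1) / (2 * m)) - 1 / 6)]

theorem le_setIntegral_sq_dx_modelU_sub_babuskaAziz (hn : 1 ≤ n) (j : Fin (2 * m)) (a : Fin n)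
    (c : ℝ) :
    ((2 * (j / 2 : ℕ) + 1 : ℝ) / (2 * m) * (1 - (2 * (j / 2 : ℕ) + 1) / (2 * m))) ^ 2 /
        (360 * n ^ 3 * m) ≤
      ∫ z in triangle (babuskaAziz n m) (j, Sum.inl a), (dx modelU z - c) ^ 2 := by
  have hvertex := fun k => triangle_babuskaAziz_subset_unitSquare (j, Sum.inl a)
    (vertex_mem_triangle (babuskaAziz n m) (j, Sum.inl a) k)
  refine le_trans (le_of_eq ?_) (le_setIntegral_sq_dx_modelU_sub
    (signedDoubleArea_babuskaAziz_ne_zero hn (j, Sum.inl a)) ⟨(hvertex 0).1.2, (hvertex 0).2.2⟩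
    (by simp [babuskaAziz_apply, gridPoint, vertexY]) ⟨(hvertex 2).1.2, (hvertex 2).2.2⟩ c)
  have hD : |signedDoubleArea (babuskaAziz n m (j, Sum.inl a))| = 2 / (2 * n * (2 * m)) := by
    rw [signedDoubleArea_babuskaAziz, abs_div, abs_mul, abs_orient]
    simp [vertexX, abs_mul]
  rw [hD]
  simp only [babuskaAziz_apply, gridPoint, vertexX, vertexY, Matrix.cons_val]
  push_cast
  field

theorem le_brokenError_modelU (hn : 1 ≤ n) (hm : 1 ≤ m)
    (v : Fin (2 * m) × (Fin n ⊕ Fin (n + 1)) → (Plane →ᵃ[ℝ] ℝ)) :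
    1 / 81 / (n : ℝ) ≤ brokenError (babuskaAziz n m) modelU v := by
  have hcont : ∀ c, Continuous fun z => (dx modelU z - c) ^ 2 := fun c =>
    ((continuous_dx contDiff_modelU).sub continuous_const).pow 2
  have hconty : ∀ c, Continuous fun z => (dy modelU z - c) ^ 2 := fun c =>
    ((continuous_dy contDiff_modelU).sub continuous_const).pow 2
  let e : ℕ → ℝ := fun k => ((2 * k + 1 : ℝ) / (2 * m) * (1 - (2 * k + 1) / (2 * m))) ^ 2
  rw [brokenError_eq contDiff_modelU]
  refine Real.le_sqrt_of_sq_le ?_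
  calc (1 / 81 / (n : ℝ)) ^ 2 ≤ 2 * (m / 36) * n / (360 * n ^ 3 * m) := by
        field_simp
        norm_num
    _ ≤ 2 * (∑ k ∈ Finset.range m, e k) * n / (360 * n ^ 3 * m) := by
        gcongr
        exact le_sum_sq_odd_lines hm
    _ = ∑ j : Fin (2 * m), ∑ _a : Fin n, e (j / 2 : ℕ) / (360 * n ^ 3 * m) := by
        rw [← sum_range_two_mul_half, ← Fin.sum_univ_eq_sum_range (fun j => e (j / 2))]
        simp only [Finset.sum_const, Finset.card_univ, Fintype.card_fin, nsmul_eq_mul,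
          ← Finset.mul_sum, ← Finset.sum_div]
        ring
    _ ≤ ∑ j : Fin (2 * m), ∑ s, ∫ z in triangle (babuskaAziz n m) (j, s),
          (dx modelU z - slopeX (v (j, s))) ^ 2 := Finset.sum_le_sum fun j _ => by
        rw [Fintype.sum_sum_type]
        exact le_add_of_le_of_nonneg (Finset.sum_le_sum fun a _ =>
          le_setIntegral_sq_dx_modelU_sub_babuskaAziz hn j a _)
          (Finset.sum_nonneg fun a _ => integral_nonneg fun z => sq_nonneg _)
    _ ≤ _ := by
        rw [← Fintype.sum_prod_type']
        refine Finset.sum_le_sum fun i _ => ?_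
        exact integral_mono (integrableOn_convexHull_range _ (hcont _))
          (integrableOn_convexHull_range _ ((hcont _).add (hconty _)))
          fun z => le_add_of_nonneg_right (sq_nonneg _)

theorem le_bestApproxError_modelU (hn : 1 ≤ n) (hm : 1 ≤ m) :
    1 / 81 / (n : ℝ) ≤ bestApproxError (babuskaAziz n m) modelU := by
  refine le_csInf ⟨_, 0, (crouzeixRaviartSubmodule _).zero_mem, rfl⟩ ?_
  rintro r ⟨v, -, rfl⟩
  exact le_brokenError_modelU hn hm v

end BestApproximationLowerBound

section IsoscelesTriangle

theorem integral_sub_half_mul_cubic (c₀ c₁ c₂ c₃ : ℝ) :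
    ∫ t in (0 : ℝ)..1, (t - 1 / 2) *
        (c₀ + c₁ * (t - 1 / 2) + c₂ * (t - 1 / 2) ^ 2 + c₃ * (t - 1 / 2) ^ 3) =
      c₁ / 12 + c₃ / 80 := by
  rw [intervalIntegral.integral_comp_sub_right
    (fun τ => τ * (c₀ + c₁ * τ + c₂ * τ ^ 2 + c₃ * τ ^ 3)) (1 / 2)]
  have h : ∀ τ ∈ Set.uIcc (0 - 1 / 2 : ℝ) (1 - 1 / 2), HasDerivAt
      (fun τ => c₀ * (τ ^ 2 / 2) + c₁ * (τ ^ 3 / 3) + c₂ * (τ ^ 4 / 4) + c₃ * (τ ^ 5 / 5))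
      (τ * (c₀ + c₁ * τ + c₂ * τ ^ 2 + c₃ * τ ^ 3)) τ := fun τ _ =>
    ((((((hasDerivAt_pow 2 τ).div_const 2).const_mul c₀).add
      (((hasDerivAt_pow 3 τ).div_const 3).const_mul c₁)).add
      (((hasDerivAt_pow 4 τ).div_const 4).const_mul c₂)).add
      (((hasDerivAt_pow 5 τ).div_const 5).const_mul c₃)).congr_deriv (by push_cast; ring)
  rw [intervalIntegral.integral_eq_sub_of_hasDerivAt h
    (Continuous.intervalIntegrable (by fun_prop) _ _)]
  ring

theorem fluxMoment_modelU (x y X Y : ℝ) :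
    fluxMoment (dx modelU) (dy modelU) (x - X / 2, y - Y / 2) (x + X / 2, y + Y / 2) =
      (1 - 2 * x) * (1 - 2 * y) * (Y ^ 2 - X ^ 2) / 12 +
        X * Y * (x * (1 - x) - y * (1 - y)) / 6 + X * Y * (Y ^ 2 - X ^ 2) / 40 := by
  have hflux : ∀ t : ℝ, normalFlux (dx modelU) (dy modelU) (x - X / 2, y - Y / 2)
      (x + X / 2, y + Y / 2) t =
        ((1 - 2 * x) * (y * (1 - y)) * Y - (1 - 2 * y) * (x * (1 - x)) * X) +
        ((1 - 2 * x) * (1 - 2 * y) * (Y ^ 2 - X ^ 2) +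
          2 * X * Y * (x * (1 - x) - y * (1 - y))) * (t - 1 / 2) +
        (X * (X ^ 2 - 2 * Y ^ 2) * (1 - 2 * y) - Y * (Y ^ 2 - 2 * X ^ 2) * (1 - 2 * x)) *
          (t - 1 / 2) ^ 2 +
        2 * X * Y * (Y ^ 2 - X ^ 2) * (t - 1 / 2) ^ 3 := fun t => by
    simp only [normalFlux, dx_modelU, dy_modelU, AffineMap.lineMap_apply_module', Prod.fst_add,
      Prod.snd_add, Prod.smul_fst, Prod.smul_snd, Prod.fst_sub, Prod.snd_sub, smul_eq_mul]
    ring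
  simp only [fluxMoment, hflux, integral_sub_half_mul_cubic]
  ring

/-- The vertices of the isosceles triangle with half base `h`, height `d` and midline centre
`(x, y)`, whose apex lies above its base if `ε = 1`, and below if `ε = -1`. -/
def isoscelesTriangle (h d x y ε : ℝ) : Fin 3 → Plane :=
  ![(x - h, y - ε * d / 2), (x + h, y - ε * d / 2), (x, y + ε * d / 2)]

/-- The terms of higher order in the edge defect `orient_mul_edgeDefect_isosceles`. -/
def isoscelesRemainder (h d x y ε σ δ : ℝ) : ℝ :=
  h ^ 3 * d * (ε * (δ * ((y * (1 - y) - x * (1 - x)) / 6 - d ^ 2 / 40 + h ^ 2 / 15) -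
    σ * (1 - 2 * x) / 4)) + h ^ 3 * (h ^ 2 - d ^ 2) / 12 * (δ * (1 - 2 * y))

theorem orient_mul_edgeDefect_isosceles {h d x y ε σ δ : ℝ} (hd : d ≠ 0) (hε : ε = 1 ∨ ε = -1)
    {w : Plane →ᵃ[ℝ] ℝ} (hX : slopeX w = ε * σ / 2) (hY : slopeY w = h ^ 2 * δ / (2 * d))
    {P : Fin 3 → Plane} (hP : P = isoscelesTriangle h d x y ε) :
    ε * ∑ k : Fin 3, (w (P (k + 2)) - w (P (k + 1))) *
        fluxMoment (dx modelU) (dy modelU) (P (k + 1)) (P (k + 2)) =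
      -(σ * (1 - 2 * x) * (1 - 2 * y) * (h ^ 3 / 4 + h * d ^ 2 / 12)) +
        isoscelesRemainder h d x y ε σ δ := by
  have hbase := fluxMoment_modelU x (y - ε * d / 2) (2 * h) 0
  have hright := fluxMoment_modelU (x + h / 2) y (-h) (ε * d)
  have hleft := fluxMoment_modelU (x - h / 2) y (-h) (-(ε * d))
  rw [show ((x - 2 * h / 2, y - ε * d / 2 - 0 / 2) : Plane) = P 0 by
      rw [hP]; ext <;> simp [isoscelesTriangle],
    show ((x + 2 * h / 2, y - ε * d / 2 + 0 / 2) : Plane) = P 1 by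
      rw [hP]; ext <;> simp [isoscelesTriangle]] at hbase
  rw [show ((x + h / 2 - -h / 2, y - ε * d / 2) : Plane) = P 1 by
      rw [hP]; ext <;> simp [isoscelesTriangle]; ring,
    show ((x + h / 2 + -h / 2, y + ε * d / 2) : Plane) = P 2 by
      rw [hP]; ext <;> simp [isoscelesTriangle]; ring] at hright
  rw [show ((x - h / 2 - -h / 2, y - -(ε * d) / 2) : Plane) = P 2 by
      rw [hP]; ext <;> simp [isoscelesTriangle] <;> ring,
    show ((x - h / 2 + -h / 2, y + -(ε * d) / 2) : Plane) = P 0 by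
      rw [hP]; ext <;> simp [isoscelesTriangle] <;> ring] at hleft
  simp only [Fin.sum_univ_three, Fin.reduceAdd, zero_add, hbase, hright, hleft, affine_sub_eq w,
    hX, hY]
  simp only [hP, isoscelesTriangle, isoscelesRemainder, Matrix.cons_val]
  rcases hε with rfl | rfl <;> field_simp <;> ring

theorem abs_isoscelesRemainder_le {h d x y ε σ δ : ℝ} (hd : 0 ≤ d) (hdh : d ≤ h) (h1 : h ≤ 1)
    (hx : x ∈ Set.Icc (0 : ℝ) 1) (hy : y ∈ Set.Icc (0 : ℝ) 1) (hε : |ε| = 1) (hσ : |σ| ≤ 1)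
    (hδ : |δ| ≤ 1) :
    |isoscelesRemainder h d x y ε σ δ| ≤ h ^ 3 * d / 2 + h ^ 5 / 12 := by
  have h0 : 0 ≤ h := hd.trans hdh
  have hsq : h ^ 2 ≤ 1 := pow_le_one₀ h0 h1
  have hdsq : d ^ 2 ≤ h ^ 2 := pow_le_pow_left₀ hd hdh 2
  have hgx := mul_one_sub_mem_Icc hx
  have hgy := mul_one_sub_mem_Icc hy
  have hleg : |(y * (1 - y) - x * (1 - x)) / 6 - d ^ 2 / 40 + h ^ 2 / 15| ≤ 1 / 4 :=
    abs_le.2 ⟨by linarith [hgx.2, hgy.1, sq_nonneg h], by linarith [hgx.1, hgy.2, sq_nonneg d]⟩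
  have hδl := mul_le_mul hδ hleg (abs_nonneg _) zero_le_one
  have hσx := mul_le_mul hσ (abs_one_sub_two_mul_le hx) (abs_nonneg _) zero_le_one
  rw [← abs_mul] at hδl hσx
  have hdiff := abs_sub (δ * ((y * (1 - y) - x * (1 - x)) / 6 - d ^ 2 / 40 + h ^ 2 / 15))
    (σ * (1 - 2 * x) / 4)
  rw [abs_div, abs_of_pos (zero_lt_four' ℝ)] at hdiff
  have hsub : 0 ≤ h ^ 3 * (h ^ 2 - d ^ 2) / 12 := by
    have := sub_nonneg.2 hdsq
    positivity
  rw [isoscelesRemainder]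
  refine (abs_add_le _ _).trans (add_le_add ?_ ?_)
  · rw [abs_mul, abs_mul ε, hε, one_mul, abs_of_nonneg (by positivity : 0 ≤ h ^ 3 * d)]
    calc _ ≤ h ^ 3 * d * (1 / 2) := by gcongr; linarith
      _ = h ^ 3 * d / 2 := by ring
  · rw [abs_mul, abs_mul δ, abs_of_nonneg hsub]
    calc _ ≤ h ^ 3 * (h ^ 2 - 0) / 12 * (1 * 1) := by
          gcongr
          · rw [sub_zero]
            positivity
          · exact sq_nonneg d
          · exact abs_one_sub_two_mul_le hy
      _ = h ^ 5 / 12 := by ring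

end IsoscelesTriangle

section Amplitude

variable {n c : ℕ}

/-- The horizontal profile of the test function `oscillation`. Up to terms of order `1 / n` it is
`x ^ 2 * (1 - x) ^ 2 * (1 - 2 * x)`; the shift by `1 / (4 * n)` makes it vanish on the legs of the
right-angled triangles of the mesh. -/
def amplitude (n : ℕ) (x : ℝ) : ℝ :=
  (x ^ 2 - (1 / (4 * n)) ^ 2) * ((1 - x) ^ 2 - (1 / (4 * n)) ^ 2) * (1 - 2 * x)

theorem amplitude_leg_eq_zero (hn : 1 ≤ n) (hc : c = 0 ∨ c = 2 * n) :
    amplitude n ((2 * c + 1) / (4 * n)) = 0 ∧ amplitude n ((2 * c - 1) / (4 * n)) = 0 := by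
  rcases hc with rfl | rfl <;> simp only [amplitude] <;> push_cast <;> constructor <;>
    field_simp <;> ring

/-- The sum of the amplitudes at the midpoints of the two legs of a triangle in column `c`. -/
def amplitudeSum (n c : ℕ) : ℝ :=
  amplitude n ((2 * c + 1) / (4 * n)) + amplitude n ((2 * c - 1) / (4 * n))

/-- The difference quotient of the amplitude between the midpoints of the two legs of a triangle in
column `c`. -/
def amplitudeSlope (n c : ℕ) : ℝ :=
  2 * n * (amplitude n ((2 * c + 1) / (4 * n)) - amplitude n ((2 * c - 1) / (4 * n)))

theorem amplitudeSum_eq (hn : 1 ≤ n) (c : ℕ) : amplitudeSum n c =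
    2 * (c * (2 * n - c)) * (2 * n - 2 * c) * (c * (2 * n - c) - 2) / (2 * n) ^ 5 := by
  simp only [amplitudeSum, amplitude]
  field_simp
  ring

theorem amplitudeSlope_eq (hn : 1 ≤ n) (c : ℕ) : amplitudeSlope n c =
    2 * (c * (2 * n - c)) * ((2 * n - 2 * c) ^ 2 - c * (2 * n - c) + 1) / (2 * n) ^ 4 := by
  simp only [amplitudeSlope, amplitude]
  field_simp
  ring

theorem mul_two_mul_sub_mem_Icc (hc : c ≤ 2 * n) :
    (c : ℝ) * (2 * n - c) ∈ Set.Icc 0 ((n : ℝ) ^ 2) := by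
  have hc' : (c : ℝ) ≤ 2 * n := by exact_mod_cast hc
  exact ⟨mul_nonneg c.cast_nonneg (sub_nonneg.2 hc'), by linarith [sq_nonneg (n - c : ℝ)]⟩

theorem abs_amplitudeSum_le (hn : 1 ≤ n) (hc : c ≤ 2 * n) : |amplitudeSum n c| ≤ 1 := by
  have hn' : (1 : ℝ) ≤ n := by exact_mod_cast hn
  obtain ⟨hp, hp'⟩ := mul_two_mul_sub_mem_Icc hc
  have hq : |(2 * n - 2 * c : ℝ)| ≤ 2 * n := abs_le_of_sq_le_sq (by linarith) (by positivity)
  have hr : |(c : ℝ) * (2 * n - c) - 2| ≤ 2 * n ^ 2 := abs_le.2 ⟨by nlinarith, by nlinarith⟩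
  rw [amplitudeSum_eq hn, abs_div, abs_mul, abs_mul, abs_mul, abs_of_nonneg hp, abs_two,
    abs_of_pos (by positivity : (0 : ℝ) < (2 * n) ^ 5), div_le_one (by positivity)]
  calc _ ≤ 2 * (n : ℝ) ^ 2 * (2 * n) * (2 * n ^ 2) := by gcongr
    _ ≤ (2 * n) ^ 5 := by linarith [pow_nonneg (n.cast_nonneg (α := ℝ)) 5]

theorem abs_amplitudeSlope_le (hn : 1 ≤ n) (hc : c ≤ 2 * n) : |amplitudeSlope n c| ≤ 1 := by
  have hn' : (1 : ℝ) ≤ n := by exact_mod_cast hn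
  obtain ⟨hp, hp'⟩ := mul_two_mul_sub_mem_Icc hc
  have hr : |(2 * n - 2 * c : ℝ) ^ 2 - c * (2 * n - c) + 1| ≤ 8 * (n : ℝ) ^ 2 :=
    abs_le.2 ⟨by nlinarith, by nlinarith⟩
  rw [amplitudeSlope_eq hn, abs_div, abs_mul, abs_mul, abs_of_nonneg hp, abs_two,
    abs_of_pos (by positivity : (0 : ℝ) < (2 * n) ^ 4), div_le_one (by positivity)]
  calc _ ≤ 2 * (n : ℝ) ^ 2 * (8 * n ^ 2) := by gcongr
    _ = (2 * n) ^ 4 := by ring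

theorem sum_range_amplitude (A : ℝ) (k : ℕ) :
    ∑ c ∈ Finset.range k, c * (A - c) * (c * (A - c) - 2) * (A - 2 * c) ^ 2 =
      A ^ 4 * (k / 6 - k ^ 2 / 2 + k ^ 3 / 3) +
      A ^ 3 * (k - 5 / 2 * k ^ 2 + 3 * k ^ 3 - 3 / 2 * k ^ 4) +
      A ^ 2 * (37 / 30 * k - 5 * k ^ 2 + 23 / 3 * k ^ 3 - 13 / 2 * k ^ 4 + 13 / 5 * k ^ 5) +
      A * (-3 * k ^ 2 + 8 * k ^ 3 - 9 * k ^ 4 + 6 * k ^ 5 - 2 * k ^ 6) -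
      6 / 35 * k + 2 * k ^ 3 - 4 * k ^ 4 + 18 / 5 * k ^ 5 - 2 * k ^ 6 + 4 / 7 * k ^ 7 := by
  induction k with
  | zero => simp
  | succ k ih =>
    rw [Finset.sum_range_succ, ih]
    push_cast
    ring

theorem sum_amplitudeSum_mul (hn : 1 ≤ n) :
    ∑ c ∈ Finset.range (2 * n + 1), amplitudeSum n c * (1 - 2 * (c / (2 * n))) =
      ((2 * n) ^ 2 - 1) * ((2 * n) ^ 2 - 4) * ((2 * n) ^ 2 - 9) / (105 * (2 * n : ℝ) ^ 5) := by
  have hterm : ∀ c : ℕ, amplitudeSum n c * (1 - 2 * (c / (2 * n))) = 2 / (2 * n) ^ 6 *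
      (c * (2 * n - c) * (c * (2 * n - c) - 2) * (2 * n - 2 * c) ^ 2) := fun c => by
    rw [amplitudeSum_eq hn]
    field
  simp only [hterm]
  rw [← Finset.mul_sum, sum_range_amplitude]
  push_cast
  field_simp
  ring

theorem le_sum_amplitudeSum_mul (hn : 6 ≤ n) : (n : ℝ) / 60 ≤
    ∑ c ∈ Finset.range (2 * n + 1), amplitudeSum n c * (1 - 2 * (c / (2 * n))) := by
  have hn' : (36 : ℝ) ≤ n ^ 2 := by exact_mod_cast Nat.pow_le_pow_left hn 2
  rw [sum_amplitudeSum_mul (by omega), le_div_iff₀ (by positivity)]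
  calc (n : ℝ) / 60 * (105 * (2 * n) ^ 5) = 56 * n ^ 2 * (n ^ 2) ^ 2 := by ring
    _ ≤ 56 * n ^ 2 * (n ^ 2) ^ 2 + ((n : ℝ) ^ 2 - 36) * n ^ 2 * (8 * n ^ 2) := by
        have := sub_nonneg.2 hn'
        exact le_add_of_nonneg_right (by positivity)
    _ ≤ _ := by nlinarith

end Amplitude

section Oscillation

variable {n m : ℕ}

/-- The ordinate of the midline of the strip `j` of the mesh. -/
def midlineY (m j : ℕ) : ℝ := (2 * j + 1) / (4 * m)

/-- The function whose values at the edge midpoints define the test function for the lower bound of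
the consistency error. It vanishes on the horizontal grid lines and on the boundary of the square,
and alternates in sign between neighbouring legs, like the nonconforming part of an element. -/
def oscillation (n m : ℕ) (z : Plane) : ℝ :=
  -(Real.sin (2 * n * z.1 * Real.pi) * Real.sin (2 * m * z.2 * Real.pi)) *
    (amplitude n z.1 * (1 - 2 * z.2) / (4 * n))

theorem vertexX_zero_eq (s : Fin n ⊕ Fin (n + 1)) : vertexX n s 0 = vertexX n s 2 - 1 := by
  rcases s with a | a <;> simp [vertexX]

theorem vertexX_one_eq (s : Fin n ⊕ Fin (n + 1)) :
    vertexX n s 1 = min (vertexX n s 2 + 1) (2 * n) := by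
  rcases s with a | a <;> simp [vertexX]
  omega

theorem vertexY_one_eq (j : ℕ) (s : Fin n ⊕ Fin (n + 1)) : vertexY n j s 1 = vertexY n j s 0 := by
  rcases s with a | a <;> rfl

theorem vertexY_two_add_vertexY_zero (j : ℕ) (s : Fin n ⊕ Fin (n + 1)) :
    vertexY n j s 2 + vertexY n j s 0 = 2 * j + 1 := by
  rcases s with a | a <;> simp [vertexY] <;> omega

theorem orient_eq (j : ℕ) (s : Fin n ⊕ Fin (n + 1)) :
    orient n j s = -((-1) ^ vertexX n s 2 * (-1) ^ j) := by
  rcases s with a | a <;> simp [orient, vertexX, pow_succ]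

theorem edgeMidpoint_babuskaAziz (j : Fin (2 * m)) (s : Fin n ⊕ Fin (n + 1)) (k : Fin 3) :
    edgeMidpoint (babuskaAziz n m) (j, s) k =
      (((vertexX n s (k + 1) + vertexX n s (k + 2) : ℕ) : ℝ) / (4 * n),
        ((vertexY n j s (k + 1) + vertexY n j s (k + 2) : ℕ) : ℝ) / (4 * m)) := by
  simp only [edgeMidpoint, babuskaAziz_apply, gridPoint, midpoint_eq_smul_add]
  ext <;> simp <;> ring

theorem oscillation_eq_zero_of_mem_boundary {z : Plane}
    (hz : (z.1 = 0 ∨ z.1 = 1) ∨ z.2 = 0 ∨ z.2 = 1) : oscillation n m z = 0 := by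
  have hsin : ∀ k : ℕ, Real.sin (2 * k * Real.pi) = 0 := fun k => by
    exact_mod_cast Real.sin_nat_mul_pi (2 * k)
  rcases hz with (h | h) | h | h <;> simp [oscillation, h, hsin]

theorem sin_half_odd_mul_pi (c : ℕ) : Real.sin ((2 * c + 1) / 2 * Real.pi) = (-1) ^ c := by
  rw [← Real.cos_nat_mul_pi, ← Real.sin_add_pi_div_two]
  congr 1
  ring

theorem oscillation_leg_midpoint (hn : 1 ≤ n) (hm : 1 ≤ m) (c j : ℕ) :
    oscillation n m ((2 * c + 1) / (4 * n), midlineY m j) =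
      -((-1) ^ c * (-1) ^ j) *
        (amplitude n ((2 * c + 1) / (4 * n)) * (1 - 2 * midlineY m j) / (4 * n)) := by
  have hx : 2 * n * ((2 * c + 1) / (4 * n)) = ((2 * c + 1) / 2 : ℝ) := by field
  have hy : 2 * m * midlineY m j = (2 * j + 1) / 2 := by rw [midlineY]; field
  simp only [oscillation, hx, hy, sin_half_odd_mul_pi]

theorem oscillation_edgeMidpoint_zero (hn : 1 ≤ n) (hm : 1 ≤ m) (j : Fin (2 * m))
    (s : Fin n ⊕ Fin (n + 1)) :
    oscillation n m (edgeMidpoint (babuskaAziz n m) (j, s) 0) =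
      orient n j s * (amplitude n ((2 * vertexX n s 2 + 1) / (4 * n)) *
        (1 - 2 * midlineY m j) / (4 * n)) := by
  rw [edgeMidpoint_babuskaAziz, orient_eq]
  simp only [zero_add, vertexY_one_eq, add_comm (vertexY n j s 0), vertexY_two_add_vertexY_zero,
    vertexX_one_eq]
  rcases Nat.lt_or_ge (vertexX n s 2) (2 * n) with hlt | hge
  · rw [min_eq_left (by omega), ← oscillation_leg_midpoint hn hm]
    congr 2
    · push_cast; ring
    · rw [midlineY]; push_cast; rfl
  · have hc : vertexX n s 2 = 2 * n := le_antisymm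
      ((vertexX_le_vertexX_one s 2).trans (vertexX_one_le_two_mul s)) hge
    rw [oscillation_eq_zero_of_mem_boundary, (amplitude_leg_eq_zero hn (Or.inr hc)).1]
    · simp
    · refine Or.inl (Or.inr ?_)
      rw [hc, min_eq_right (by omega)]
      push_cast
      field

theorem oscillation_edgeMidpoint_one (hn : 1 ≤ n) (hm : 1 ≤ m) (j : Fin (2 * m))
    (s : Fin n ⊕ Fin (n + 1)) :
    oscillation n m (edgeMidpoint (babuskaAziz n m) (j, s) 1) =
      -(orient n j s * (amplitude n ((2 * vertexX n s 2 - 1) / (4 * n)) *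
        (1 - 2 * midlineY m j) / (4 * n))) := by
  rw [edgeMidpoint_babuskaAziz, orient_eq]
  simp only [Fin.reduceAdd, vertexY_two_add_vertexY_zero, vertexX_zero_eq]
  rcases vertexX n s 2 with - | c
  · rw [oscillation_eq_zero_of_mem_boundary (by simp), amplitude]
    push_cast
    ring
  · have hmid := oscillation_leg_midpoint hn hm c j
    rw [midlineY] at hmid ⊢
    push_cast at hmid ⊢
    convert hmid using 2 <;> ring_nf

theorem oscillation_edgeMidpoint_two (hm : 1 ≤ m) (j : Fin (2 * m)) (s : Fin n ⊕ Fin (n + 1)) :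
    oscillation n m (edgeMidpoint (babuskaAziz n m) (j, s) 2) = 0 := by
  rw [edgeMidpoint_babuskaAziz]
  simp only [Fin.reduceAdd, vertexY_one_eq]
  have hy : 2 * m * (((vertexY n j s 0 + vertexY n j s 0 : ℕ) : ℝ) / (4 * m)) =
      vertexY n j s 0 := by
    push_cast
    field
  rw [oscillation, hy]
  simp

theorem exists_crouzeixRaviart_oscillation (hn : 1 ≤ n) (hm : 1 ≤ m) :
    ∃ w ∈ crouzeixRaviart (babuskaAziz n m), ∀ i k, w i (edgeMidpoint (babuskaAziz n m) i k) =
      oscillation n m (edgeMidpoint (babuskaAziz n m) i k) :=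
  exists_crouzeixRaviart_apply_edgeMidpoint (signedDoubleArea_babuskaAziz_ne_zero hn)
    fun _ _ hb => oscillation_eq_zero_of_mem_boundary (lineMap_mem_boundary hn hm hb _)

end Oscillation

section OscillationDefect

variable {n m : ℕ}

theorem vertexX_eq_or (hn : 1 ≤ n) (s : Fin n ⊕ Fin (n + 1)) :
    (vertexX n s 0 + 1 = vertexX n s 2 ∧ vertexX n s 1 = vertexX n s 2 + 1) ∨
      vertexX n s 1 = vertexX n s 0 + 1 ∧ (vertexX n s 2 = 0 ∨ vertexX n s 2 = 2 * n) := by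
  have hle := (vertexX_le_vertexX_one s 2).trans (vertexX_one_le_two_mul s)
  rw [vertexX_zero_eq, vertexX_one_eq]
  omega

theorem cast_sign_signedDoubleArea_babuskaAziz (hn : 1 ≤ n) (j : Fin (2 * m))
    (s : Fin n ⊕ Fin (n + 1)) :
    (SignType.sign (signedDoubleArea (babuskaAziz n m (j, s))) : ℝ) = orient n j s := by
  rw [sign_signedDoubleArea_babuskaAziz hn]
  rcases eq_or_eq_neg_of_abs_eq (abs_orient (j : ℕ) s) with h | h <;> simp [h]

theorem babuskaAziz_eq_isoscelesTriangle (hn : 1 ≤ n) (hm : 1 ≤ m) (j : Fin (2 * m))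
    {s : Fin n ⊕ Fin (n + 1)} (h0 : vertexX n s 0 + 1 = vertexX n s 2)
    (h1 : vertexX n s 1 = vertexX n s 2 + 1) :
    babuskaAziz n m (j, s) = isoscelesTriangle (1 / (2 * n)) (1 / (2 * m))
      (vertexX n s 2 / (2 * n)) (midlineY m j) (orient n j s) := by
  have h0' : (vertexX n s 0 : ℝ) = vertexX n s 2 - 1 := by rw [← h0]; push_cast; ring
  have h1' : (vertexX n s 1 : ℝ) = vertexX n s 2 + 1 := by rw [h1]; push_cast; ring
  have hsum : (vertexY n j s 2 : ℝ) + vertexY n j s 0 = 2 * j + 1 := by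
    exact_mod_cast vertexY_two_add_vertexY_zero j s
  have hdiff := vertexY_two_sub_vertexY_zero j s
  have hY0 : (vertexY n j s 0 : ℝ) = (2 * j + 1 - orient n j s) / 2 := by linarith
  have hY2 : (vertexY n j s 2 : ℝ) = (2 * j + 1 + orient n j s) / 2 := by linarith
  funext k
  rw [babuskaAziz_apply, gridPoint]
  fin_cases k <;> ext <;>
    simp [isoscelesTriangle, midlineY, vertexY_one_eq, h0', h1', hY0, hY2] <;> field

variable {w : Plane →ᵃ[ℝ] ℝ} {j : Fin (2 * m)} {s : Fin n ⊕ Fin (n + 1)}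

theorem slopeX_mul_oscillation (hn : 1 ≤ n) (hm : 1 ≤ m)
    (hw : ∀ k, w (edgeMidpoint (babuskaAziz n m) (j, s) k) =
      oscillation n m (edgeMidpoint (babuskaAziz n m) (j, s) k)) :
    slopeX w * (vertexX n s 1 - vertexX n s 0) =
      orient n j s * (amplitudeSum n (vertexX n s 2) * (1 - 2 * midlineY m j)) := by
  have h := affine_sub_eq w (edgeMidpoint (babuskaAziz n m) (j, s) 0)
    (edgeMidpoint (babuskaAziz n m) (j, s) 1)
  rw [hw, hw, oscillation_edgeMidpoint_zero hn hm, oscillation_edgeMidpoint_one hn hm] at h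
  simp only [edgeMidpoint_babuskaAziz, Fin.reduceAdd, zero_add, vertexY_one_eq,
    add_comm (vertexY n j s 0), sub_self, mul_zero, add_zero] at h
  push_cast at h
  field_simp at h
  rw [amplitudeSum]
  linear_combination -h

theorem slopeX_mul_add_slopeY_mul_oscillation (hn : 1 ≤ n) (hm : 1 ≤ m)
    (hw : ∀ k, w (edgeMidpoint (babuskaAziz n m) (j, s) k) =
      oscillation n m (edgeMidpoint (babuskaAziz n m) (j, s) k)) :
    slopeX w * (vertexX n s 2 - vertexX n s 0) + slopeY w * (n / m) * orient n j s =
      orient n j s *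
        (amplitude n ((2 * vertexX n s 2 + 1) / (4 * n)) * (1 - 2 * midlineY m j)) := by
  have h := affine_sub_eq w (edgeMidpoint (babuskaAziz n m) (j, s) 0)
    (edgeMidpoint (babuskaAziz n m) (j, s) 2)
  rw [hw, hw, oscillation_edgeMidpoint_zero hn hm, oscillation_edgeMidpoint_two hm] at h
  simp only [edgeMidpoint_babuskaAziz, Fin.reduceAdd, zero_add, vertexY_one_eq] at h
  push_cast at h
  rw [← vertexY_two_sub_vertexY_zero j s] at h ⊢
  field_simp at h ⊢
  linear_combination -h

theorem slopes_oscillation (hn : 1 ≤ n) (hm : 1 ≤ m)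
    (hw : ∀ k, w (edgeMidpoint (babuskaAziz n m) (j, s) k) =
      oscillation n m (edgeMidpoint (babuskaAziz n m) (j, s) k)) :
    slopeX w = orient n j s * (amplitudeSum n (vertexX n s 2) * (1 - 2 * midlineY m j)) / 2 ∧
      slopeY w = (1 / (2 * n)) ^ 2 * (amplitudeSlope n (vertexX n s 2) * (1 - 2 * midlineY m j)) /
        (2 * (1 / (2 * m))) := by
  have ho : orient n j s ≠ 0 := abs_pos.1 (by rw [abs_orient]; exact one_pos)
  have hn' : (n : ℝ) ≠ 0 := by positivity
  have hm' : (m : ℝ) ≠ 0 := by positivity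
  have hlegs := slopeX_mul_oscillation hn hm hw
  have hbase := slopeX_mul_add_slopeY_mul_oscillation hn hm hw
  rcases vertexX_eq_or hn s with ⟨h0, h1⟩ | ⟨h1, hend⟩
  · have h02 : (vertexX n s 2 : ℝ) - vertexX n s 0 = 1 := by rw [← h0]; push_cast; ring
    have h01 : (vertexX n s 1 : ℝ) - vertexX n s 0 = 2 := by rw [h1, ← h0]; push_cast; ring
    rw [h01] at hlegs
    have hX := eq_div_of_mul_eq two_ne_zero hlegs
    rw [h02, hX, amplitudeSum] at hbase
    refine ⟨hX, mul_left_cancel₀ ho ?_⟩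
    rw [amplitudeSlope]
    field_simp at hbase ⊢
    linear_combination hbase
  · obtain ⟨hright, hleft⟩ := amplitude_leg_eq_zero hn hend
    have hX : slopeX w = 0 := by simpa [h1, amplitudeSum, hright, hleft] using hlegs
    have hY : slopeY w = 0 := by simpa [hX, hright, hn', hm', ho] using hbase
    simp [hX, hY, amplitudeSum, amplitudeSlope, hright, hleft]

theorem orient_mul_sum_fluxMoment_oscillation (hn : 1 ≤ n) (hm : 1 ≤ m)
    (hw : ∀ k, w (edgeMidpoint (babuskaAziz n m) (j, s) k) =
      oscillation n m (edgeMidpoint (babuskaAziz n m) (j, s) k)) {h d x y : ℝ}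
    (hh : h = 1 / (2 * n)) (hd : d = 1 / (2 * m)) (hx : x = vertexX n s 2 / (2 * n))
    (hy : y = midlineY m j) :
    orient n j s * ∑ k : Fin 3,
        (w (babuskaAziz n m (j, s) (k + 2)) - w (babuskaAziz n m (j, s) (k + 1))) *
        fluxMoment (dx modelU) (dy modelU) (babuskaAziz n m (j, s) (k + 1))
          (babuskaAziz n m (j, s) (k + 2)) =
      -(amplitudeSum n (vertexX n s 2) * (1 - 2 * y) * (1 - 2 * x) * (1 - 2 * y) *
          (h ^ 3 / 4 + h * d ^ 2 / 12)) +
        isoscelesRemainder h d x y (orient n j s) (amplitudeSum n (vertexX n s 2) * (1 - 2 * y))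
          (amplitudeSlope n (vertexX n s 2) * (1 - 2 * y)) := by
  obtain ⟨hX, hY⟩ := slopes_oscillation hn hm hw
  rw [← hh, ← hd, ← hy] at hY
  rw [← hy] at hX
  rcases vertexX_eq_or hn s with ⟨h0, h1⟩ | ⟨-, hend⟩
  · refine orient_mul_edgeDefect_isosceles (by rw [hd]; positivity)
      (eq_or_eq_neg_of_abs_eq (abs_orient (j : ℕ) s)) hX hY ?_
    rw [hh, hd, hx, hy, babuskaAziz_eq_isoscelesTriangle hn hm j h0 h1]
  · obtain ⟨hright, hleft⟩ := amplitude_leg_eq_zero hn hend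
    have hsum : amplitudeSum n (vertexX n s 2) = 0 := by rw [amplitudeSum, hright, hleft, add_zero]
    have hslope : amplitudeSlope n (vertexX n s 2) = 0 := by
      rw [amplitudeSlope, hright, hleft, sub_self, mul_zero]
    have hconst : ∀ z z', w z - w z' = 0 := fun z z' => by
      rw [affine_sub_eq w, hX, hY, hsum, hslope]
      ring
    simp [hconst, hsum, hslope, isoscelesRemainder]

end OscillationDefect

section ConsistencyLowerBound

variable {n m : ℕ}

theorem existsUnique_isGalerkinSolution_modelF (hn : 1 ≤ n) (hm : 1 ≤ m) :
    ∃! v, IsGalerkinSolution (babuskaAziz n m) modelF v :=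
  existsUnique_isGalerkinSolution continuous_modelF
    fun _ hw h0 => eq_zero_of_brokenNorm_eq_zero hn hm hw h0

theorem sum_range_two_mul_add_one (f : ℕ → ℝ) (n : ℕ) : ∑ c ∈ Finset.range (2 * n + 1), f c =
    ∑ a ∈ Finset.range n, f (2 * a + 1) + ∑ a ∈ Finset.range (n + 1), f (2 * a) := by
  induction n with
  | zero => simp
  | succ n ih =>
    rw [show 2 * (n + 1) + 1 = 2 * n + 1 + 1 + 1 by ring, Finset.sum_range_succ,
      Finset.sum_range_succ, ih, Finset.sum_range_succ (fun a => f (2 * a + 1)) n,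
      Finset.sum_range_succ (fun a => f (2 * a)) (n + 1), mul_add_one]
    ring

theorem sum_vertexX_two (f : ℕ → ℝ) :
    ∑ s : Fin n ⊕ Fin (n + 1), f (vertexX n s 2) = ∑ c ∈ Finset.range (2 * n + 1), f c := by
  rw [Fintype.sum_sum_type, sum_range_two_mul_add_one,
    ← Fin.sum_univ_eq_sum_range (fun a => f (2 * a + 1)),
    ← Fin.sum_univ_eq_sum_range (fun a => f (2 * a))]
  rfl

theorem le_sum_sq_one_sub_two_mul_midlineY (hm : 1 ≤ m) :
    (m : ℝ) / 2 ≤ ∑ j : Fin (2 * m), (1 - 2 * midlineY m j) ^ 2 := by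
  have hm' : (1 : ℝ) ≤ m := Nat.one_le_cast.2 hm
  have hterm : ∀ j : ℕ, (1 - 2 * midlineY m j) ^ 2 =
      1 - (2 * j + 1) * (2 * (2 * m) - (2 * j + 1)) / (4 * m ^ 2) := fun j => by
    rw [midlineY]
    field_simp
    ring
  rw [Fin.sum_univ_eq_sum_range (fun j => (1 - 2 * midlineY m j) ^ 2)]
  simp only [hterm]
  rw [Finset.sum_sub_distrib, ← Finset.sum_div, sum_range_odd_mul, Finset.sum_const,
    Finset.card_range, nsmul_one, le_sub_iff_add_le, ← le_sub_iff_add_le',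
    div_le_iff₀ (by positivity)]
  push_cast
  nlinarith [mul_nonneg (sub_nonneg.2 hm') (by positivity : (0 : ℝ) ≤ m * (m + 1))]

theorem le_sum_leading_term (hn : 6 ≤ n) (hm : 1 ≤ m) :
    (m : ℝ) / n ^ 2 / 3840 ≤ ∑ i : Fin (2 * m) × (Fin n ⊕ Fin (n + 1)),
      amplitudeSum n (vertexX n i.2 2) * (1 - 2 * midlineY m i.1) *
        (1 - 2 * (vertexX n i.2 2 / (2 * n))) * (1 - 2 * midlineY m i.1) *
        ((1 / (2 * n)) ^ 3 / 4 + 1 / (2 * n) * (1 / (2 * m)) ^ 2 / 12) :=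
  calc (m : ℝ) / n ^ 2 / 3840 = m / 2 * (n / 60 * ((1 / (2 * n)) ^ 3 / 4)) := by field
    _ ≤ (∑ j : Fin (2 * m), (1 - 2 * midlineY m j) ^ 2) *
          ((∑ c ∈ Finset.range (2 * n + 1), amplitudeSum n c * (1 - 2 * (c / (2 * n)))) *
          ((1 / (2 * n)) ^ 3 / 4 + 1 / (2 * n) * (1 / (2 * m)) ^ 2 / 12)) := by
        gcongr
        · exact le_sum_sq_one_sub_two_mul_midlineY hm
        · exact (by positivity : (0 : ℝ) ≤ n / 60).trans (le_sum_amplitudeSum_mul hn)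
        · exact le_sum_amplitudeSum_mul hn
        · exact le_add_of_nonneg_right (by positivity)
    _ = _ := by
        rw [Fintype.sum_prod_type, ← sum_vertexX_two
          (fun c => amplitudeSum n c * (1 - 2 * (c / (2 * n)))), ← mul_assoc, Finset.sum_mul_sum,
          Finset.sum_mul]
        simp_rw [Finset.sum_mul]
        exact Finset.sum_congr rfl fun j _ => Finset.sum_congr rfl fun s _ => by ring

theorem midlineY_mem_Icc (j : Fin (2 * m)) : midlineY m j ∈ Set.Icc (0 : ℝ) 1 := by
  have hj : (j : ℝ) + 1 ≤ 2 * m := by exact_mod_cast j.2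
  refine ⟨by rw [midlineY]; positivity, div_le_one_of_le₀ (by linarith) (by positivity)⟩

theorem abs_mul_one_sub_two_mul_midlineY_le {a : ℝ} (ha : |a| ≤ 1) (j : Fin (2 * m)) :
    |a * (1 - 2 * midlineY m j)| ≤ 1 := by
  rw [abs_mul]
  exact mul_le_one₀ ha (abs_nonneg _) (abs_one_sub_two_mul_le (midlineY_mem_Icc j))

theorem vertexX_two_le (s : Fin n ⊕ Fin (n + 1)) : vertexX n s 2 ≤ 2 * n :=
  (vertexX_le_vertexX_one s 2).trans (vertexX_one_le_two_mul s)

theorem abs_isoscelesRemainder_oscillation_le (hn : 1 ≤ n) (hnm : n ≤ m) (j : Fin (2 * m))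
    (s : Fin n ⊕ Fin (n + 1)) :
    |isoscelesRemainder (1 / (2 * n)) (1 / (2 * m)) (vertexX n s 2 / (2 * n)) (midlineY m j)
      (orient n j s) (amplitudeSum n (vertexX n s 2) * (1 - 2 * midlineY m j))
      (amplitudeSlope n (vertexX n s 2) * (1 - 2 * midlineY m j))| ≤
        1 / (32 * n ^ 3 * m) + 1 / (384 * n ^ 5) := by
  have hn' : (1 : ℝ) ≤ n := Nat.one_le_cast.2 hn
  have hm : 1 ≤ m := hn.trans hnm
  have hc : (vertexX n s 2 : ℝ) ≤ 2 * n := by exact_mod_cast vertexX_two_le s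
  refine (abs_isoscelesRemainder_le (by positivity) (by gcongr)
    (div_le_one_of_le₀ (by linarith) (by positivity))
    ⟨by positivity, div_le_one_of_le₀ hc (by positivity)⟩ (midlineY_mem_Icc j) (abs_orient _ s)
    (abs_mul_one_sub_two_mul_midlineY_le (abs_amplitudeSum_le hn (vertexX_two_le s)) j)
    (abs_mul_one_sub_two_mul_midlineY_le (abs_amplitudeSlope_le hn (vertexX_two_le s)) j)).trans_eq
    ?_
  field

variable {w : Fin (2 * m) × (Fin n ⊕ Fin (n + 1)) → (Plane →ᵃ[ℝ] ℝ)}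

theorem consistencyTerm_oscillation (hn : 1 ≤ n) (hm : 1 ≤ m)
    (hw : w ∈ crouzeixRaviart (babuskaAziz n m))
    (hosc : ∀ i k, w i (edgeMidpoint (babuskaAziz n m) i k) =
      oscillation n m (edgeMidpoint (babuskaAziz n m) i k)) :
    consistencyTerm (babuskaAziz n m) modelU modelF w =
      -(∑ i : Fin (2 * m) × (Fin n ⊕ Fin (n + 1)),
        amplitudeSum n (vertexX n i.2 2) * (1 - 2 * midlineY m i.1) *
          (1 - 2 * (vertexX n i.2 2 / (2 * n))) * (1 - 2 * midlineY m i.1) *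
          ((1 / (2 * n)) ^ 3 / 4 + 1 / (2 * n) * (1 / (2 * m)) ^ 2 / 12)) +
      ∑ i : Fin (2 * m) × (Fin n ⊕ Fin (n + 1)),
        isoscelesRemainder (1 / (2 * n)) (1 / (2 * m)) (vertexX n i.2 2 / (2 * n))
          (midlineY m i.1) (orient n i.1 i.2)
          (amplitudeSum n (vertexX n i.2 2) * (1 - 2 * midlineY m i.1))
          (amplitudeSlope n (vertexX n i.2 2) * (1 - 2 * midlineY m i.1)) := by
  rw [consistencyTerm_eq_edgeDefect (signedDoubleArea_babuskaAziz_ne_zero hn)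
    (isNeighbourMap_meshNeighbour hn hm) contDiff_dx_modelU contDiff_dy_modelU
    dx_dx_modelU_add_dy_dy_modelU hw, edgeDefect, ← Finset.sum_neg_distrib,
    ← Finset.sum_add_distrib]
  refine Finset.sum_congr rfl fun i _ => ?_
  rw [cast_sign_signedDoubleArea_babuskaAziz hn i.1 i.2]
  exact orient_mul_sum_fluxMoment_oscillation hn hm (hosc i) rfl rfl rfl rfl

theorem abs_sum_isoscelesRemainder_oscillation_le (hn : 2000 ≤ n) (hnm : n ≤ m) :
    |∑ i : Fin (2 * m) × (Fin n ⊕ Fin (n + 1)),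
      isoscelesRemainder (1 / (2 * n)) (1 / (2 * m)) (vertexX n i.2 2 / (2 * n))
        (midlineY m i.1) (orient n i.1 i.2)
        (amplitudeSum n (vertexX n i.2 2) * (1 - 2 * midlineY m i.1))
        (amplitudeSlope n (vertexX n i.2 2) * (1 - 2 * midlineY m i.1))| ≤
      1 / 7680 * ((m : ℝ) / n ^ 2) := by
  have hn1 : 1 ≤ n := le_trans (by norm_num) hn
  have hn' : (2000 : ℝ) ≤ n := by exact_mod_cast hn
  have hm' : (2000 : ℝ) ≤ m := by exact_mod_cast hn.trans hnm
  have hn2 : (2000 : ℝ) ^ 2 ≤ n ^ 2 := by gcongr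
  calc _ ≤ ∑ _i : Fin (2 * m) × (Fin n ⊕ Fin (n + 1)),
        (1 / (32 * (n : ℝ) ^ 3 * m) + 1 / (384 * n ^ 5)) :=
        (Finset.abs_sum_le_sum_abs _ _).trans
          (Finset.sum_le_sum fun i _ => abs_isoscelesRemainder_oscillation_le hn1 hnm i.1 i.2)
    _ ≤ 6 * n * m * (1 / (32 * (n : ℝ) ^ 3 * m) + 1 / (384 * n ^ 5)) := by
        rw [Finset.sum_const, Finset.card_univ, nsmul_eq_mul]
        gcongr
        exact card_triangles_le hn1
    _ = (3 / 16 / m + 1 / (64 * n ^ 2)) * ((m : ℝ) / n ^ 2) := by field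
    _ ≤ (3 / 16 / 2000 + 1 / (64 * 2000 ^ 2)) * ((m : ℝ) / n ^ 2) := by gcongr
    _ ≤ 1 / 7680 * ((m : ℝ) / n ^ 2) := by gcongr; norm_num

theorem le_abs_consistencyTerm_oscillation (hn : 2000 ≤ n) (hnm : n ≤ m)
    (hw : w ∈ crouzeixRaviart (babuskaAziz n m))
    (hosc : ∀ i k, w i (edgeMidpoint (babuskaAziz n m) i k) =
      oscillation n m (edgeMidpoint (babuskaAziz n m) i k)) :
    1 / 7680 * ((m : ℝ) / n ^ 2) ≤ |consistencyTerm (babuskaAziz n m) modelU modelF w| := by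
  have hn1 : 1 ≤ n := le_trans (by norm_num) hn
  have hm1 : 1 ≤ m := hn1.trans hnm
  have hmain := le_sum_leading_term (n := n) (m := m) (le_trans (by norm_num) hn) hm1
  have hrem := abs_le.1 (abs_sum_isoscelesRemainder_oscillation_le hn hnm)
  rw [consistencyTerm_oscillation hn1 hm1 hw hosc]
  refine le_abs.2 (Or.inr ?_)
  linarith [hrem.2]

theorem brokenNorm_oscillation_le (hn : 1 ≤ n) (hm : 1 ≤ m)
    (hosc : ∀ i k, w i (edgeMidpoint (babuskaAziz n m) i k) =
      oscillation n m (edgeMidpoint (babuskaAziz n m) i k)) :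
    brokenNorm (babuskaAziz n m) (pieces w) ≤ max 1 ((m : ℝ) / n ^ 2) := by
  have hn' : (n : ℝ) ≠ 0 := by positivity
  have hm' : (m : ℝ) ≠ 0 := by positivity
  have hslopes : ∀ i, slopeX (w i) ^ 2 + slopeY (w i) ^ 2 ≤ max 1 ((m : ℝ) / n ^ 2) ^ 2 / 2 := by
    rintro ⟨j, s⟩
    obtain ⟨hX, hY⟩ := slopes_oscillation hn hm (hosc (j, s))
    have hX' : |slopeX (w (j, s))| ≤ max 1 ((m : ℝ) / n ^ 2) / 2 := by
      rw [hX, abs_div, abs_mul, abs_orient, one_mul, abs_two]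
      gcongr
      exact (abs_mul_one_sub_two_mul_midlineY_le
        (abs_amplitudeSum_le hn (vertexX_two_le s)) j).trans (le_max_left _ _)
    have hY' : |slopeY (w (j, s))| ≤ max 1 ((m : ℝ) / n ^ 2) / 2 := by
      have hscale : (1 / (2 * n) : ℝ) ^ 2 / (2 * (1 / (2 * m))) = m / n ^ 2 / 4 := by
        field_simp
        norm_num
      rw [hY, mul_div_right_comm, hscale, abs_mul, abs_of_nonneg (by positivity)]
      calc _ ≤ max 1 ((m : ℝ) / n ^ 2) / 4 * 1 := by
            gcongr
            · exact le_max_right _ _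
            · exact abs_mul_one_sub_two_mul_midlineY_le
                (abs_amplitudeSlope_le hn (vertexX_two_le s)) j
        _ ≤ max 1 ((m : ℝ) / n ^ 2) / 2 := by
            linarith [le_max_left 1 ((m : ℝ) / n ^ 2)]
    linarith [sq_le_sq' (abs_le.1 hX').1 (abs_le.1 hX').2,
      sq_le_sq' (abs_le.1 hY').1 (abs_le.1 hY').2]
  refine abs_le_of_sq_le_sq' ?_ (by positivity) |>.2
  rw [brokenNorm_pieces_sq]
  calc _ ≤ ∑ i, volume.real (triangle (babuskaAziz n m) i) * (max 1 ((m : ℝ) / n ^ 2) ^ 2 / 2) := by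
        gcongr with i
        exact hslopes i
    _ ≤ 3 / 2 * (max 1 ((m : ℝ) / n ^ 2) ^ 2 / 2) := by
        rw [← Finset.sum_mul]
        gcongr
        exact sum_volume_real_triangle_le hn hm
    _ ≤ max 1 ((m : ℝ) / n ^ 2) ^ 2 := by linarith [sq_nonneg (max 1 ((m : ℝ) / n ^ 2))]

theorem le_consistencyError_modelU (hn : 2000 ≤ n) (hnm : n ≤ m) :
    1 / 7680 * min 1 ((m : ℝ) / n ^ 2) ≤ consistencyError (babuskaAziz n m) modelU modelF := by
  have hn1 : 1 ≤ n := le_trans (by norm_num) hn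
  have hm1 : 1 ≤ m := hn1.trans hnm
  obtain ⟨w, hw, hosc⟩ := exists_crouzeixRaviart_oscillation hn1 hm1
  obtain ⟨v, hv⟩ := (existsUnique_isGalerkinSolution_modelF hn1 hm1).exists
  have hmax : (0 : ℝ) < max 1 ((m : ℝ) / n ^ 2) := by positivity
  refine le_of_mul_le_mul_right ?_ hmax
  calc 1 / 7680 * min 1 ((m : ℝ) / n ^ 2) * max 1 ((m : ℝ) / n ^ 2)
      = 1 / 7680 * ((m : ℝ) / n ^ 2) := by rw [mul_assoc, min_mul_max, one_mul]
    _ ≤ |consistencyTerm (babuskaAziz n m) modelU modelF w| :=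
        le_abs_consistencyTerm_oscillation hn hnm hw hosc
    _ ≤ consistencyError (babuskaAziz n m) modelU modelF *
          brokenNorm (babuskaAziz n m) (pieces w) :=
        abs_consistencyTerm_le_consistencyError contDiff_modelU hv hw
    _ ≤ consistencyError (babuskaAziz n m) modelU modelF * max 1 ((m : ℝ) / n ^ 2) := by
        gcongr
        · exact consistencyError_nonneg
        · exact brokenNorm_oscillation_le hn1 hm1 hosc

theorem min_le_brokenError_modelU (hn : 1 ≤ n) (hnm : n ≤ m)
    {v : Fin (2 * m) × (Fin n ⊕ Fin (n + 1)) → (Plane →ᵃ[ℝ] ℝ)}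
    (hv : IsGalerkinSolution (babuskaAziz n m) modelF v) :
    1 / 162000 * min 1 ((m : ℝ) / n ^ 2) ≤ brokenError (babuskaAziz n m) modelU v := by
  have hmin : (0 : ℝ) ≤ min 1 ((m : ℝ) / n ^ 2) := by positivity
  rcases le_or_gt 2000 n with hlarge | hsmall
  · linarith [le_consistencyError_modelU hlarge hnm,
      consistencyError_le_brokenError contDiff_modelU hv]
  · have hn' : (n : ℝ) ≤ 2000 := by exact_mod_cast hsmall.le
    calc 1 / 162000 * min 1 ((m : ℝ) / n ^ 2) ≤ 1 / 162000 * 1 := by gcongr; exact min_le_left _ _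
      _ = 1 / 81 / 2000 := by norm_num
      _ ≤ 1 / 81 / (n : ℝ) := by gcongr
      _ ≤ brokenError (babuskaAziz n m) modelU v := le_brokenError_modelU hn (hn.trans hnm) v

theorem tendsto_div_sq_of_tendsto_brokenError {ι : Type*} {l : Filter ι} {n m : ι → ℕ}
    (hn : ∀ i, 1 ≤ n i) (hnm : ∀ i, n i ≤ m i)
    {v : (i : ι) → Fin (2 * m i) × (Fin (n i) ⊕ Fin (n i + 1)) → (Plane →ᵃ[ℝ] ℝ)}
    (hv : ∀ i, IsGalerkinSolution (babuskaAziz (n i) (m i)) modelF (v i))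
    (hE : Tendsto (fun i => brokenError (babuskaAziz (n i) (m i)) modelU (v i)) l (𝓝 0)) :
    Tendsto (fun i => (m i : ℝ) / (n i : ℝ) ^ 2) l (𝓝 0) := by
  have hE' := hE.const_mul 162000
  rw [mul_zero] at hE'
  have hmin : Tendsto (fun i => min 1 ((m i : ℝ) / (n i : ℝ) ^ 2)) l (𝓝 0) :=
    squeeze_zero (fun _ => by positivity)
      (fun i => by linarith [min_le_brokenError_modelU (hn i) (hnm i) (hv i)]) hE'
  refine hmin.congr' ?_
  filter_upwards [hmin.eventually_lt_const one_pos] with i hi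
  exact min_eq_right ((min_lt_iff.1 hi).resolve_left (lt_irrefl 1)).le

end ConsistencyLowerBound

end NonconformingP1

end

open NonconformingP1 in
theorem theorem3_general :
    (∀ n m : ℕ, 1 ≤ n → 1 ≤ m → ∃! v, IsGalerkinSolution (babuskaAziz n m) modelF v) ∧
    (∃ c C : ℝ, 0 < c ∧ 0 < C ∧ ∀ n m : ℕ, 1 ≤ n → n ≤ m →
      ∀ v, IsGalerkinSolution (babuskaAziz n m) modelF v →
        c * min 1 ((m : ℝ) / (n : ℝ) ^ 2) ≤ brokenError (babuskaAziz n m) modelU v ∧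
        brokenError (babuskaAziz n m) modelU v ≤ C * min 1 ((m : ℝ) / (n : ℝ) ^ 2)) ∧
    (∀ n m : ℕ → ℕ, (∀ l, 1 ≤ n l ∧ n l ≤ m l) →
      ∀ v : (l : ℕ) → Fin (2 * m l) × (Fin (n l) ⊕ Fin (n l + 1)) → (Plane →ᵃ[ℝ] ℝ),
        (∀ l, IsGalerkinSolution (babuskaAziz (n l) (m l)) modelF (v l)) →
        Tendsto (fun l => brokenError (babuskaAziz (n l) (m l)) modelU (v l)) atTop (𝓝 0) →
        Tendsto (fun l => (m l : ℝ) / (n l : ℝ) ^ 2) atTop (𝓝 0)) ∧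
    (∃ c C : ℝ, 0 < c ∧ 0 < C ∧ ∀ n m : ℕ, 1 ≤ n → n ≤ m →
      c / n ≤ bestApproxError (babuskaAziz n m) modelU ∧
      bestApproxError (babuskaAziz n m) modelU ≤ C / n) ∧
    (∃ (c C : ℝ) (n₀ : ℕ), 0 < c ∧ 0 < C ∧
      (∀ n m : ℕ, 1 ≤ n → n ≤ m →
        consistencyError (babuskaAziz n m) modelU modelF ≤ C * min 1 ((m : ℝ) / (n : ℝ) ^ 2)) ∧
      (∀ n m : ℕ, n₀ ≤ n → n ≤ m →
        c * min 1 ((m : ℝ) / (n : ℝ) ^ 2) ≤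
          consistencyError (babuskaAziz n m) modelU modelF)) :=
  ⟨fun _ _ hn hm => existsUnique_isGalerkinSolution_modelF hn hm,
    ⟨1 / 162000, 68, by norm_num, by norm_num, fun _ _ hn hnm _ hv =>
      ⟨min_le_brokenError_modelU hn hnm hv, brokenError_modelU_le hn hnm hv⟩⟩,
    fun _ _ hnm _ hv hE => tendsto_div_sq_of_tendsto_brokenError
      (fun l => (hnm l).1) (fun l => (hnm l).2) hv hE,
    ⟨1 / 81, 4, by norm_num, by norm_num, fun _ _ hn hnm =>
      ⟨le_bestApproxError_modelU hn (hn.trans hnm), bestApproxError_modelU_le hn hnm⟩⟩,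
    ⟨1 / 7680, 60, 2000, by norm_num, by norm_num,
      fun _ _ hn hnm => consistencyError_modelU_le hn hnm,
      fun _ _ hn hnm => le_consistencyError_modelU hn hnm⟩⟩

open NonconformingP1 in
theorem theorem3 :
    (∀ n m : ℕ, 1 ≤ n → n ≤ m → ∃! v, IsGalerkinSolution (babuskaAziz n m) modelF v) ∧
    (∃ c C : ℝ, 0 < c ∧ 0 < C ∧ ∀ n m : ℕ, 1 ≤ n → n ≤ m →
      ∀ v, IsGalerkinSolution (babuskaAziz n m) modelF v →
        c * min 1 ((m : ℝ) / (n : ℝ) ^ 2) ≤ brokenError (babuskaAziz n m) modelU v ∧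
        brokenError (babuskaAziz n m) modelU v ≤ C * min 1 ((m : ℝ) / (n : ℝ) ^ 2)) ∧
    (∀ n m : ℕ → ℕ, (∀ l, 1 ≤ n l ∧ n l ≤ m l) → Tendsto n atTop atTop →
      ∀ v : (l : ℕ) → Fin (2 * m l) × (Fin (n l) ⊕ Fin (n l + 1)) → (Plane →ᵃ[ℝ] ℝ),
        (∀ l, IsGalerkinSolution (babuskaAziz (n l) (m l)) modelF (v l)) →
        Tendsto (fun l => brokenError (babuskaAziz (n l) (m l)) modelU (v l)) atTop (𝓝 0) →
        Tendsto (fun l => (m l : ℝ) / (n l : ℝ) ^ 2) atTop (𝓝 0)) ∧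
    (∃ c C : ℝ, 0 < c ∧ 0 < C ∧ ∀ n m : ℕ, 1 ≤ n → n ≤ m →
      c / n ≤ bestApproxError (babuskaAziz n m) modelU ∧
      bestApproxError (babuskaAziz n m) modelU ≤ C / n) ∧
    (∃ (c C K : ℝ) (n₀ : ℕ), 0 < c ∧ 0 < C ∧
      (∀ n m : ℕ, 1 ≤ n → n ≤ m →
        consistencyError (babuskaAziz n m) modelU modelF ≤ C * min 1 ((m : ℝ) / (n : ℝ) ^ 2)) ∧
      (∀ n m : ℕ, 1 ≤ n → n ≤ m → n₀ ≤ n → K * n ≤ m →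
        c * min 1 ((m : ℝ) / (n : ℝ) ^ 2) ≤
          consistencyError (babuskaAziz n m) modelU modelF)) :=
  let ⟨hex, herr, hlim, hbest, c, C, n₀, hc, hC, hle, hge⟩ := theorem3_general
  ⟨fun n m hn hnm => hex n m hn (hn.trans hnm), herr, fun n m hnm _ => hlim n m hnm, hbest,
    c, C, 1, n₀, hc, hC, hle, fun n m _ hnm hn _ => hge n m hn hnm⟩
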